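/- **Setting.** For $n\ge 1$ let $Y_n$ be the number of key exchanges made by Hoare's Quickselect (FIND) on a uniformly random permutation $A[1..n]$ of $\{1,\dots,n\}$ when it selects a rank that is uniformly distributed on $\{1,\dots,n\}$ and independent of the permutation. Quickselect on $A[lo..hi]$ with rank $r$ stops if $lo\ge hi$. Otherwise it partitions the sub-array and continues with the left sub-list $A[lo..q]$ and rank $r$ if $r\le q-lo+1$, and with the right sub-list $A[q+1..hi]$ and rank $r-(q-lo+1)$ otherwise. The partition is as follows. Put $x=A[lo]$, $i=lo-1$, $j=hi+1$. Repeatedly, decrease $j$ by $1$ (at least once) until $A[j]\le x$, then increase $i$ by $1$ (at least once) until $A[i]\ge x$; if $i<j$, exchange $A[i]$ and $A[j]$ (one key exchange) and go on; otherwise stop and return $q=j$. For probability laws $\mu,\nu$ on $\mathbb R$ and $1\le p<\infty$ let $$\ell_p(\mu,\nu)=\inf\|W'-Z'\|_p,$$ the infimum being over all pairs $(W',Z')$ of random variables on a common probability space such that $W'$ has law $\mu$ and $Z'$ has law $\nu$; for random variables $W,Z$ let $\ell_p(W,Z)$ be the $\ell_p$-distance of their laws. **Theorem.** There is exactly one probability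 law on $\mathbb R$ such that a random variable $X$ with this law satisfies $$X\overset{d}{=}\sqrt U\,X+\sqrt U\,(1-\sqrt U),$$ where $U$ is uniformly distributed on $[0,1]$ and independent of $X$. For this $X$ and for all real $1\le p<\infty$ one has $\mathbb E|X|^p<\infty$ and, for all integers $n\ge 1$, $$\ell_p\Big(\frac{Y_n}{n},X\Big)\le \kappa_p\,n^{-1/2},\qquad \kappa_p=\frac{2p+3}{2p-1}\,(7+\tau_p),\qquad \tau_p=\Big(\frac12+\frac{\Gamma(p/2+1)}{2^{p/2+1}}\Big)^{1/p}.$$ -/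

import Mathlib

open MeasureTheory
open scoped ENNReal

/-! ### Hoare's partition and Quickselect, counting key exchanges

An array is a function `A : ℕ → ℕ` of which only the positions `1, …, n` are used. All loops are
written with a fuel argument which bounds the number of iterations and which, at the values used
below, never runs out: a scan inside `A[lo..hi]` needs at most `hi - i` moves, the index `j` of the
partitioning loop decreases strictly, and the length of the sub-array decreases strictly in every
recursive call. -/

/-- `repeat j ← j - 1 until A[j] ≤ x`, started at `j`; the final value of `j`. -/
def scanDown (A : ℕ → ℕ) (x : ℕ) : ℕ → ℕ
  | 0 => 0
  | j + 1 => if A j ≤ x then j else scanDown A x j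

/-- `repeat i ← i + 1 until A[i] ≥ x`, started at `i`, with at most `fuel` moves;
the final value of `i`. -/
def scanUp (A : ℕ → ℕ) (x : ℕ) : (fuel : ℕ) → (i : ℕ) → ℕ
  | 0, i => i
  | fuel + 1, i => if x ≤ A (i + 1) then i + 1 else scanUp A x fuel (i + 1)

/-- The main loop of Hoare's partitioning procedure with pivot value `x` on an array whose last
position is `hi`. Scan `j` down and `i` up; if the two indices have not met, exchange `A[i]` and
`A[j]` and go on, otherwise stop. Returns the rearranged array, the final index `j`, and the number
of exchanges performed, added to the initial value `t` of the counter. -/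
def partitionLoop (x hi : ℕ) :
    (fuel : ℕ) → (A : ℕ → ℕ) → (i j t : ℕ) → (ℕ → ℕ) × ℕ × ℕ
  | 0, A, _, j, t => (A, j, t)
  | fuel + 1, A, i, j, t =>
    let j' := scanDown A x j
    let i' := scanUp A x (hi - i) i
    if i' < j' then partitionLoop x hi fuel (A ∘ Equiv.swap i' j') i' j' (t + 1)
    else (A, j', t)

/-- Hoare's partitioning procedure on `A[lo..hi]` (`1 ≤ lo`) with pivot `A[lo]`. With output
`(A', q, t)`, the left sub-list is `A'[lo..q]`, the right sub-list is `A'[q+1..hi]`, and `t` is the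
number of key exchanges. -/
def hoarePartition (A : ℕ → ℕ) (lo hi : ℕ) : (ℕ → ℕ) × ℕ × ℕ :=
  partitionLoop (A lo) hi (hi + 1) A (lo - 1) (hi + 1) 0

/-- The number of key exchanges performed by Quickselect on `A[lo..hi]` when it selects the element
of rank `r` (`1 ≤ r ≤ hi - lo + 1`) of this sub-array. -/
def quickselectExchanges : (fuel : ℕ) → (A : ℕ → ℕ) → (lo hi r : ℕ) → ℕ
  | 0, _, _, _, _ => 0
  | fuel + 1, A, lo, hi, r =>
    if lo < hi then
      match hoarePartition A lo hi with
      | (A', q, t) =>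
        if r ≤ q - lo + 1 then t + quickselectExchanges fuel A' lo q r
        else t + quickselectExchanges fuel A' (q + 1) hi (r - (q - lo + 1))
    else 0

/-- The array `A[1..n]` with `A[k] = σ(k)`, where `σ` is a permutation of `{1, …, n}`
(`Fin n = {0, …, n - 1}` being shifted by one). -/
def arrayOfPerm {n : ℕ} (σ : Equiv.Perm (Fin n)) (k : ℕ) : ℕ :=
  if h : k - 1 < n then (σ ⟨k - 1, h⟩ : ℕ) + 1 else 0

/-- The number of key exchanges of Quickselect on the permutation `σ` of size `n`, selecting
rank `R + 1`. -/
def keyExchanges {n : ℕ} (σ : Equiv.Perm (Fin n)) (R : Fin n) : ℕ :=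
  quickselectExchanges n (arrayOfPerm σ) 1 n ((R : ℕ) + 1)

/-- The law of `Y_n / n`, where `Y_n` is the number of key exchanges of Quickselect on a uniformly
random permutation of size `n`, with an independent uniformly distributed rank. -/
noncomputable def scaledExchangesLaw (n : ℕ) [NeZero n] : Measure ℝ :=
  ((PMF.uniformOfFintype (Equiv.Perm (Fin n) × Fin n)).map
    (fun ω => (keyExchanges ω.1 ω.2 : ℝ) / (n : ℝ))).toMeasure

/-! ### The limit law, the minimal `ℓ_p` metric, and the constants -/

/-- `μ` is the law of a random variable `X` with `X = √U X + √U (1 - √U)` in distribution, where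
`U` is uniform on `[0, 1]` and independent of `X`. -/
def SolvesRDE (μ : Measure ℝ) : Prop :=
  μ = (μ.prod (volume.restrict (Set.Icc (0 : ℝ) 1))).map
    (fun z : ℝ × ℝ => √z.2 * z.1 + √z.2 * (1 - √z.2))

/-- The minimal `ℓ_p` distance of two laws on the real line: the infimum of `‖W' - Z'‖_p` over all
pairs `(W', Z')` with the given marginal laws. It takes values in `[0, ∞]`. -/
noncomputable def minimalLp (p : ℝ) (μ ν : Measure ℝ) : ℝ≥0∞ :=
  ⨅ (γ : Measure (ℝ × ℝ)) (_ : γ.map Prod.fst = μ ∧ γ.map Prod.snd = ν),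
    eLpNorm (fun z : ℝ × ℝ => z.1 - z.2) (ENNReal.ofReal p) γ

noncomputable def tauConst (p : ℝ) : ℝ :=
  (1 / 2 + Real.Gamma (p / 2 + 1) / (2 : ℝ) ^ (p / 2 + 1)) ^ (1 / p)

noncomputable def kappaConst (p : ℝ) : ℝ :=
  (2 * p + 3) / (2 * p - 1) * (7 + tauConst p)

/-!
The number of exchanges `Y` on a sub-array of length `m` is coupled with `m X`, recursively over the
sub-lists, where `X` has the law of the fixed point equation. The induction carries exponential
moments instead of moments: for all orders `0 ≤ l ≤ 4`, the expectations of `exp (l (Y - m X))` and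
`exp (-l (Y - m X))` are at most `exp (l² m / 8 + l (137 / 20) √m)`, up to a bounded factor
(`couplingBound`). Chernoff's bound at the order `l = 4 t / √n` turns this into the tail bound
`P (|Y - n X| ≥ (7 + t) √n) ≤ 2 exp (-2 t²)` (`tail_le`), and integration over the tails gives the
`L_p` norm, with `τ_p` as the norm of the excess over `7 √n` up to a factor `4^(1/p)`, which is at
most `(2 p + 3) / (2 p - 1)`. For `n < 50` the trivial bound `|Y - n X| ≤ n` suffices.

The recursion closes for the following reasons. If the pivot `x` is not the smallest key, the
partition exchanges once plus once for every larger key that sits in the future left sub-list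
(`hoarePartition_spec`). It commutes with permutations of the values that respect the comparisons
with the pivot (`hoarePartition_comp`), so that given the pivot and the number `T` of exchanges the
sub-lists are again random. The number `T - 1` is hypergeometric, up to an exception for the
smallest key, and Hoeffding's bound for sampling without replacement (`sum_perms_exp_le`) yields the
variance proxy. This is `l² m / 8` for partition and sub-list together, less a term of order `l²`. A
sub-list of length `i` occurs with the probability `2 i / (m (m - 1))`, which is the length of the
interval `(i (i - 1), i (i + 1)] / (m (m - 1))` of values of `U`. If `U` lies in this interval then
`m √U` differs from `i` by at most `1`, and `m √U (1 - √U)` is close to the mean of `T`. Hence one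
step contributes a bounded error to `Y - m X` (`generic_upper`, `generic_lower`). This error is paid
for by the decrease from `√m` to `√i`, on average over `i` (`sum_step_le`).

If the smallest key stands in front, the first partition makes no exchange and removes one key only.
The next partition is then taken into the same step (`step_of_eq`), and such arrays are allowed the
additional factor `exp (l - l² / 8)` for negative orders. That factor also has to be granted to the
sub-lists, whose first element may be the smallest. Their values other than the smallest are
permuted at random while the position of the smallest stays fixed; this is why the induction
hypothesis is a statement on all blocks.

A solution of the fixed point equation is the law of the perpetuity `∑ₙ √U₀ ⋯ √Uₙ₋₁ √Uₙ (1 - √Uₙ)`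
of independent uniform variables, which takes values in `[0, 1]` (`solvesRDE_fixedLaw`). It is
unique (`SolvesRDE.unique`), since the difference `δ` of the characteristic functions of two
solutions satisfies `|δ t| ≤ ∫ |δ (t √u)| du`, so that its maximum over a symmetric interval is
attained at `0`, where `δ` vanishes.
-/


/-! ### Hoare's partition: correctness and equivariance -/

lemma scanDown_comp {π : Equiv.Perm ℕ} {x : ℕ} (h : ∀ v, π v ≤ x ↔ v ≤ x) (A : ℕ → ℕ) (j : ℕ) :
    scanDown (π ∘ A) x j = scanDown A x j := by
  induction j with
  | zero => rfl
  | succ j ih => simp only [scanDown, Function.comp, h]; rw [← ih]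

lemma scanUp_comp {π : Equiv.Perm ℕ} {x : ℕ} (h : ∀ v, x ≤ π v ↔ x ≤ v) (A : ℕ → ℕ) (f i : ℕ) :
    scanUp (π ∘ A) x f i = scanUp A x f i := by
  induction f generalizing i with
  | zero => rfl
  | succ f ih => simp only [scanUp, Function.comp, h]; rw [← ih]

lemma partitionLoop_comp {π : Equiv.Perm ℕ} {x : ℕ} (h₁ : ∀ v, π v ≤ x ↔ v ≤ x)
    (h₂ : ∀ v, x ≤ π v ↔ x ≤ v) (hi f : ℕ) (A : ℕ → ℕ) (i j t : ℕ) :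
    partitionLoop x hi f (π ∘ A) i j t =
      (π ∘ (partitionLoop x hi f A i j t).1, (partitionLoop x hi f A i j t).2) := by
  induction f generalizing A i j t with
  | zero => rfl
  | succ f ih =>
    simp only [partitionLoop, scanDown_comp h₁, scanUp_comp h₂]
    split_ifs
    · rw [Function.comp_assoc, ih]
    · rfl

/-- The partition only compares keys with the pivot, so it commutes with every permutation of the
values that respects the comparisons with the pivot. -/
lemma hoarePartition_comp {π : Equiv.Perm ℕ} {A : ℕ → ℕ} {lo : ℕ} (h₁ : ∀ v, π v ≤ A lo ↔ v ≤ A lo)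
    (h₂ : ∀ v, A lo ≤ π v ↔ A lo ≤ v) (hi : ℕ) :
    hoarePartition (π ∘ A) lo hi =
      (π ∘ (hoarePartition A lo hi).1, (hoarePartition A lo hi).2) := by
  have h : (π ∘ A) lo = A lo :=
    le_antisymm ((h₁ (A lo)).2 le_rfl) ((h₂ (A lo)).2 le_rfl)
  unfold hoarePartition
  rw [h]
  exact partitionLoop_comp h₁ h₂ _ _ _ _ _ _

/-- Downward scan: some position `k` below the start holds a key at most `x`, so the scan stops, at
the first such position. -/
lemma scanDown_spec {A : ℕ → ℕ} {x j k : ℕ} (hk : k < j) (hA : A k ≤ x) :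
    k ≤ scanDown A x j ∧ scanDown A x j < j ∧ A (scanDown A x j) ≤ x ∧
      ∀ p, scanDown A x j < p → p < j → x < A p := by
  induction j with
  | zero => omega
  | succ j ih =>
    simp only [scanDown]
    split_ifs with h
    · exact ⟨by omega, by omega, h, fun p _ _ => by omega⟩
    · have hkj : k < j := by
        rcases Nat.lt_succ_iff_lt_or_eq.1 hk with h' | h'
        · exact h'
        · subst h'; exact absurd hA h
      obtain ⟨h1, h2, h3, h4⟩ := ih hkj
      refine ⟨h1, by omega, h3, fun p hp hp' => ?_⟩
      rcases Nat.lt_succ_iff_lt_or_eq.1 hp' with h' | h'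
      · exact h4 p hp h'
      · subst h'; omega

/-- Upward scan: some position `k` within reach of the fuel `f` holds a key at least `x`, so the
scan stops, at the first such position. -/
lemma scanUp_spec {A : ℕ → ℕ} {x f i k : ℕ} (hk : i < k) (hkf : k ≤ i + f) (hA : x ≤ A k) :
    i < scanUp A x f i ∧ scanUp A x f i ≤ k ∧ x ≤ A (scanUp A x f i) ∧
      ∀ p, i < p → p < scanUp A x f i → A p < x := by
  induction f generalizing i with
  | zero => omega
  | succ f ih =>
    simp only [scanUp]
    split_ifs with h
    · exact ⟨by omega, by omega, h, fun p _ _ => by omega⟩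
    · have hkj : i + 1 < k := by
        rcases (Nat.succ_le_of_lt hk).lt_or_eq with h' | h'
        · exact h'
        · subst h'; exact absurd hA h
      obtain ⟨h1, h2, h3, h4⟩ := ih hkj (by omega)
      refine ⟨by omega, h2, h3, fun p hp hp' => ?_⟩
      rcases (Nat.succ_le_of_lt hp).lt_or_eq with h' | h'
      · exact h4 p h' hp'
      · obtain rfl : p = i + 1 := h'.symm
        omega

/-- `A[lo..hi]` contains exactly the keys `lo, …, hi`. -/
abbrev IsBlock (A : ℕ → ℕ) (lo hi : ℕ) : Prop := Set.BijOn A (Set.Icc lo hi) (Set.Icc lo hi)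

lemma IsBlock.eq_of_eq {A : ℕ → ℕ} {lo hi p q : ℕ} (h : IsBlock A lo hi) (hp : lo ≤ p)
    (hp' : p ≤ hi) (hq : lo ≤ q) (hq' : q ≤ hi) (e : A p = A q) : p = q :=
  h.injOn ⟨hp, hp'⟩ ⟨hq, hq'⟩ e

lemma isBlock_of_mapsTo {A : ℕ → ℕ} {lo hi : ℕ} (h₁ : Set.MapsTo A (Set.Icc lo hi) (Set.Icc lo hi))
    (h₂ : Set.InjOn A (Set.Icc lo hi)) : IsBlock A lo hi := by
  refine ⟨h₁, h₂, ?_⟩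
  have := Finset.surjOn_of_injOn_of_card_le (s := Finset.Icc lo hi) (t := Finset.Icc lo hi) A
    (by simpa using h₁) (by simpa using h₂) le_rfl
  simpa using this

lemma IsBlock.comp_perm {A : ℕ → ℕ} {lo hi : ℕ} (h : IsBlock A lo hi) {π : Equiv.Perm ℕ}
    (hπ : ∀ v, v ∉ Set.Icc lo hi → π v = v) : IsBlock (π ∘ A) lo hi := by
  refine isBlock_of_mapsTo (fun p hp => ?_) (π.injective.injOn.comp h.injOn (Set.mapsTo_univ _ _))
  by_contra hc
  have : π (π (A p)) = π (A p) := hπ _ hc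
  have h2 := π.injective this
  simp only [Function.comp] at hc
  rw [h2] at hc
  exact hc (h.mapsTo hp)

lemma IsBlock.comp_swap {A : ℕ → ℕ} {lo hi i j : ℕ} (h : IsBlock A lo hi) (hi' : i ∈ Set.Icc lo hi)
    (hj : j ∈ Set.Icc lo hi) : IsBlock (A ∘ Equiv.swap i j) lo hi := by
  have hs : Set.MapsTo (Equiv.swap i j) (Set.Icc lo hi) (Set.Icc lo hi) := by
    intro p hp
    rw [Equiv.swap_apply_def]
    split_ifs <;> assumption
  exact isBlock_of_mapsTo (h.mapsTo.comp hs) (h.injOn.comp (Equiv.injective _).injOn hs)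

/-- The main loop from its second round on. The keys up to position `i` are smaller than the pivot,
those from position `j` on are not, so both scans meet a sentinel and no index leaves the sub-array.
The exchanges still to come are counted by the large keys which have yet to leave the left part:
each exchange removes exactly one of them. -/
lemma partitionLoop_spec {x lo hi : ℕ} (f : ℕ) (A : ℕ → ℕ) (i j t : ℕ) (hf : j ≤ f) (hlo : lo ≤ i)
    (hij : i < j) (hj : j ≤ hi) (hA : IsBlock A lo hi) (hs : ∀ p, lo ≤ p → p ≤ i → A p < x)
    (hb : ∀ p, j ≤ p → p ≤ hi → x ≤ A p) (hx : ∃ p, j ≤ p ∧ p ≤ hi ∧ A p = x) :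
    ∃ A' q c, partitionLoop x hi f A i j t = (A', q, t + c) ∧ i ≤ q ∧ q < j ∧ IsBlock A' lo hi ∧
      (∀ p, lo ≤ p → p ≤ q → A' p < x) ∧ (∀ p, q < p → p ≤ hi → x ≤ A' p) ∧
      c = ((Finset.Ioc i q).filter fun p => x ≤ A p).card := by
  induction f generalizing A i j t with
  | zero => omega
  | succ f ih =>
    obtain ⟨hd1, hd2, hd3, hd4⟩ := scanDown_spec (A := A) (x := x) hij (hs i hlo le_rfl).le
    obtain ⟨hu1, hu2, hu3, hu4⟩ := scanUp_spec (A := A) (x := x) (f := hi - i) hij (by omega)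
      (hb j le_rfl hj)
    simp only [partitionLoop]
    set j' := scanDown A x j
    set i' := scanUp A x (hi - i) i
    -- the key `x` sits at or beyond position `j`, hence not where the downward scan stops
    have hjx : A j' < x := by
      refine lt_of_le_of_ne hd3 fun h => ?_
      obtain ⟨p, hp1, hp2, hp3⟩ := hx
      have := hA.eq_of_eq (p := j') (q := p) (by omega) (by omega) (by omega) (by omega)
        (by rw [h, hp3])
      omega
    split_ifs with hlt
    · obtain ⟨A', q, c, h1, h2, h3, h4, h5, h6, h7⟩ := ih (A ∘ Equiv.swap i' j') i' j' (t + 1)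
        (by omega) (by omega) hlt (by omega)
        (hA.comp_swap ⟨by omega, by omega⟩ ⟨by omega, by omega⟩)
        (fun p hp hp' => by
          rcases hp'.lt_or_eq with h | h
          · rw [Function.comp, Equiv.swap_apply_of_ne_of_ne (by omega) (by omega)]
            rcases le_or_gt p i with h' | h'
            · exact hs p hp h'
            · exact hu4 p h' h
          · subst h; simpa using hjx)
        (fun p hp hp' => by
          rcases hp.lt_or_eq with h | h
          · rw [Function.comp, Equiv.swap_apply_of_ne_of_ne (by omega) (by omega)]
            rcases lt_or_ge p j with h' | h'
            · exact (hd4 p h h').le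
            · exact hb p h' hp'
          · subst h; simpa using hu3)
        (by
          obtain ⟨p, hp1, hp2, hp3⟩ := hx
          rcases eq_or_ne i' j with h | h
          · omega
          · refine ⟨p, by omega, hp2, ?_⟩
            rw [Function.comp, Equiv.swap_apply_of_ne_of_ne (by omega) (by omega), hp3])
      refine ⟨A', q, c + 1, by rw [h1]; congr 2; omega, by omega, by omega, h4, h5, h6, ?_⟩
      have hset : ((Finset.Ioc i q).filter fun p => x ≤ A p) =
          insert i' ((Finset.Ioc i' q).filter fun p => x ≤ (A ∘ Equiv.swap i' j') p) := by
        ext p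
        simp only [Finset.mem_filter, Finset.mem_Ioc, Finset.mem_insert, Function.comp]
        rcases lt_trichotomy p i' with h | h | h
        · have : ¬ (i' < p) := by omega
          constructor
          · rintro ⟨⟨h8, h9⟩, h10⟩
            have := hu4 p h8 h
            omega
          · rintro (h8 | h8) <;> omega
        · subst h
          exact ⟨fun _ => Or.inl rfl, fun _ => ⟨⟨hu1, h2⟩, hu3⟩⟩
        · constructor
          · rintro ⟨⟨h8, h9⟩, h10⟩
            rw [Equiv.swap_apply_of_ne_of_ne (by omega) (by omega)]
            exact Or.inr ⟨⟨h, h9⟩, h10⟩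
          · rintro (h8 | ⟨⟨h8, h9⟩, h10⟩)
            · omega
            · rw [Equiv.swap_apply_of_ne_of_ne (by omega) (by omega)] at h10
              exact ⟨⟨by omega, h9⟩, h10⟩
      rw [hset, Finset.card_insert_of_notMem (by simp), ← h7]
    · have hne : i' ≠ j' := fun h => by rw [h] at hu3; omega
      refine ⟨A, j', 0, rfl, hd1, hd2, hA, fun p hp hp' => ?_, fun p hp hp' => ?_, ?_⟩
      · rcases le_or_gt p i with h' | h'
        · exact hs p hp h'
        · exact hu4 p h' (by omega)
      · rcases lt_or_ge p j with h' | h'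
        · exact (hd4 p hp h').le
        · exact hb p h' hp'
      · symm
        rw [Finset.card_eq_zero, Finset.filter_eq_empty_iff]
        intro p hp
        rw [Finset.mem_Ioc] at hp
        have := hu4 p hp.1 (by omega)
        omega

/-- The number of keys larger than the pivot which sit, inside the future left sub-list, behind its
first position. Each of them costs one exchange. -/
def bigsLeft (A : ℕ → ℕ) (lo : ℕ) : ℕ :=
  ((Finset.Ioc lo (A lo - 1)).filter fun p => A lo < A p).card

/-- Hoare's partition when the pivot is not the smallest key. The first exchange moves the pivot out
of the first position into the right part; each further one removes a key counted by `bigsLeft`. -/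
lemma hoarePartition_spec {A : ℕ → ℕ} {lo hi : ℕ} (hlo : 1 ≤ lo) (hlt : lo < hi)
    (hA : IsBlock A lo hi) (hx : A lo ≠ lo) :
    ∃ A', hoarePartition A lo hi = (A', A lo - 1, 1 + bigsLeft A lo) ∧
      IsBlock A' lo (A lo - 1) ∧ IsBlock A' (A lo) hi := by
  have hxm := hA.mapsTo (Set.left_mem_Icc.2 hlt.le)
  obtain ⟨p₀, hp₀, hp₀'⟩ := hA.surjOn (Set.left_mem_Icc.2 hlt.le)
  rw [Set.mem_Icc] at hxm hp₀
  have hp₀lo : p₀ ≠ lo := by rintro rfl; exact hx hp₀'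
  obtain ⟨hd1, hd2, hd3, hd4⟩ := scanDown_spec (A := A) (x := A lo) (j := hi + 1) (k := p₀)
    (by omega) (by omega)
  have hup : scanUp A (A lo) (hi - (lo - 1)) (lo - 1) = lo := by
    obtain ⟨f, hf⟩ : ∃ f, hi - (lo - 1) = f + 1 := ⟨hi - lo, by omega⟩
    rw [hf, scanUp, Nat.sub_add_cancel hlo, if_pos le_rfl]
  have hunf : hoarePartition A lo hi =
      partitionLoop (A lo) hi hi (A ∘ Equiv.swap lo (scanDown A (A lo) (hi + 1))) lo
        (scanDown A (A lo) (hi + 1)) (0 + 1) := by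
    rw [hoarePartition, partitionLoop]
    simp only [hup]
    rw [if_pos (by omega)]
  set j' := scanDown A (A lo) (hi + 1)
  have hne : ∀ p, lo < p → p ≤ hi → A p ≠ A lo := fun p hp hp' h => by
    have := hA.eq_of_eq (p := p) (q := lo) (by omega) (by omega) (by omega) (by omega) h
    omega
  obtain ⟨A', q, c, h1, h2, h3, h4, h5, h6, h7⟩ := partitionLoop_spec (x := A lo) (lo := lo)
    (hi := hi) hi (A ∘ Equiv.swap lo j') lo j' (0 + 1) (by omega) le_rfl (by omega) (by omega)
    (hA.comp_swap ⟨by omega, by omega⟩ ⟨by omega, by omega⟩)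
    (fun p hp hp' => by
      obtain rfl : p = lo := by omega
      have := hne j' (by omega) (by omega)
      simp only [Function.comp, Equiv.swap_apply_left]; omega)
    (fun p hp hp' => by
      rcases hp.lt_or_eq with h | h
      · rw [Function.comp, Equiv.swap_apply_of_ne_of_ne (by omega) (by omega)]
        exact (hd4 p h (by omega)).le
      · subst h; simp)
    ⟨j', le_rfl, by omega, by simp⟩
  have hl : Set.MapsTo A' (Set.Icc lo q) (Set.Ico lo (A lo)) := fun p hp =>
    ⟨(h4.mapsTo ⟨hp.1, by have := hp.2; omega⟩).1, h5 p hp.1 hp.2⟩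
  have hr : Set.MapsTo A' (Set.Ioc q hi) (Set.Icc (A lo) hi) := fun p hp =>
    ⟨h6 p hp.1 hp.2, (h4.mapsTo ⟨by have := hp.1; omega, hp.2⟩).2⟩
  have hli : Set.InjOn A' (Set.Icc lo q) := h4.injOn.mono (Set.Icc_subset_Icc le_rfl (by omega))
  have hri : Set.InjOn A' (Set.Ioc q hi) := h4.injOn.mono fun p (hp : q < p ∧ p ≤ hi) =>
    Set.mem_Icc.2 ⟨by omega, hp.2⟩
  have hcl := Finset.card_le_card_of_injOn (s := Finset.Icc lo q) (t := Finset.Ico lo (A lo)) A'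
    (by simpa using hl) (by simpa using hli)
  have hcr := Finset.card_le_card_of_injOn (s := Finset.Ioc q hi) (t := Finset.Icc (A lo) hi) A'
    (by simpa using hr) (by simpa using hri)
  simp only [Nat.card_Icc, Nat.card_Ico, Nat.card_Ioc] at hcl hcr
  -- counting the keys on both sides of `q` determines `q`
  have hq : q = A lo - 1 := by omega
  have hxq : A lo = q + 1 := by omega
  refine ⟨A', ?_, isBlock_of_mapsTo ?_ ?_, isBlock_of_mapsTo ?_ ?_⟩
  · rw [hunf, h1, h7, ← hq, bigsLeft, ← hq]
    congr 4
    refine Finset.filter_congr fun p hp => ?_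
    rw [Finset.mem_Ioc] at hp
    rw [Function.comp, Equiv.swap_apply_of_ne_of_ne (by omega) (by omega)]
    have := hne p hp.1 (by omega)
    omega
  · rw [← hq]; intro p hp; have := hl hp; rw [Set.mem_Ico] at this; exact ⟨this.1, by omega⟩
  · rw [← hq]; exact hli
  · intro p hp; rw [Set.mem_Icc] at hp; exact hr ⟨by omega, hp.2⟩
  · refine hri.mono fun p hp => ?_
    rw [Set.mem_Icc] at hp
    exact ⟨by omega, hp.2⟩

/-- Hoare's partition when the pivot is the smallest key: no exchange is made. -/
lemma hoarePartition_of_eq {A : ℕ → ℕ} {lo hi : ℕ} (hlo : 1 ≤ lo) (hlt : lo < hi)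
    (hA : IsBlock A lo hi) (hx : A lo = lo) : hoarePartition A lo hi = (A, lo, 0) := by
  obtain ⟨hd1, hd2, hd3, hd4⟩ := scanDown_spec (A := A) (x := A lo) (j := hi + 1) (k := lo)
    (by omega) le_rfl
  have hup : scanUp A (A lo) (hi - (lo - 1)) (lo - 1) = lo := by
    obtain ⟨f, hf⟩ : ∃ f, hi - (lo - 1) = f + 1 := ⟨hi - lo, by omega⟩
    rw [hf, scanUp, Nat.sub_add_cancel hlo, if_pos le_rfl]
  have hj : scanDown A (A lo) (hi + 1) = lo := by
    have h1 := hA.mapsTo (x := scanDown A (A lo) (hi + 1)) ⟨hd1, by omega⟩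
    rw [Set.mem_Icc] at h1
    exact hA.injOn ⟨hd1, by omega⟩ ⟨le_rfl, hlt.le⟩ (by omega)
  rw [hoarePartition, partitionLoop]
  simp only [hup, hj, lt_irrefl, if_false]

lemma quickselectExchanges_succ {A : ℕ → ℕ} {lo hi : ℕ} (hlt : lo < hi) (f r : ℕ) {A' : ℕ → ℕ}
    {q t : ℕ} (h : hoarePartition A lo hi = (A', q, t)) :
    quickselectExchanges (f + 1) A lo hi r =
      if r ≤ q - lo + 1 then t + quickselectExchanges f A' lo q r
      else t + quickselectExchanges f A' (q + 1) hi (r - (q - lo + 1)) := by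
  rw [quickselectExchanges, if_pos hlt, h]

lemma quickselectExchanges_of_le {A : ℕ → ℕ} {lo hi : ℕ} (h : hi ≤ lo) (f r : ℕ) :
    quickselectExchanges f A lo hi r = 0 := by
  cases f with
  | zero => rfl
  | succ f => rw [quickselectExchanges, if_neg (by omega)]

lemma bigsLeft_add_le {A : ℕ → ℕ} {lo hi : ℕ} (hlt : lo < hi) (hA : IsBlock A lo hi)
    (hx : A lo ≠ lo) : bigsLeft A lo + 1 + lo ≤ A lo ∧ bigsLeft A lo + A lo ≤ hi := by
  have hxm := hA.mapsTo (Set.left_mem_Icc.2 hlt.le)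
  rw [Set.mem_Icc] at hxm
  constructor
  · have := Finset.card_filter_le (Finset.Ioc lo (A lo - 1)) fun p => A lo < A p
    rw [Nat.card_Ioc] at this
    unfold bigsLeft
    omega
  · have := Finset.card_le_card_of_injOn
      (s := (Finset.Ioc lo (A lo - 1)).filter fun p => A lo < A p)
      (t := Finset.Ioc (A lo) hi) A
      (fun p hp => by
        simp only [Finset.coe_filter, Finset.mem_Ioc, Set.mem_ofPred_eq] at hp
        have := hA.mapsTo (x := p) ⟨by omega, by omega⟩
        simp only [Finset.coe_Ioc, Set.mem_Ioc]
        exact ⟨hp.2, this.2⟩)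
      (hA.injOn.mono fun p hp => by
        simp only [Finset.coe_filter, Finset.mem_Ioc, Set.mem_ofPred_eq] at hp
        exact ⟨by omega, by omega⟩)
    rw [Nat.card_Ioc] at this
    unfold bigsLeft
    omega

/-- A partition makes at most as many exchanges as the sub-array gets shorter, so Quickselect makes
at most as many exchanges as there are keys. -/
lemma quickselectExchanges_le {A : ℕ → ℕ} {lo hi : ℕ} (f r : ℕ) (hlo : 1 ≤ lo)
    (hA : IsBlock A lo hi) : quickselectExchanges f A lo hi r ≤ hi + 1 - lo := by
  induction f generalizing A lo hi r with
  | zero => exact Nat.zero_le _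
  | succ f ih =>
    rcases le_or_gt hi lo with h | hlt
    · rw [quickselectExchanges_of_le h]; exact Nat.zero_le _
    by_cases hx : A lo = lo
    · rw [quickselectExchanges_succ hlt f r (hoarePartition_of_eq hlo hlt hA hx)]
      split_ifs
      · rw [quickselectExchanges_of_le le_rfl]; omega
      · have := ih (r - (lo - lo + 1)) (by omega) (A := A) (lo := lo + 1) (hi := hi)
          (isBlock_of_mapsTo (fun p hp => by
            rw [Set.mem_Icc] at hp
            have h1 := hA.mapsTo (x := p) ⟨by omega, by omega⟩
            have h2 : A p ≠ lo := fun h => by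
              have := hA.eq_of_eq (p := p) (q := lo) (by omega) (by omega) (by omega) (by omega)
                (by omega)
              omega
            rw [Set.mem_Icc] at h1 ⊢
            omega) (hA.injOn.mono fun p hp => by
              rw [Set.mem_Icc] at hp ⊢; omega))
        omega
    · obtain ⟨A', h1, h2, h3⟩ := hoarePartition_spec hlo hlt hA hx
      obtain ⟨hb1, hb2⟩ := bigsLeft_add_le hlt hA hx
      rw [quickselectExchanges_succ hlt f r h1]
      have hxm := hA.mapsTo (Set.left_mem_Icc.2 hlt.le)
      rw [Set.mem_Icc] at hxm
      have e : A lo - 1 + 1 = A lo := by omega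
      split_ifs
      · have := ih r hlo h2
        omega
      · have := ih (r - (A lo - 1 - lo + 1)) (by omega) h3
        rw [e]
        omega

/-! ### Sums over permutations of a finite set of keys, and a Hoeffding bound -/

section PermSums

variable {M : Type*} [AddCommMonoid M]

lemma mem_perms {s : Finset ℕ} {π : Equiv.Perm ℕ} :
    π ∈ permsOfFinset s ↔ ∀ v, v ∉ s → π v = v := by
  rw [mem_perms_of_finset_iff]
  exact ⟨fun h v hv => by_contra fun hc => hv (h hc), fun h v hv => by_contra fun hc => hv (h v hc)⟩

lemma perms_apply_mem {s : Finset ℕ} {π : Equiv.Perm ℕ} (h : π ∈ permsOfFinset s) {v : ℕ} :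
    π v ∈ s ↔ v ∈ s := by
  rw [mem_perms] at h
  constructor
  · intro hv
    by_contra hc
    rw [h v hc] at hv
    exact hc hv
  · intro hv
    by_contra hc
    have := π.injective (h _ hc)
    rw [this] at hc
    exact hc hv

lemma perms_mul {s : Finset ℕ} {π ρ : Equiv.Perm ℕ} (hπ : π ∈ permsOfFinset s)
    (hρ : ρ ∈ permsOfFinset s) : π * ρ ∈ permsOfFinset s := by
  rw [mem_perms] at *
  intro v hv
  rw [Equiv.Perm.mul_apply, hρ v hv, hπ v hv]

lemma perms_inv {s : Finset ℕ} {π : Equiv.Perm ℕ} (hπ : π ∈ permsOfFinset s) :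
    π⁻¹ ∈ permsOfFinset s := by
  rw [mem_perms] at *
  intro v hv
  rw [Equiv.Perm.inv_eq_iff_eq, hπ v hv]

lemma perms_mono {s t : Finset ℕ} (h : s ⊆ t) {π : Equiv.Perm ℕ} (hπ : π ∈ permsOfFinset s) :
    π ∈ permsOfFinset t := by
  rw [mem_perms] at *
  exact fun v hv => hπ v fun hc => hv (h hc)

/-- A permutation of `s` is determined by the image `b` of `a` and a permutation of `s \ {b}`. -/
lemma sum_perms_erase {s : Finset ℕ} {a : ℕ} (ha : a ∈ s) (F : Equiv.Perm ℕ → M) :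
    ∑ π ∈ permsOfFinset s, F π =
      ∑ b ∈ s, ∑ π ∈ permsOfFinset (s.erase b), F (π * Equiv.swap a b) := by
  rw [Finset.sum_sigma']
  symm
  refine Finset.sum_bij' (fun x _ => x.2 * Equiv.swap a x.1)
    (fun π _ => ⟨π a, π * Equiv.swap a (π a)⟩) ?_ ?_ ?_ ?_ ?_
  · rintro ⟨b, π⟩ h
    simp only [Finset.mem_sigma] at h
    refine perms_mul (perms_mono (Finset.erase_subset _ _) h.2) (mem_perms.2 fun v hv => ?_)
    exact Equiv.swap_apply_of_ne_of_ne (by rintro rfl; exact hv ha)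
      (by rintro rfl; exact hv h.1)
  · intro π h
    have hb : π a ∈ s := (perms_apply_mem h).2 ha
    refine Finset.mem_sigma.2 ⟨hb, mem_perms.2 fun v hv => ?_⟩
    rw [Finset.mem_erase, not_and_or, not_not] at hv
    rw [Equiv.Perm.mul_apply]
    by_cases hv' : v = π a
    · subst hv'; rw [Equiv.swap_apply_right]
    · have hvs : v ∉ s := hv.resolve_left hv'
      rw [Equiv.swap_apply_of_ne_of_ne (by rintro rfl; exact hvs ha) hv']
      exact mem_perms.1 h v hvs
  · rintro ⟨b, π⟩ h
    simp only [Finset.mem_sigma] at h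
    have : π b = b := mem_perms.1 h.2 b (Finset.notMem_erase _ _)
    simp [this, mul_assoc]
  · intro π _
    simp [mul_assoc]
  · intros; rfl

lemma sum_perms_mul_left {s : Finset ℕ} {ρ : Equiv.Perm ℕ} (hρ : ρ ∈ permsOfFinset s)
    (F : Equiv.Perm ℕ → M) : ∑ π ∈ permsOfFinset s, F (ρ * π) = ∑ π ∈ permsOfFinset s, F π := by
  refine Finset.sum_bij' (fun π _ => ρ * π) (fun π _ => ρ⁻¹ * π) ?_ ?_ ?_ ?_ ?_
  · exact fun π h => perms_mul hρ h
  · exact fun π h => perms_mul (perms_inv hρ) h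
  · intros; simp
  · intros; simp
  · intros; rfl

lemma sum_perms_inv {s : Finset ℕ} (F : Equiv.Perm ℕ → M) :
    ∑ π ∈ permsOfFinset s, F π⁻¹ = ∑ π ∈ permsOfFinset s, F π := by
  refine Finset.sum_bij' (fun π _ => π⁻¹) (fun π _ => π⁻¹) ?_ ?_ ?_ ?_ ?_
  · exact fun π h => perms_inv h
  · exact fun π h => perms_inv h
  · intros; simp
  · intros; simp
  · intros; rfl

/-- A sum over permutations of `s` may first be averaged over the subgroup of permutations of a
subset `t`. -/
lemma sum_perms_coset {s t : Finset ℕ} (hts : t ⊆ s) (F : Equiv.Perm ℕ → ℝ≥0∞) :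
    ∑ π ∈ permsOfFinset s, F π =
      ∑ π ∈ permsOfFinset s, ((t.card.factorial : ℕ) : ℝ≥0∞)⁻¹ *
        ∑ ρ ∈ permsOfFinset t, F (ρ * π) := by
  rw [← Finset.mul_sum, Finset.sum_comm]
  rw [Finset.sum_congr rfl fun ρ hρ => sum_perms_mul_left (perms_mono hts hρ) F]
  rw [Finset.sum_const, card_perms_of_finset, nsmul_eq_mul, ← mul_assoc, ENNReal.inv_mul_cancel,
    one_mul]
  · exact_mod_cast (Nat.factorial_pos _).ne'
  · exact ENNReal.natCast_ne_top _

end PermSums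

/-- Hoeffding's lemma for a Bernoulli variable. -/
lemma bernoulli_mgf_le {q : ℝ} (hq0 : 0 ≤ q) (hq1 : q ≤ 1) (y : ℝ) :
    1 - q + q * Real.exp y ≤ Real.exp (q * y + y ^ 2 / 8) := by
  let P : Measure ℝ := ENNReal.ofReal (1 - q) • Measure.dirac 0 + ENNReal.ofReal q • Measure.dirac 1
  have hP : IsProbabilityMeasure P := by
    constructor
    simp only [P, Measure.add_apply, Measure.smul_apply, measure_univ, smul_eq_mul, mul_one]
    rw [← ENNReal.ofReal_add (by linarith) hq0]
    simp
  have hint : ∀ f : ℝ → ℝ, ∫ x, f x ∂P = (1 - q) * f 0 + q * f 1 := by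
    intro f
    have h0 : Integrable f (ENNReal.ofReal (1 - q) • Measure.dirac (0 : ℝ)) :=
      (integrable_dirac (by simp)).smul_measure ENNReal.ofReal_ne_top
    have h1 : Integrable f (ENNReal.ofReal q • Measure.dirac (1 : ℝ)) :=
      (integrable_dirac (by simp)).smul_measure ENNReal.ofReal_ne_top
    rw [integral_add_measure h0 h1]
    simp only [integral_smul_measure, integral_dirac, smul_eq_mul]
    rw [ENNReal.toReal_ofReal (by linarith), ENNReal.toReal_ofReal hq0]
  have h := (ProbabilityTheory.hasSubgaussianMGF_of_mem_Icc (μ := P) (X := fun x : ℝ => x)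
    (a := 0) (b := 1) (by fun_prop) (by
      rw [ae_iff]
      simp [P])).mgf_le y
  rw [ProbabilityTheory.mgf, hint, hint] at h
  simp only [mul_zero, mul_one, zero_add, sub_zero, zero_sub] at h
  have e : q * y + y ^ 2 / 8 = q * y + ((‖(1 : ℝ)‖₊ / 2) ^ 2 : NNReal) * y ^ 2 / 2 := by
    simp; ring
  rw [e, Real.exp_add]
  refine le_trans (le_of_eq ?_) (mul_le_mul_of_nonneg_left h (Real.exp_pos _).le)
  rw [mul_add, mul_left_comm, ← Real.exp_add, mul_left_comm (Real.exp _) q, ← Real.exp_add]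
  ring_nf
  simp only [Real.exp_zero]
  ring

/-- Hoeffding's bound for the hypergeometric distribution, in the form of the number of elements of
`S` that a random permutation of `s` sends to `T`. -/
lemma sum_perms_exp_le {s S T : Finset ℕ} (hS : S ⊆ s) (hT : T ⊆ s) (l : ℝ) :
    ∑ π ∈ permsOfFinset s, Real.exp (l * ((S.filter fun v => π v ∈ T).card : ℝ)) ≤
      s.card.factorial * Real.exp (l * (S.card * T.card / s.card) + l ^ 2 * S.card / 8) := by
  induction hd : S.card generalizing s S T with
  | zero =>
    rw [Finset.card_eq_zero] at hd
    subst hd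
    simp [card_perms_of_finset]
  | succ d ih =>
    obtain ⟨a, ha⟩ : S.Nonempty := by rw [← Finset.card_pos]; omega
    have has := hS ha
    rw [sum_perms_erase has]
    set L : ℝ := (s.card : ℝ) with hL
    set K : ℝ := (T.card : ℝ) with hK
    have hL1 : (1 : ℝ) ≤ L := by
      rw [hL]; exact_mod_cast Finset.card_pos.2 ⟨a, has⟩
    have hKL : K ≤ L := by rw [hK, hL]; exact_mod_cast Finset.card_le_card hT
    have hK0 : 0 ≤ K := by positivity
    have hcard : ∀ b ∈ s, ((s.erase b).card : ℝ) = L - 1 := fun b hb => by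
      rw [Finset.card_erase_of_mem hb, Nat.cast_sub (Finset.card_pos.2 ⟨b, hb⟩)]; simp [hL]
    have hdL : (d : ℝ) ≤ L - 1 := by
      have := Finset.card_le_card hS
      have h2 : (d : ℝ) + 1 ≤ L := by rw [hL]; exact_mod_cast hd ▸ this
      linarith
    have hfac : ∀ b ∈ s, (s.erase b).card.factorial = (s.card - 1).factorial := fun b hb => by
      rw [Finset.card_erase_of_mem hb]
    -- if `a` is sent to `b`, the other `d` elements of `S` are moved by a random permutation of
    -- `s.erase b`, with one element less of `T` left to hit when `b ∈ T`
    have key : ∀ b ∈ s, ∀ k : ℝ, ((T.erase b).card : ℝ) = K - k → (k = if b ∈ T then 1 else 0) →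
        ∑ π ∈ permsOfFinset (s.erase b),
          Real.exp (l * ((S.filter fun v => (π * Equiv.swap a b) v ∈ T).card : ℝ)) ≤
        (s.card - 1).factorial *
          Real.exp (l * k + l * (d * (K - k) / (L - 1)) + l ^ 2 * d / 8) := by
      intro b hb k hk hk'
      have hsub : (S.erase a).image (Equiv.swap a b) ⊆ s.erase b := by
        intro w hw
        obtain ⟨v, hv, rfl⟩ := Finset.mem_image.1 hw
        rw [Finset.mem_erase] at hv ⊢
        refine ⟨fun e => hv.1 ?_, ?_⟩
        · exact (Equiv.swap a b).injective (e.trans (Equiv.swap_apply_left a b).symm)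
        · by_cases hvb : v = b
          · subst hvb; simpa using has
          · rw [Equiv.swap_apply_of_ne_of_ne hv.1 hvb]; exact hS hv.2
      have hc : ((S.erase a).image (Equiv.swap a b)).card = d := by
        rw [Finset.card_image_of_injective _ (Equiv.injective _), Finset.card_erase_of_mem ha, hd]
        rfl
      have h := ih hsub (Finset.erase_subset_erase b hT) hc
      rw [hfac b hb, hcard b hb, hk] at h
      calc _ = ∑ π ∈ permsOfFinset (s.erase b), Real.exp (l * k) * Real.exp (l *
            ((((S.erase a).image (Equiv.swap a b)).filter fun v => π v ∈ T.erase b).card : ℝ)) := by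
            refine Finset.sum_congr rfl fun π hπ => ?_
            have hpb : π b = b := mem_perms.1 hπ b (Finset.notMem_erase _ _)
            rw [← Real.exp_add, ← mul_add]
            congr 2
            have e1 : (S.filter fun v => (π * Equiv.swap a b) v ∈ T).card =
                (if b ∈ T then 1 else 0) +
                  ((S.erase a).filter fun v => (π * Equiv.swap a b) v ∈ T).card := by
              conv_lhs => rw [← Finset.insert_erase ha, Finset.filter_insert]
              have e : (π * Equiv.swap a b) a = b := by simp [hpb]
              rw [e]
              split_ifs
              · rw [Finset.card_insert_of_notMem fun hm =>
                  Finset.notMem_erase a S (Finset.mem_filter.1 hm).1]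
                ring
              · simp
            have e2 : (((S.erase a).image (Equiv.swap a b)).filter fun v => π v ∈ T.erase b) =
                ((S.erase a).filter fun v => (π * Equiv.swap a b) v ∈ T).image
                  (Equiv.swap a b) := by
              rw [Finset.filter_image]
              congr 1
              refine Finset.filter_congr fun v hv => ?_
              rw [Finset.mem_erase] at hv
              simp only [Finset.mem_erase, Equiv.Perm.mul_apply, and_iff_right_iff_imp]
              intro _ e
              have e' := π.injective (e.trans hpb.symm)
              exact hv.1 ((Equiv.swap a b).injective (e'.trans (Equiv.swap_apply_left a b).symm))
            rw [e1, e2, Finset.card_image_of_injective _ (Equiv.injective _), hk']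
            push_cast
            rfl
        _ ≤ Real.exp (l * k) * ((s.card - 1).factorial *
              Real.exp (l * (d * (K - k) / (L - 1)) + l ^ 2 * d / 8)) := by
            rw [← Finset.mul_sum]
            exact mul_le_mul_of_nonneg_left h (Real.exp_pos _).le
        _ = _ := by
            rw [mul_left_comm, ← Real.exp_add]; congr 2; ring
    have hfs : (s.card.factorial : ℝ) = L * (s.card - 1).factorial := by
      rw [hL]
      exact_mod_cast (Nat.mul_factorial_pred (Finset.card_pos.2 ⟨a, has⟩).ne').symm
    have hsum : ∑ b ∈ s, ∑ π ∈ permsOfFinset (s.erase b),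
          Real.exp (l * ((S.filter fun v => (π * Equiv.swap a b) v ∈ T).card : ℝ)) ≤
        ∑ b ∈ s, (s.card - 1).factorial * (if b ∈ T then
          Real.exp (l * 1 + l * (d * (K - 1) / (L - 1)) + l ^ 2 * d / 8) else
          Real.exp (l * 0 + l * (d * (K - 0) / (L - 1)) + l ^ 2 * d / 8)) := by
      refine Finset.sum_le_sum fun b hb => ?_
      split_ifs with hbT
      · exact key b hb 1 (by
          rw [Finset.card_erase_of_mem hbT, Nat.cast_sub (Finset.card_pos.2 ⟨b, hbT⟩)]
          simp [hK]) (by simp [hbT])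
      · exact key b hb 0 (by rw [Finset.erase_eq_of_notMem hbT]; simp [hK]) (by simp [hbT])
    refine hsum.trans ?_
    rw [← Finset.mul_sum, Finset.sum_ite, Finset.sum_const, Finset.sum_const,
      Finset.filter_mem_eq_inter, Finset.inter_eq_right.2 hT, hfs]
    have hcn : ((s.filter fun b => b ∉ T).card : ℝ) = L - K := by
      rw [Finset.filter_notMem_eq_sdiff, Finset.cast_card_sdiff hT]
    simp only [nsmul_eq_mul, hcn]
    rw [← hK, mul_comm L, mul_assoc]
    refine mul_le_mul_of_nonneg_left ?_ (by positivity)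
    -- the mean moves by at most one with each draw, which is Hoeffding's lemma for one step
    set D : ℝ := 1 - d / (L - 1) with hD
    have hD0 : 0 ≤ D := by
      rw [hD, sub_nonneg]; exact div_le_one_of_le₀ hdL (by linarith)
    have hD1 : D ≤ 1 := by
      rw [hD]; have : 0 ≤ (d : ℝ) / (L - 1) := div_nonneg (by positivity) (by linarith)
      linarith
    have hb := bernoulli_mgf_le (q := K / L) (by positivity) (div_le_one_of_le₀ hKL (by linarith))
      (l * D)
    set B : ℝ := l * (d * K / (L - 1)) + l ^ 2 * d / 8 with hB
    have e1 : l * 1 + l * (d * (K - 1) / (L - 1)) + l ^ 2 * d / 8 = l * D + B := by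
      rw [hD, hB]; ring
    have e2 : l * 0 + l * (d * (K - 0) / (L - 1)) + l ^ 2 * d / 8 = B := by
      rw [hB]; ring
    rw [e1, e2, Real.exp_add]
    have e3 : l * ((d + 1 : ℕ) * K / L) + l ^ 2 * (d + 1 : ℕ) / 8 =
        (K / L * (l * D) + l ^ 2 / 8) + B := by
      rw [hD, hB]
      push_cast
      rcases eq_or_ne L 1 with h1 | h1
      · have : (d : ℝ) = 0 := le_antisymm (by linarith) (by positivity)
        rw [h1, this]; ring
      · have : L - 1 ≠ 0 := sub_ne_zero.2 h1
        have : L ≠ 0 := by linarith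
        field_simp
        ring
    have h5 : Real.exp (K / L * (l * D) + (l * D) ^ 2 / 8) ≤
        Real.exp (K / L * (l * D) + l ^ 2 / 8) := by
      apply Real.exp_le_exp.2
      have : (l * D) ^ 2 ≤ l ^ 2 := by
        rw [mul_pow]
        exact mul_le_of_le_one_right (sq_nonneg _) (pow_le_one₀ hD0 hD1)
      linarith
    rw [e3, Real.exp_add _ B]
    have hLp : 0 < L := by linarith
    calc K * (Real.exp (l * D) * Real.exp B) + (L - K) * Real.exp B
        = L * ((1 - K / L + K / L * Real.exp (l * D)) * Real.exp B) := by field_simp; ring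
      _ ≤ L * (Real.exp (K / L * (l * D) + l ^ 2 / 8) * Real.exp B) := by
          gcongr
          exact hb.trans h5

/-- The symmetric form of `sum_perms_exp_le`, with the size of `T` as the variance proxy. -/
lemma sum_perms_exp_le' {s S T : Finset ℕ} (hS : S ⊆ s) (hT : T ⊆ s) (l : ℝ) :
    ∑ π ∈ permsOfFinset s, Real.exp (l * ((S.filter fun v => π v ∈ T).card : ℝ)) ≤
      s.card.factorial * Real.exp (l * (S.card * T.card / s.card) + l ^ 2 * T.card / 8) := by
  rw [← sum_perms_inv, mul_comm (S.card : ℝ)]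
  refine le_trans (le_of_eq (Finset.sum_congr rfl fun π hπ => ?_)) (sum_perms_exp_le hT hS l)
  congr 3
  refine Finset.card_bij' (fun v _ => π⁻¹ v) (fun v _ => π v) ?_ ?_ ?_ ?_
  all_goals simp +contextual

/-! ### Real inequalities for one step of the recursion -/

/-- The Laplace transform of the size lost in one step, when size `i` remains with probability
`2 i / (m (m - 1))`, is at most that of an exponential variable with mean `m / 3`. -/
lemma sum_mul_exp_le {θ : ℝ} (hθ : 0 ≤ θ) (m : ℕ) :
    (∑ i ∈ Finset.Ico 1 m, 2 * (i : ℝ) * Real.exp (-θ * (m - i))) * (1 + θ * m / 3) ≤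
      m * (m - 1) := by
  rcases Nat.eq_zero_or_pos m with rfl | hm
  · simp
  induction m, hm using Nat.le_induction with
  | base => simp
  | succ m hm ih =>
    have hS : ∑ i ∈ Finset.Ico 1 (m + 1), 2 * (i : ℝ) * Real.exp (-θ * ((m + 1 : ℕ) - i)) =
        Real.exp (-θ) * (∑ i ∈ Finset.Ico 1 m, 2 * (i : ℝ) * Real.exp (-θ * (m - i)) + 2 * m) := by
      rw [Finset.sum_Ico_succ_top hm, mul_add, Finset.mul_sum]
      congr 1
      · refine Finset.sum_congr rfl fun i _ => ?_
        rw [mul_left_comm, ← Real.exp_add]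
        congr 2; push_cast; ring
      · push_cast; rw [mul_comm]; congr 2; ring
    rw [hS]
    set S := ∑ i ∈ Finset.Ico 1 m, 2 * (i : ℝ) * Real.exp (-θ * (m - i))
    have hm1 : (1 : ℝ) ≤ m := by exact_mod_cast hm
    have ha : 0 < 1 + θ * m / 3 := by positivity
    have hq : Real.exp (-θ) * (1 + θ) ≤ 1 := by
      have := Real.add_one_le_exp θ
      calc _ ≤ Real.exp (-θ) * Real.exp θ := by gcongr; linarith
        _ = 1 := by rw [← Real.exp_add]; simp
    have hS' : S ≤ m * (m - 1) / (1 + θ * m / 3) := by rwa [le_div_iff₀ ha]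
    have h1 : (S + 2 * m) * (1 + θ * (m + 1) / 3) ≤ (1 + θ) * ((m + 1) * m) := by
      calc _ ≤ (m * (m - 1) / (1 + θ * m / 3) + 2 * m) * (1 + θ * (m + 1) / 3) := by gcongr
        _ = (m * (m + 1 + 2 * θ * m / 3) * (1 + θ * (m + 1) / 3)) / (1 + θ * m / 3) := by
          field_simp; ring
        _ ≤ _ := by
          -- the difference of the two sides is the polynomial with nonnegative coefficients below
          rw [div_le_iff₀ ha]
          have : 0 ≤ m * θ * (2 / 3 + θ * m / 9 + θ * m ^ 2 / 9) := by positivity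
          nlinarith [this]
    have h2 : 0 ≤ (m + 1 : ℝ) * m := by positivity
    push_cast
    calc _ = Real.exp (-θ) * ((S + 2 * m) * (1 + θ * (m + 1) / 3)) := by ring
      _ ≤ Real.exp (-θ) * ((1 + θ) * ((m + 1) * m)) := by gcongr
      _ = (Real.exp (-θ) * (1 + θ)) * ((m + 1) * m) := by ring
      _ ≤ 1 * ((m + 1) * m) := by gcongr
      _ = _ := by ring

/-- The polynomial `R` on the right satisfies `R' ≥ h' R` on `[0, 4]` for `h = 2 l - 3 l² / 8`, so
`R exp (-h)` increases from the value `1` at `l = 0`. -/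
lemma exp_le_quartic {l : ℝ} (h0 : 0 ≤ l) (h4 : l ≤ 4) :
    Real.exp (2 * l - 3 * l ^ 2 / 8) ≤
      1 + 2 * l + 13 / 8 * l ^ 2 + 18 / 25 * l ^ 3 - 6 / 25 * l ^ 4 := by
  let F : ℝ → ℝ := fun x => (1 + 2 * x + 13 / 8 * x ^ 2 + 18 / 25 * x ^ 3 - 6 / 25 * x ^ 4) *
    Real.exp (-(2 * x - 3 * x ^ 2 / 8))
  have hd : ∀ x : ℝ, HasDerivAt F ((x ^ 2 * (41 / 100 - 4725 / 4000 * x + 51 / 50 * x ^ 2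
      - 9 / 50 * x ^ 3)) * Real.exp (-(2 * x - 3 * x ^ 2 / 8))) x := by
    intro x
    have h1 : HasDerivAt (fun x : ℝ =>
        1 + 2 * x + 13 / 8 * x ^ 2 + 18 / 25 * x ^ 3 - 6 / 25 * x ^ 4)
        (2 + 13 / 4 * x + 54 / 25 * x ^ 2 - 24 / 25 * x ^ 3) x := by
      have := (((((hasDerivAt_id x).const_mul 2).const_add 1).add
        ((hasDerivAt_pow 2 x).const_mul (13 / 8))).add
        ((hasDerivAt_pow 3 x).const_mul (18 / 25))).sub ((hasDerivAt_pow 4 x).const_mul (6 / 25))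
      refine this.congr_deriv ?_
      push_cast
      ring
    have h2 : HasDerivAt (fun x : ℝ => -(2 * x - 3 * x ^ 2 / 8)) (-(2 - 3 / 4 * x)) x := by
      have := (((hasDerivAt_id x).const_mul 2).sub
        (((hasDerivAt_pow 2 x).const_mul 3).div_const 8)).neg
      refine this.congr_deriv ?_
      push_cast
      ring
    refine (h1.mul h2.exp).congr_deriv ?_
    ring
  have hmono : MonotoneOn F (Set.Icc 0 4) := by
    refine monotoneOn_of_deriv_nonneg (convex_Icc 0 4)
      (fun x _ => (hd x).continuousAt.continuousWithinAt)
      (fun x _ => (hd x).differentiableAt.differentiableWithinAt) fun x hx => ?_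
    rw [interior_Icc] at hx
    obtain ⟨hx0, hx4⟩ := hx
    rw [(hd x).deriv]
    refine mul_nonneg (mul_nonneg (sq_nonneg _) ?_) (Real.exp_pos _).le
    have h3 : x ^ 3 ≤ x ^ 2 * 1 ∨ 1 ≤ x := by
      rcases le_total x 1 with h | h
      · left; nlinarith [sq_nonneg x]
      · right; exact h
    rcases h3 with h | h
    · nlinarith [sq_nonneg (x - 7 / 10)]
    · nlinarith [mul_nonneg (sub_nonneg.2 h) (sub_nonneg.2 hx4.le),
        mul_nonneg (mul_nonneg (sub_nonneg.2 h) (sub_nonneg.2 hx4.le)) hx0.le]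
  have h := hmono (Set.left_mem_Icc.2 (by norm_num)) ⟨h0, h4⟩ h0
  have h1 : 1 ≤ (1 + 2 * l + 13 / 8 * l ^ 2 + 18 / 25 * l ^ 3 - 6 / 25 * l ^ 4) *
      Real.exp (-(2 * l - 3 * l ^ 2 / 8)) := by simpa [F] using h
  rwa [Real.exp_neg, ← div_eq_mul_inv, le_div_iff₀ (Real.exp_pos _), one_mul] at h1

/-- The numerical inequality behind the constant `137 / 20`. It involves `477 / 100`, which is
`137 / 20 - 2.08`: the part of the decrease of `√m` left over once `shifted_lower` has used its
share. The left side is largest near `l = 11 / 5`. -/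
lemma quartic_mul_le {l : ℝ} (h0 : 0 ≤ l) (h4 : l ≤ 4) :
    (2 + 13 / 8 * l + 18 / 25 * l ^ 2 - 6 / 25 * l ^ 3 + 2.5 * (47 / 46) / 3) * (1 - l / 8) ≤
      477 / 100 * (137 / 20) / 6 := by
  nlinarith [mul_nonneg h0 (sub_nonneg.2 h4), sq_nonneg (l - 11 / 5), sq_nonneg (l * (l - 11 / 5)),
    mul_nonneg h0 (sq_nonneg (l - 11 / 5)), mul_nonneg (sub_nonneg.2 h4) (sq_nonneg (l - 11 / 5)),
    mul_nonneg (mul_nonneg h0 (sub_nonneg.2 h4)) (sq_nonneg (l - 11 / 5))]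

/-- The inequality which makes the recursion for the exponential moments close: the error made in
one step is paid for by the decrease of `√m`. Since `√m - √i ≥ (m - i) / (2 √m)`, the sum is a
Laplace transform as in `sum_mul_exp_le`. -/
lemma sum_step_le {m : ℕ} {l : ℝ} (hm : 47 ≤ m) (h0 : 0 ≤ l) (h4 : l ≤ 4)
    (hl : 137 / 20 ≤ √m * (1 - l / 8)) :
    ∑ i ∈ Finset.Ico 1 m, 2 * (i : ℝ) * Real.exp (l * (2 - 3 * l / 8 +
      2.5 * ((m - i) / (m - 1)) - 477 / 100 * (√m - √i))) ≤ m * (m - 1) := by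
  have hm' : (47 : ℝ) ≤ m := by exact_mod_cast hm
  have hs : 0 < √(m : ℝ) := Real.sqrt_pos.2 (by linarith)
  have hss : √(m : ℝ) * √m = m := Real.mul_self_sqrt (by linarith)
  have hs6 : 6 ≤ √(m : ℝ) := Real.le_sqrt_of_sq_le (by linarith)
  set θ := l * (477 / 100 / (2 * √m) - 2.5 / (m - 1)) with hθ
  have hm1 : (0 : ℝ) < m - 1 := by linarith
  have hθ0 : 0 ≤ θ := by
    refine mul_nonneg h0 (sub_nonneg.2 ?_)
    rw [div_le_div_iff₀ hm1 (by positivity)]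
    nlinarith
  have hterm : ∀ i ∈ Finset.Ico 1 m, 2 * (i : ℝ) * Real.exp (l * (2 - 3 * l / 8 +
      2.5 * ((m - i) / (m - 1)) - 477 / 100 * (√m - √i))) ≤
      Real.exp (2 * l - 3 * l ^ 2 / 8) * (2 * (i : ℝ) * Real.exp (-θ * (m - i))) := by
    intro i hi
    rw [Finset.mem_Ico] at hi
    have hi' : (i : ℝ) ≤ m := by exact_mod_cast hi.2.le
    rw [mul_left_comm, ← Real.exp_add]
    gcongr
    have hsi : √(i : ℝ) * √i = i := Real.mul_self_sqrt (by positivity)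
    have hle : √(i : ℝ) ≤ √m := Real.sqrt_le_sqrt hi'
    have hkey : (m - i) / (2 * √(m : ℝ)) ≤ √m - √i := by
      rw [div_le_iff₀ (by positivity)]
      nlinarith [sq_nonneg (√(m : ℝ) - √i)]
    have := mul_le_mul_of_nonneg_left hkey h0
    have e : -θ * (m - i) =
        l * (2.5 * ((m - i) / (m - 1)) - 477 / 100 * ((m - i) / (2 * √(m : ℝ)))) := by
      rw [hθ]; ring
    rw [e]
    nlinarith
  refine (Finset.sum_le_sum hterm).trans ?_
  rw [← Finset.mul_sum]
  have hS := sum_mul_exp_le hθ0 m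
  have hS0 : 0 ≤ ∑ i ∈ Finset.Ico 1 m, 2 * (i : ℝ) * Real.exp (-θ * (m - i)) :=
    Finset.sum_nonneg fun i _ => by positivity
  have hq : Real.exp (2 * l - 3 * l ^ 2 / 8) ≤ 1 + θ * m / 3 := by
    refine (exp_le_quartic h0 h4).trans ?_
    have h8 : 0 < 1 - l / 8 := by linarith
    have e : θ * m = l * (477 / 100 * √m / 2 - 2.5 * (m / (m - 1))) := by
      have h1 : 477 / 100 / (2 * √(m : ℝ)) * m = 477 / 100 * √m / 2 := by
        rw [div_mul_eq_mul_div, div_eq_div_iff (by positivity) (by norm_num)]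
        linear_combination -(477 / 100 * 2) * hss
      rw [hθ, mul_assoc, sub_mul, h1]; ring
    have h47 : (m : ℝ) / (m - 1) ≤ 47 / 46 := by
      rw [div_le_div_iff₀ hm1 (by norm_num)]; linarith
    have hr : 2 + 13 / 8 * l + 18 / 25 * l ^ 2 - 6 / 25 * l ^ 3 + 2.5 * (47 / 46) / 3 ≤
        477 / 100 * √m / 6 := by
      have h1 := quartic_mul_le h0 h4
      have h2 : 477 / 100 * (137 / 20) / 6 ≤ (477 / 100 * √(m : ℝ) / 6) * (1 - l / 8) := by
        linarith
      exact le_of_mul_le_mul_right (h1.trans h2) h8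
    rw [e]
    have h3 : 2 + 13 / 8 * l + 18 / 25 * l ^ 2 - 6 / 25 * l ^ 3 ≤
        (477 / 100 * √(m : ℝ) / 2 - 2.5 * (m / (m - 1))) / 3 := by linarith
    have := mul_le_mul_of_nonneg_left h3 h0
    nlinarith
  calc _ ≤ (1 + θ * m / 3) * ∑ i ∈ Finset.Ico 1 m, 2 * (i : ℝ) * Real.exp (-θ * (m - i)) := by
        gcongr
    _ ≤ _ := by rw [mul_comm]; exact hS

/-- The difference between `i x` and `m` times one step of the fixed point equation, at `v = √u`: a
term which is small when `m v` is close to `i`, and the mean number of exchanges for a sub-list of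
length `i`. -/
lemma step_identity {m : ℝ} (hm : m ≠ 0) (i v x : ℝ) :
    i * x - m * (v * x + v * (1 - v)) = (i - m * v) * (x + 1 - v - i / m) - i * (1 - i / m) := by
  field_simp
  ring

/-- The mean number of exchanges differs from `i (1 - i / m)` by at most `1/2`. -/
lemma mean_exchanges_le {m i : ℝ} (hm : 3 ≤ m) (hi : 1 ≤ i) (him : i ≤ m - 1) :
    1 + (i - 1) * (m - i - 1) / (m - 2) - i * (1 - i / m) ≤ 1 / 2 ∧
    1 + (i - 1) * (m - i - 1) / (m - 2) - i * (1 - i / m) ≤ 2 * ((m - i) / m) ∧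
    0 ≤ 1 + (i - 1) * (m - i - 1) / (m - 2) - i * (1 - i / m) := by
  have h2 : 0 < m - 2 := by linarith
  have h0 : 0 < m := by linarith
  have e : 1 + (i - 1) * (m - i - 1) / (m - 2) - i * (1 - i / m) =
      (2 * i * (m - i) - m) / (m * (m - 2)) := by
    field_simp
    ring
  rw [e]
  refine ⟨?_, ?_, div_nonneg ?_ (by positivity)⟩
  · rw [div_le_div_iff₀ (by positivity) (by norm_num)]
    nlinarith [sq_nonneg (m - 2 * i)]
  · rw [mul_div_assoc', div_le_div_iff₀ (by positivity) h0]
    have : (2 * i * (m - i) - m) ≤ 2 * (m - i) * (m - 2) := by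
      nlinarith [mul_nonneg (sub_nonneg.2 him) (sub_nonneg.2 him)]
    nlinarith
  · nlinarith [mul_nonneg (sub_nonneg.2 hi) (sub_nonneg.2 him)]

section Coupling

variable {m i v x : ℝ}

/-- If `v²` lies in the interval of the size `i`, then `m v` is close to `i`. -/
lemma generic_bounds (hm : 3 ≤ m) (hi : 1 ≤ i) (him : i ≤ m - 1) (hv : 0 ≤ v)
    (h1 : i * (i - 1) ≤ v ^ 2 * (m * (m - 1))) (h2 : v ^ 2 * (m * (m - 1)) ≤ i * (i + 1)) :
    m * v - i ≤ 1 ∧ i - m * v ≤ (m - i) / (m - 1) := by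
  have h0 : 0 < m - 1 := by linarith
  constructor
  · have : (m * v) ^ 2 ≤ (i + 1) ^ 2 := by
      have h3 : (m * v) ^ 2 * (m - 1) ≤ (i + 1) ^ 2 * (m - 1) := by nlinarith
      exact le_of_mul_le_mul_right h3 h0
    have := abs_le_of_sq_le_sq' this (by linarith)
    linarith [this.2]
  · set t := (m - i) / (m - 1) with ht
    have ht' : t * (m - 1) = m - i := by rw [ht]; field_simp
    have ht1 : t ≤ 1 := by rw [ht, div_le_one h0]; linarith
    have ht0 : 0 ≤ t := div_nonneg (by linarith) h0.le
    have : (i - t) ^ 2 ≤ (m * v) ^ 2 := by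
      have h3 : (i - t) ^ 2 * (m - 1) ≤ (m * v) ^ 2 * (m - 1) := by
        have h4 : (m * v) ^ 2 * (m - 1) ≥ m * (i * (i - 1)) := by nlinarith
        have h5 : (i - t) ^ 2 * (m - 1) = i ^ 2 * (m - 1) - 2 * i * (m - i) + t * (m - i) := by
          linear_combination (-2 * i + t) * ht'
        nlinarith [mul_nonneg (sub_nonneg.2 (ht1.trans hi)) (by linarith : 0 ≤ m - i)]
      exact le_of_mul_le_mul_right h3 h0
    have := abs_le_of_sq_le_sq' this (by positivity)
    linarith [this.2]

/-- One step of the recursion overestimates by at most `1` and a multiple of the fraction of the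
keys which is split off. The summand `1 + (i - 1) (m - i - 1) / (m - 2)` is the mean number of
exchanges. -/
lemma generic_upper (hm : 3 ≤ m) (hi : 1 ≤ i) (him : i ≤ m - 1) (hv : 0 ≤ v) (hv1 : v ≤ 1)
    (hx : 0 ≤ x) (hx1 : x ≤ 1)
    (h1 : i * (i - 1) ≤ v ^ 2 * (m * (m - 1))) (h2 : v ^ 2 * (m * (m - 1)) ≤ i * (i + 1)) :
    i * x - m * (v * x + v * (1 - v)) + (1 + (i - 1) * (m - i - 1) / (m - 2)) ≤
      1 + 2.5 * ((m - i) / (m - 1)) := by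
  obtain ⟨hb1, hb2⟩ := generic_bounds hm hi him hv h1 h2
  obtain ⟨he1, he2, -⟩ := mean_exchanges_le hm hi him
  rw [step_identity (by linarith)]
  have h0 : 0 < m - 1 := by linarith
  have hm0 : 0 < m := by linarith
  have hut : (m - i) / m ≤ (m - i) / (m - 1) :=
    div_le_div_of_nonneg_left (by linarith) h0 (by linarith)
  have hu : (m - i) / m = 1 - i / m := by field_simp
  have ht0 : 0 ≤ (m - i) / (m - 1) := div_nonneg (by linarith) h0.le
  have hy0 : 0 ≤ i / m := by positivity
  rcases le_total i (m * v) with h | h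
  · have : (i - m * v) * (x + 1 - v - i / m) ≤ i / m := by
      nlinarith [mul_nonneg (sub_nonneg.2 h) (by linarith : 0 ≤ x + 1 - v)]
    linarith
  · have : (i - m * v) * (x + 1 - v - i / m) ≤ (m - i) / (m - 1) * 2 := by
      have h3 : (i - m * v) * (x + 1 - v - i / m) ≤ (i - m * v) * 2 :=
        mul_le_mul_of_nonneg_left (by linarith) (by linarith)
      linarith
    linarith

/-- The bound in the other direction, before the mean number of exchanges is subtracted; the latter
is compared with `i (1 - i / m)` by `mean_exchanges_le`. -/
lemma generic_lower (hm : 3 ≤ m) (hi : 1 ≤ i) (him : i ≤ m - 1) (hv : 0 ≤ v) (hv1 : v ≤ 1)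
    (hx : 0 ≤ x) (hx1 : x ≤ 1)
    (h1 : i * (i - 1) ≤ v ^ 2 * (m * (m - 1))) (h2 : v ^ 2 * (m * (m - 1)) ≤ i * (i + 1)) :
    m * (v * x + v * (1 - v)) - i * x ≤ 2 * ((m - i) / (m - 1)) + i * (1 - i / m) := by
  obtain ⟨hb1, hb2⟩ := generic_bounds hm hi him hv h1 h2
  have hid := step_identity (m := m) (by linarith) i v x
  have h0 : 0 < m - 1 := by linarith
  have hm0 : 0 < m := by linarith
  have hut : (m - i) / m ≤ (m - i) / (m - 1) :=
    div_le_div_of_nonneg_left (by linarith) h0 (by linarith)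
  have hu : (m - i) / m = 1 - i / m := by field_simp
  have ht0 : 0 ≤ (m - i) / (m - 1) := div_nonneg (by linarith) h0.le
  have hy0 : 0 ≤ i / m := by positivity
  have hy1 : i / m ≤ 1 := by rw [div_le_one hm0]; linarith
  have : (m * v - i) * (x + 1 - v - i / m) ≤ 2 * ((m - i) / (m - 1)) := by
    rcases le_total i (m * v) with h | h
    · have hvi : i / m ≤ v := by rw [div_le_iff₀ hm0]; linarith
      have h3 : (m * v - i) * (x + 1 - v - i / m) ≤ (m * v - i) * (2 * (1 - i / m)) :=
        mul_le_mul_of_nonneg_left (by linarith) (by linarith)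
      have h4 : (m * v - i) * (2 * (1 - i / m)) ≤ 1 * (2 * (1 - i / m)) :=
        mul_le_mul_of_nonneg_right hb1 (by linarith)
      linarith
    · have h3 : (i - m * v) * (v + i / m - 1 - x) ≤ (i - m * v) * 1 :=
        mul_le_mul_of_nonneg_left (by linarith) (by linarith)
      nlinarith
  linarith

/-- The analogue of `generic_bounds` when the smallest key stands in front: it uses up the interval
`(0, 1 / m]` of values of `v²`, which moves the interval of the size `i` up by `1 / m`. For small
`i` the error `m v - i` is of the order `√m`, for large `i` it is bounded. -/
lemma shifted_bounds (hm : 4 ≤ m) (hi : 1 ≤ i) (him : i ≤ m - 2) (hv : 0 ≤ v)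
    (h1 : m - 1 + i * (i - 1) ≤ v ^ 2 * (m * (m - 1)))
    (h2 : v ^ 2 * (m * (m - 1)) ≤ m - 1 + i * (i + 1)) :
    i ≤ m * v ∧ (m * v - i - 1) * (2 * (i + 1)) ≤ m ∧
      (m * v - i - 1) * (√m + i) ≤ m := by
  have h0 : 0 < m - 1 := by linarith
  have hlow : i ≤ m * v := by
    have : i ^ 2 ≤ (m * v) ^ 2 := by
      have h3 : i ^ 2 * (m - 1) ≤ (m * v) ^ 2 * (m - 1) := by nlinarith
      exact le_of_mul_le_mul_right h3 h0
    exact (abs_le_of_sq_le_sq' this (by positivity)).2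
  have hup : (m * v) ^ 2 ≤ (i + 1) ^ 2 + m := by
    have h3 : (m * v) ^ 2 * (m - 1) ≤ ((i + 1) ^ 2 + m) * (m - 1) := by
      have h4 : (m * v) ^ 2 * (m - 1) ≤ m * (m - 1 + i * (i + 1)) := by nlinarith
      nlinarith
    exact le_of_mul_le_mul_right h3 h0
  have hE : (m * v - i - 1) ^ 2 + 2 * (i + 1) * (m * v - i - 1) ≤ m := by nlinarith
  refine ⟨hlow, by nlinarith [sq_nonneg (m * v - i - 1)], ?_⟩
  set E := m * v - i - 1
  have hs : 0 < √m := Real.sqrt_pos.2 (by linarith)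
  have hss : √m * √m = m := Real.mul_self_sqrt (by linarith)
  rcases le_total E 0 with hE0 | hE0
  · nlinarith [mul_nonneg (neg_nonneg.2 hE0) (by positivity : 0 ≤ √m + i)]
  by_contra hc
  push Not at hc
  have hEs : E ≤ √m := by
    by_contra hE'
    push Not at hE'
    nlinarith
  have h5 : E * E ≤ E * √m := mul_le_mul_of_nonneg_left hEs hE0
  -- `E² + 2 (i + 1) E > m` as soon as `E (√m + i) > m`
  have h6 : 0 < E := by
    rcases hE0.lt_or_eq with h | h
    · exact h
    · rw [← h] at hc; linarith
  have h7 : m - E * i < E * √m := by linarith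
  have h8 : (m - E * i) ^ 2 < E ^ 2 * m := by
    have h9 : 0 ≤ m - E * i := by nlinarith
    calc (m - E * i) ^ 2 < (E * √m) ^ 2 := by gcongr
      _ = E ^ 2 * m := by rw [mul_pow, Real.sq_sqrt (by linarith)]
  nlinarith [mul_pos h6 (by linarith : 0 < m), sq_nonneg (E * i)]

/-- The analogue of `generic_upper` when the smallest key stands in front, so that `m - 1` keys are
partitioned. -/
lemma shifted_upper (hm : 5 ≤ m) (hi : 1 ≤ i) (him : i ≤ m - 2) (hv : 0 ≤ v) (hv1 : v ≤ 1)
    (hx : 0 ≤ x) (h1 : m - 1 + i * (i - 1) ≤ v ^ 2 * (m * (m - 1)))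
    (h2 : v ^ 2 * (m * (m - 1)) ≤ m - 1 + i * (i + 1)) :
    i * x - m * (v * x + v * (1 - v)) + (1 + (i - 1) * (m - 1 - i - 1) / (m - 1 - 2)) ≤
      3 / 2 + (m - i) / (m - 1) := by
  obtain ⟨hb1, hb2, -⟩ := shifted_bounds (by linarith) hi him hv h1 h2
  obtain ⟨-, he2, -⟩ := mean_exchanges_le (m := m - 1) (by linarith) hi (by linarith)
  rw [step_identity (by linarith)]
  have h0 : 0 < m - 1 := by linarith
  have hm0 : 0 < m := by linarith
  have hut : (m - i) / m ≤ (m - i) / (m - 1) :=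
    div_le_div_of_nonneg_left (by linarith) h0 (by linarith)
  have hu : (m - i) / m = 1 - i / m := by field_simp
  have hG : (m - 1 - i) / (m - 1) ≤ (m - i) / m := by
    rw [div_le_div_iff₀ h0 hm0]; nlinarith
  have hy0 : 0 ≤ i / m := by positivity
  have hmean : i * (1 - i / (m - 1)) ≤ i * (1 - i / m) := by
    refine mul_le_mul_of_nonneg_left ?_ (by linarith)
    have : i / m ≤ i / (m - 1) := div_le_div_of_nonneg_left (by linarith) h0 (by linarith)
    linarith
  have hE : (m * v - i - 1) * (i / m) ≤ 1 / 2 := by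
    rcases le_total (m * v - i - 1) 0 with h | h
    · nlinarith
    · rw [mul_div_assoc', div_le_div_iff₀ hm0 (by norm_num)]
      nlinarith
  have : (i - m * v) * (x + 1 - v - i / m) ≤ i / m + 1 / 2 := by
    nlinarith [mul_nonneg (sub_nonneg.2 hb1) (by linarith : 0 ≤ x + 1 - v)]
  linarith

/-- The analogue of `generic_lower` when the smallest key stands in front. The error of order `√m`
for small `i` is paid for by `2.08` times the decrease of `√m`. -/
lemma shifted_lower (hm : 47 ≤ m) (hi : 1 ≤ i) (him : i ≤ m - 2) (hv : 0 ≤ v)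
    (hx1 : x ≤ 1) (h1 : m - 1 + i * (i - 1) ≤ v ^ 2 * (m * (m - 1)))
    (h2 : v ^ 2 * (m * (m - 1)) ≤ m - 1 + i * (i + 1)) :
    m * (v * x + v * (1 - v)) - i * x ≤
      1 + (m - i) / (m - 1) + 2.08 * (√m - √i) + i * (1 - i / (m - 1)) := by
  obtain ⟨hb1, -, hb2⟩ := shifted_bounds (by linarith) hi him hv h1 h2
  have hid := step_identity (m := m) (by linarith) i v x
  have h0 : 0 < m - 1 := by linarith
  have hm0 : 0 < m := by linarith
  have hut : (m - i) / m ≤ (m - i) / (m - 1) :=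
    div_le_div_of_nonneg_left (by linarith) h0 (by linarith)
  have hu : (m - i) / m = 1 - i / m := by field_simp
  have hy0 : 0 ≤ i / m := by positivity
  have hy1 : i / m ≤ 1 := by rw [div_le_one hm0]; linarith
  have hvi : i / m ≤ v := by rw [div_le_iff₀ hm0]; linarith
  have hmean : i * (1 - i / m) - i * (1 - i / (m - 1)) ≤ i / m := by
    have e : i * (1 - i / m) - i * (1 - i / (m - 1)) = i / m * (i / (m - 1)) := by
      field_simp; ring
    rw [e]
    refine mul_le_of_le_one_right hy0 ?_
    rw [div_le_one h0]; linarith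
  have hs : 6.8 ≤ √m := Real.le_sqrt_of_sq_le (by linarith)
  have hss : √m * √m = m := Real.mul_self_sqrt (by linarith)
  have hz : 0 ≤ √i := Real.sqrt_nonneg i
  have hzz : √i * √i = i := Real.mul_self_sqrt (by linarith)
  have hzs : √i ≤ √m := Real.sqrt_le_sqrt (by linarith)
  have hE : (m * v - i - 1) * (2 * (1 - i / m)) ≤ 2.08 * (√m - √i) := by
    rw [← hu, mul_div_assoc', mul_div_assoc', div_le_iff₀ hm0]
    set E := m * v - i - 1
    have h3 : E * (√m + √i) * 2 ≤ 2.08 * m := by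
      rcases le_total E 0 with h | h
      · nlinarith [mul_nonneg (neg_nonneg.2 h) (by positivity : 0 ≤ √m + √i)]
      · have h4 : 2 * (√m + √i) ≤ 2.08 * (√m + i) := by
          nlinarith [sq_nonneg (√i - 0.48)]
        nlinarith [mul_le_mul_of_nonneg_left h4 h]
    have h5 : m - i = (√m + √i) * (√m - √i) := by linear_combination -hss + hzz
    rw [h5]
    nlinarith [mul_le_mul_of_nonneg_right h3 (sub_nonneg.2 hzs)]
  have : (m * v - i) * (x + 1 - v - i / m) ≤ (m * v - i) * (2 * (1 - i / m)) :=
    mul_le_mul_of_nonneg_left (by linarith) (by linarith)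
  linarith

end Coupling

/-! ### Couplings with bounds on exponential moments -/

/-- The random map `x ↦ √u x + √u (1 - √u)` of the fixed point equation. -/
noncomputable def stepMap (u x : ℝ) : ℝ := √u * x + √u * (1 - √u)

lemma stepMap_mem {u x : ℝ} (hu : u ∈ Set.Icc (0 : ℝ) 1) (hx : x ∈ Set.Icc (0 : ℝ) 1) :
    stepMap u x ∈ Set.Icc (0 : ℝ) 1 := by
  have h0 := Real.sqrt_nonneg u
  have h1 : √u ≤ 1 := Real.sqrt_le_one.2 hu.2
  unfold stepMap
  constructor
  · nlinarith [mul_nonneg h0 hx.1, mul_nonneg h0 (sub_nonneg.2 h1)]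
  · nlinarith [mul_nonneg h0 (sub_nonneg.2 hx.2), sq_nonneg (1 - √u)]

/-- There is a measure `γ` on `ℝ × ℝ` whose marginals are, as functionals on test functions, `N` and
`S`, and for which the exponential moments of `y - a x` of the orders `l` and `-l`, for `0 ≤ l ≤ 4`,
are at most `Bp l` and `Bm l`. The measures are not normalised. The orders up to `4` are those which
Chernoff's bound needs in `tail_le`. -/
def Cpl (N S : (ℝ → ℝ≥0∞) → ℝ≥0∞) (a : ℝ) (Bp Bm : ℝ → ℝ≥0∞) : Prop :=
  ∃ γ : Measure (ℝ × ℝ), SFinite γ ∧ (∀ g, Measurable g → ∫⁻ z, g z.1 ∂γ = N g) ∧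
    (∀ g, Measurable g → ∫⁻ z, g z.2 ∂γ = S g) ∧
    ∀ l ∈ Set.Icc (0 : ℝ) 4, ∫⁻ z, ENNReal.ofReal (Real.exp (l * (z.1 - a * z.2))) ∂γ ≤ Bp l ∧
      ∫⁻ z, ENNReal.ofReal (Real.exp (-l * (z.1 - a * z.2))) ∂γ ≤ Bm l

lemma ae_mem_of_lintegral_indicator {Ω : Type*} [MeasurableSpace Ω] {γ : Measure Ω} {f : Ω → ℝ}
    (hf : Measurable f) {s : Set ℝ} (hs : MeasurableSet s)
    (h : ∫⁻ z, sᶜ.indicator (1 : ℝ → ℝ≥0∞) (f z) ∂γ = 0) : ∀ᵐ z ∂γ, f z ∈ s := by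
  have hm : Measurable fun z => sᶜ.indicator (1 : ℝ → ℝ≥0∞) (f z) :=
    (measurable_one.indicator hs.compl).comp hf
  rw [lintegral_eq_zero_iff hm] at h
  filter_upwards [h] with z hz
  by_contra hc
  simp [Set.indicator_of_mem (show f z ∈ sᶜ from hc)] at hz

namespace Cpl

variable {N S N' S' : (ℝ → ℝ≥0∞) → ℝ≥0∞} {a : ℝ} {Bp Bm Bp' Bm' : ℝ → ℝ≥0∞}

lemma mono (h : Cpl N S a Bp Bm) (hN : ∀ g, Measurable g → N g = N' g)
    (hS : ∀ g, Measurable g → S g = S' g) (hp : ∀ l ∈ Set.Icc (0 : ℝ) 4, Bp l ≤ Bp' l)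
    (hm : ∀ l ∈ Set.Icc (0 : ℝ) 4, Bm l ≤ Bm' l) : Cpl N' S' a Bp' Bm' := by
  obtain ⟨γ, h0, h1, h2, h3⟩ := h
  exact ⟨γ, h0, fun g hg => (h1 g hg).trans (hN g hg), fun g hg => (h2 g hg).trans (hS g hg),
    fun l hl => ⟨(h3 l hl).1.trans (hp l hl), (h3 l hl).2.trans (hm l hl)⟩⟩

lemma sum {ι : Type*} (s : Finset ι) {N S : ι → (ℝ → ℝ≥0∞) → ℝ≥0∞} {Bp Bm : ι → ℝ → ℝ≥0∞}
    (h : ∀ j ∈ s, Cpl (N j) (S j) a (Bp j) (Bm j)) :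
    Cpl (fun g => ∑ j ∈ s, N j g) (fun g => ∑ j ∈ s, S j g) a (fun l => ∑ j ∈ s, Bp j l)
      (fun l => ∑ j ∈ s, Bm j l) := by
  choose! γ h0 h1 h2 h3 using h
  have hs : SFinite (∑ j ∈ s, γ j) := by
    have := Measure.sum_coe_finset s γ
    rw [← this]
    have : ∀ j : s, SFinite (γ j) := fun j => h0 j j.2
    infer_instance
  refine ⟨∑ j ∈ s, γ j, hs, fun g hg => ?_, fun g hg => ?_, fun l hl => ⟨?_, ?_⟩⟩
  · rw [lintegral_finsetSum_measure]
    exact Finset.sum_congr rfl fun j hj => h1 j hj g hg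
  · rw [lintegral_finsetSum_measure]
    exact Finset.sum_congr rfl fun j hj => h2 j hj g hg
  · rw [lintegral_finsetSum_measure]
    exact Finset.sum_le_sum fun j hj => (h3 j hj l hl).1
  · rw [lintegral_finsetSum_measure]
    exact Finset.sum_le_sum fun j hj => (h3 j hj l hl).2

lemma add (h : Cpl N S a Bp Bm) (h' : Cpl N' S' a Bp' Bm') :
    Cpl (fun g => N g + N' g) (fun g => S g + S' g) a (fun l => Bp l + Bp' l)
      (fun l => Bm l + Bm' l) := by
  obtain ⟨γ, h0, h1, h2, h3⟩ := h
  obtain ⟨γ', h0', h1', h2', h3'⟩ := h'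
  refine ⟨γ + γ', inferInstance, fun g hg => ?_, fun g hg => ?_, fun l hl => ⟨?_, ?_⟩⟩
  · rw [lintegral_add_measure, h1 g hg, h1' g hg]
  · rw [lintegral_add_measure, h2 g hg, h2' g hg]
  · rw [lintegral_add_measure]
    exact add_le_add (h3 l hl).1 (h3' l hl).1
  · rw [lintegral_add_measure]
    exact add_le_add (h3 l hl).2 (h3' l hl).2

lemma smul (h : Cpl N S a Bp Bm) (c : ℝ≥0∞) :
    Cpl (fun g => c * N g) (fun g => c * S g) a (fun l => c * Bp l) (fun l => c * Bm l) := by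
  obtain ⟨γ, h0, h1, h2, h3⟩ := h
  refine ⟨c • γ, inferInstance, fun g hg => ?_, fun g hg => ?_, fun l hl => ⟨?_, ?_⟩⟩
  · rw [lintegral_smul_measure, h1 g hg, smul_eq_mul]
  · rw [lintegral_smul_measure, h2 g hg, smul_eq_mul]
  · rw [lintegral_smul_measure, smul_eq_mul]
    exact mul_le_mul' le_rfl (h3 l hl).1
  · rw [lintegral_smul_measure, smul_eq_mul]
    exact mul_le_mul' le_rfl (h3 l hl).2

/-- The number of exchanges in one partition is added to the first coordinate. -/
lemma shift (h : Cpl N S a Bp Bm) (T : ℝ) :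
    Cpl (fun g => N fun y => g (T + y)) S a (fun l => ENNReal.ofReal (Real.exp (l * T)) * Bp l)
      (fun l => ENNReal.ofReal (Real.exp (-l * T)) * Bm l) := by
  obtain ⟨γ, h0, h1, h2, h3⟩ := h
  have hmeas : Measurable fun z : ℝ × ℝ => (T + z.1, z.2) := by fun_prop
  have key : ∀ k : ℝ, ∫⁻ z, ENNReal.ofReal (Real.exp (k * (z.1 - a * z.2)))
      ∂(γ.map fun z : ℝ × ℝ => (T + z.1, z.2)) = ENNReal.ofReal (Real.exp (k * T)) *
        ∫⁻ z, ENNReal.ofReal (Real.exp (k * (z.1 - a * z.2))) ∂γ := by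
    intro k
    rw [lintegral_map (by fun_prop) hmeas, ← lintegral_const_mul _ (by fun_prop)]
    refine lintegral_congr fun z => ?_
    rw [← ENNReal.ofReal_mul (Real.exp_pos _).le, ← Real.exp_add]
    congr 2; ring
  refine ⟨γ.map fun z => (T + z.1, z.2), inferInstance, fun g hg => ?_, fun g hg => ?_,
    fun l hl => ⟨?_, ?_⟩⟩
  · rw [lintegral_map (by fun_prop) hmeas]
    exact h1 (fun y => g (T + y)) (by fun_prop)
  · rw [lintegral_map (by fun_prop) hmeas]
    exact h2 g hg
  · rw [key]; exact mul_le_mul' le_rfl (h3 l hl).1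
  · rw [key]; exact mul_le_mul' le_rfl (h3 l hl).2

variable {μ : Measure ℝ} {c : ℝ≥0∞}

/-- One step of the recursion for the second coordinate: `x` is replaced by `stepMap u x` with an
independent `u`, uniformly distributed on `(α, β]`. -/
lemma step [SFinite μ] (hμ : μ (Set.Icc 0 1)ᶜ = 0) {i m α β ep em : ℝ} (hαβ : α < β)
    (h : Cpl N (fun g => c * ∫⁻ x, g x ∂μ) i Bp Bm)
    (hep : ∀ u ∈ Set.Ioc α β, ∀ x ∈ Set.Icc (0 : ℝ) 1, i * x - m * stepMap u x ≤ ep)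
    (hem : ∀ u ∈ Set.Ioc α β, ∀ x ∈ Set.Icc (0 : ℝ) 1, m * stepMap u x - i * x ≤ em) :
    Cpl N (fun g => c * ENNReal.ofReal (1 / (β - α)) *
        ∫⁻ u in Set.Ioc α β, ∫⁻ x, g (stepMap u x) ∂μ) m
      (fun l => ENNReal.ofReal (Real.exp (l * ep)) * Bp l)
      (fun l => ENNReal.ofReal (Real.exp (l * em)) * Bm l) := by
  obtain ⟨γ, h0, h1, h2, h3⟩ := h
  set κ := ENNReal.ofReal (1 / (β - α)) with hκ
  set ν : Measure ℝ := κ • volume.restrict (Set.Ioc α β) with hν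
  have hνu : ν Set.univ = 1 := by
    rw [hν, Measure.smul_apply, Measure.restrict_apply_univ, Real.volume_Ioc, smul_eq_mul, hκ,
      ← ENNReal.ofReal_mul (by have := sub_pos.2 hαβ; positivity), one_div,
      inv_mul_cancel₀ (sub_pos.2 hαβ).ne', ENNReal.ofReal_one]
  have : IsProbabilityMeasure ν := ⟨hνu⟩
  have hνm : ∀ᵐ u ∂ν, u ∈ Set.Ioc α β :=
    Measure.ae_smul_measure (ae_restrict_mem measurableSet_Ioc) κ
  have hγx : ∀ᵐ z ∂γ, z.2 ∈ Set.Icc (0 : ℝ) 1 := by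
    refine ae_mem_of_lintegral_indicator measurable_snd measurableSet_Icc ?_
    rw [h2 _ (measurable_one.indicator measurableSet_Icc.compl)]
    simp [lintegral_indicator_one measurableSet_Icc.compl, hμ]
  have hmeas : Measurable fun w : (ℝ × ℝ) × ℝ => (w.1.1, stepMap w.2 w.1.2) := by
    unfold stepMap; fun_prop
  have key : ∀ k e l : ℝ, (∀ y u x, u ∈ Set.Ioc α β → x ∈ Set.Icc (0 : ℝ) 1 →
        k * (y - m * stepMap u x) ≤ l * e + k * (y - i * x)) →
      ∫⁻ z, ENNReal.ofReal (Real.exp (k * (z.1 - m * z.2)))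
        ∂((γ.prod ν).map fun w : (ℝ × ℝ) × ℝ => (w.1.1, stepMap w.2 w.1.2)) ≤
      ENNReal.ofReal (Real.exp (l * e)) *
        ∫⁻ z, ENNReal.ofReal (Real.exp (k * (z.1 - i * z.2))) ∂γ := by
    intro k e l hk
    rw [lintegral_map (by fun_prop) hmeas, lintegral_prod _ (by
      unfold stepMap; fun_prop), ← lintegral_const_mul _ (by fun_prop)]
    refine lintegral_mono_ae ?_
    filter_upwards [hγx] with z hz
    calc _ ≤ ∫⁻ u, ENNReal.ofReal (Real.exp (l * e)) *
          ENNReal.ofReal (Real.exp (k * (z.1 - i * z.2))) ∂ν := by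
          refine lintegral_mono_ae ?_
          filter_upwards [hνm] with u hu
          rw [← ENNReal.ofReal_mul (Real.exp_pos _).le, ← Real.exp_add]
          exact ENNReal.ofReal_le_ofReal (Real.exp_le_exp.2 (hk _ _ _ hu hz))
      _ = _ := by rw [lintegral_const, measure_univ, mul_one]
  refine ⟨(γ.prod ν).map fun w => (w.1.1, stepMap w.2 w.1.2), inferInstance, fun g hg => ?_,
    fun g hg => ?_, fun l hl => ⟨?_, ?_⟩⟩
  · rw [lintegral_map (by fun_prop) hmeas, lintegral_prod _ (by fun_prop)]
    simp only [lintegral_const, measure_univ, mul_one]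
    exact h1 g hg
  · have hg' : Measurable fun w : (ℝ × ℝ) × ℝ => g (stepMap w.2 w.1.2) := by
      unfold stepMap; fun_prop
    have hg2 : Measurable fun w : ℝ × ℝ => g (stepMap w.2 w.1) := by
      unfold stepMap; fun_prop
    rw [lintegral_map (by fun_prop) hmeas, lintegral_prod _ hg'.aemeasurable]
    refine (h2 _ hg2.lintegral_prod_right').trans ?_
    beta_reduce
    rw [mul_assoc]
    congr 1
    rw [lintegral_lintegral_swap hg2.aemeasurable, hν, lintegral_smul_measure, smul_eq_mul]
  · refine (key l ep l fun y u x hu hx => ?_).trans (mul_le_mul' le_rfl (h3 l hl).1)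
    have := mul_le_mul_of_nonneg_left (hep u hu x hx) hl.1
    linarith
  · refine (key (-l) em l fun y u x hu hx => ?_).trans (mul_le_mul' le_rfl (h3 l hl).2)
    have := mul_le_mul_of_nonneg_left (hem u hu x hx) hl.1
    linarith

/-- If both coordinates are confined to intervals, the exponential moments are bounded trivially, by
the same coupling. -/
lemma trivial_bound [IsProbabilityMeasure μ] (hμ : μ (Set.Icc 0 1)ᶜ = 0) {m : ℝ} (hm : 0 ≤ m)
    (h : Cpl N (fun g => c * ∫⁻ x, g x ∂μ) m Bp Bm)
    (hN : N ((Set.Icc 0 m)ᶜ.indicator 1) = 0) :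
    Cpl N (fun g => c * ∫⁻ x, g x ∂μ) m
      (fun l => min (Bp l) (c * ENNReal.ofReal (Real.exp (l * m))))
      (fun l => min (Bm l) (c * ENNReal.ofReal (Real.exp (l * m)))) := by
  obtain ⟨γ, h0, h1, h2, h3⟩ := h
  have hγx : ∀ᵐ z ∂γ, z.2 ∈ Set.Icc (0 : ℝ) 1 := by
    refine ae_mem_of_lintegral_indicator measurable_snd measurableSet_Icc ?_
    rw [h2 _ (measurable_one.indicator measurableSet_Icc.compl)]
    simp [lintegral_indicator_one measurableSet_Icc.compl, hμ]
  have hγy : ∀ᵐ z ∂γ, z.1 ∈ Set.Icc (0 : ℝ) m := by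
    refine ae_mem_of_lintegral_indicator measurable_fst measurableSet_Icc ?_
    rw [h1 _ (measurable_one.indicator measurableSet_Icc.compl), hN]
  have hmass : γ Set.univ = c := by
    have := h2 1 measurable_one
    simpa using this
  have key : ∀ k l : ℝ, |k| ≤ l → ∫⁻ z, ENNReal.ofReal (Real.exp (k * (z.1 - m * z.2))) ∂γ ≤
      c * ENNReal.ofReal (Real.exp (l * m)) := by
    intro k l hk
    calc _ ≤ ∫⁻ z, ENNReal.ofReal (Real.exp (l * m)) ∂γ := by
          refine lintegral_mono_ae ?_
          filter_upwards [hγx, hγy] with z hx hy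
          refine ENNReal.ofReal_le_ofReal (Real.exp_le_exp.2 ?_)
          have h5 : |z.1 - m * z.2| ≤ m := by
            rw [abs_le]
            have := mul_le_mul_of_nonneg_left hx.2 hm
            have := mul_nonneg hm hx.1
            constructor <;> linarith [hy.1, hy.2]
          calc k * (z.1 - m * z.2) ≤ |k * (z.1 - m * z.2)| := le_abs_self _
            _ = |k| * |z.1 - m * z.2| := abs_mul _ _
            _ ≤ l * m := mul_le_mul hk h5 (abs_nonneg _) ((abs_nonneg _).trans hk)
      _ = _ := by rw [lintegral_const, hmass, mul_comm]
  refine ⟨γ, h0, h1, h2, fun l hl => ⟨le_min (h3 l hl).1 (key l l ?_),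
    le_min (h3 l hl).2 (key (-l) l ?_)⟩⟩
  · rw [abs_of_nonneg hl.1]
  · rw [abs_neg, abs_of_nonneg hl.1]

/-- The independent coupling with a measure with finitely many atoms. -/
lemma indep [IsProbabilityMeasure μ] {ι : Type*} (s : Finset ι) (Y : ι → ℝ) (a : ℝ) :
    Cpl (fun g => ∑ j ∈ s, g (Y j)) (fun g => (s.card : ℝ≥0∞) * ∫⁻ x, g x ∂μ) a ⊤ ⊤ := by
  refine ⟨(∑ j ∈ s, Measure.dirac (Y j)).prod μ, inferInstance, fun g hg => ?_, fun g hg => ?_,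
    fun l hl => ⟨le_top, le_top⟩⟩
  · rw [lintegral_prod _ (by fun_prop)]
    simp only [lintegral_const, measure_univ, mul_one]
    rw [lintegral_finsetSum_measure]
    exact Finset.sum_congr rfl fun j _ => lintegral_dirac' _ hg
  · rw [lintegral_prod _ (by fun_prop)]
    simp only [lintegral_const]
    rw [mul_comm, Measure.coe_finsetSum, Finset.sum_apply]
    simp

end Cpl

/-- A fixed point of the distributional equation, as an identity for test functions. -/
lemma SolvesRDE.lintegral_eq {μ : Measure ℝ} [SFinite μ] (h : SolvesRDE μ) {g : ℝ → ℝ≥0∞}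
    (hg : Measurable g) :
    ∫⁻ x, g x ∂μ = ∫⁻ u in Set.Ioc 0 1, ∫⁻ x, g (stepMap u x) ∂μ := by
  have hg2 : Measurable fun w : ℝ × ℝ => g (stepMap w.2 w.1) := by
    unfold stepMap; fun_prop
  conv_lhs => rw [h]
  rw [lintegral_map hg (by fun_prop), ← restrict_Ioc_eq_restrict_Icc,
    lintegral_prod_symm _ (by exact hg2.aemeasurable)]
  rfl

/-- Splitting an integral at the points of an increasing sequence. -/
lemma sum_lintegral_Ioc {e : ℕ → ℝ} {k n : ℕ} (hkn : k ≤ n)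
    (he : ∀ j, k ≤ j → j < n → e j ≤ e (j + 1)) (h : ℝ → ℝ≥0∞) :
    ∑ j ∈ Finset.Ico k n, ∫⁻ u in Set.Ioc (e j) (e (j + 1)), h u =
      ∫⁻ u in Set.Ioc (e k) (e n), h u := by
  suffices (∑ j ∈ Finset.Ico k n, ∫⁻ u in Set.Ioc (e j) (e (j + 1)), h u =
      ∫⁻ u in Set.Ioc (e k) (e n), h u) ∧ e k ≤ e n from this.1
  induction n, hkn using Nat.le_induction with
  | base => simp
  | succ n hkn ih =>
    obtain ⟨h1, h2⟩ := ih fun j hj hj' => he j hj (by omega)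
    have h3 := he n hkn (by omega)
    refine ⟨?_, h2.trans h3⟩
    rw [Finset.sum_Ico_succ_top hkn, h1, ← Set.Ioc_union_Ioc_eq_Ioc h2 h3,
      lintegral_union measurableSet_Ioc (Set.Ioc_disjoint_Ioc_of_le le_rfl)]

/-! ### The exponential moments of the two sub-lists -/

/-- The exponential function with values in `[0, ∞]`. -/
noncomputable abbrev eexp (x : ℝ) : ℝ≥0∞ := ENNReal.ofReal (Real.exp x)

lemma eexp_add (x y : ℝ) : eexp (x + y) = eexp x * eexp y := by
  rw [eexp, Real.exp_add, ENNReal.ofReal_mul (Real.exp_pos _).le]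

lemma eexp_mono {x y : ℝ} (h : x ≤ y) : eexp x ≤ eexp y :=
  ENNReal.ofReal_le_ofReal (Real.exp_le_exp.2 h)

/-- The logarithm of the bound for the exponential moments of the orders `l` and `-l` for sub-arrays
of length `m`. The constant `137 / 20` is chosen for `quartic_mul_le`, with a little room below the
`7` of the final bound, and such that its square exceeds `46`, which `couplingBound_of_le` needs. -/
noncomputable def mgfExponent (l m : ℝ) : ℝ := l ^ 2 * m / 8 + l * (137 / 20) * √m

/-- The test function `g`, summed over the numbers of exchanges for all ranks. -/
noncomputable def rankSum (f : ℕ) (A : ℕ → ℕ) (lo hi : ℕ) (g : ℝ → ℝ≥0∞) : ℝ≥0∞ :=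
  ∑ r ∈ Finset.Icc 1 (hi + 1 - lo), g (quickselectExchanges f A lo hi r : ℝ)

/-- The part of `rankSum` belonging to the ranks which lead to the left sub-list. -/
noncomputable def leftSum (f : ℕ) (A : ℕ → ℕ) (lo hi : ℕ) (g : ℝ → ℝ≥0∞) : ℝ≥0∞ :=
  ∑ r ∈ Finset.Icc 1 (A lo - lo), g (quickselectExchanges f A lo hi r : ℝ)

/-- The part of `rankSum` belonging to the ranks which lead to the right sub-list. -/
noncomputable def rightSum (f : ℕ) (A : ℕ → ℕ) (lo hi : ℕ) (g : ℝ → ℝ≥0∞) : ℝ≥0∞ :=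
  ∑ r ∈ Finset.Icc (A lo - lo + 1) (hi + 1 - lo), g (quickselectExchanges f A lo hi r : ℝ)

lemma leftSum_add_rightSum {A : ℕ → ℕ} {lo hi : ℕ} (h : A lo ≤ hi) (f : ℕ) (g : ℝ → ℝ≥0∞) :
    leftSum f A lo hi g + rightSum f A lo hi g = rankSum f A lo hi g := by
  unfold leftSum rightSum rankSum
  have e1 : Finset.Icc 1 (A lo - lo) = Finset.Ioc 0 (A lo - lo) := rfl
  have e2 : Finset.Icc (A lo - lo + 1) (hi + 1 - lo) = Finset.Ioc (A lo - lo) (hi + 1 - lo) := by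
    ext; simp
  have e3 : Finset.Icc 1 (hi + 1 - lo) = Finset.Ioc 0 (hi + 1 - lo) := rfl
  rw [e1, e2, e3, Finset.sum_Ioc_consecutive _ (Nat.zero_le _) (by omega)]

/-- The coupling bound for all sub-arrays of length `m`: `m!` times the law of the number of
exchanges, for a random rank, on a block `A[lo..hi]` whose values other than `lo` have been permuted
at random can be coupled with `m!` times the law `μ` of `X`, compared as `y` with `m x`. A block
whose smallest element stands at its first position is allowed an additional factor for negative
orders, since its first partition performs no exchange. -/
def CouplingBound (μ : Measure ℝ) (m : ℕ) : Prop :=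
  ∀ (f : ℕ) (A : ℕ → ℕ) (lo hi : ℕ), m ≤ f → 1 ≤ lo → hi + 1 = lo + m → IsBlock A lo hi →
    Cpl (fun g => ∑ π ∈ permsOfFinset (Finset.Ioc lo hi), rankSum f (π ∘ A) lo hi g)
      (fun g => (m.factorial : ℝ≥0∞) * ∫⁻ x, g x ∂μ) m
      (fun l => (m.factorial : ℝ≥0∞) * eexp (mgfExponent l m))
      (fun l => (m.factorial : ℝ≥0∞) *
        eexp (mgfExponent l m + if A lo = lo then l - l ^ 2 / 8 else 0))

lemma correction_nonneg {l : ℝ} (hl : l ∈ Set.Icc (0 : ℝ) 4) : 0 ≤ l - l ^ 2 / 8 := by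
  nlinarith [hl.1, hl.2, mul_nonneg hl.1 (sub_nonneg.2 hl.2)]

lemma leftSum_succ {A A' : ℕ → ℕ} {lo hi : ℕ} (hlo : 1 ≤ lo) (hx : lo < A lo) (hxh : A lo ≤ hi)
    {t : ℕ} (h : hoarePartition A lo hi = (A', A lo - 1, t)) (f : ℕ) (g : ℝ → ℝ≥0∞) :
    leftSum (f + 1) A lo hi g = rankSum f A' lo (A lo - 1) fun y => g (t + y) := by
  unfold leftSum rankSum
  rw [show A lo - 1 + 1 - lo = A lo - lo by omega]
  refine Finset.sum_congr rfl fun r hr => ?_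
  rw [Finset.mem_Icc] at hr
  rw [quickselectExchanges_succ (by omega) f r h, if_pos (by omega), Nat.cast_add]

lemma rightSum_succ {A A' : ℕ → ℕ} {lo hi : ℕ} (hlo : 1 ≤ lo) (hx : lo < A lo) (hxh : A lo ≤ hi)
    {t : ℕ} (h : hoarePartition A lo hi = (A', A lo - 1, t)) (f : ℕ) (g : ℝ → ℝ≥0∞) :
    rightSum (f + 1) A lo hi g = rankSum f A' (A lo) hi fun y => g (t + y) := by
  unfold rightSum rankSum
  refine Finset.sum_bij' (fun r _ => r - (A lo - lo)) (fun r _ => r + (A lo - lo)) ?_ ?_ ?_ ?_ ?_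
  · intro r hr; rw [Finset.mem_Icc] at hr ⊢; omega
  · intro r hr; rw [Finset.mem_Icc] at hr ⊢; omega
  · intro r hr; rw [Finset.mem_Icc] at hr; omega
  · intro r hr; rw [Finset.mem_Icc] at hr; omega
  · intro r hr
    rw [Finset.mem_Icc] at hr
    rw [quickselectExchanges_succ (by omega) f r h, if_neg (by omega), Nat.cast_add,
      show A lo - 1 + 1 = A lo by omega, show A lo - 1 - lo + 1 = A lo - lo by omega]

/-- Averaging over the cosets of the permutation group `t` of one sub-list. Inside a coset the
number `T π` of exchanges of the partition is constant and the sub-list is permuted at random, so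
that the induction hypothesis applies; the fluctuation of `T` enters through its exponential
moments. -/
lemma Cpl.sum_cosets {μ : Measure ℝ} {s t : Finset ℕ} (hts : t ⊆ s) {i : ℕ} (hi : t.card + 1 = i)
    {F : Equiv.Perm ℕ → (ℝ → ℝ≥0∞) → ℝ≥0∞} {T : Equiv.Perm ℕ → ℝ} {bp bm cp cm : ℝ → ℝ}
    (h : ∀ π ∈ permsOfFinset s, Cpl (fun g => ∑ ρ ∈ permsOfFinset t, F (ρ * π) g)
      (fun g => (i.factorial : ℝ≥0∞) * ∫⁻ x, g x ∂μ) i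
      (fun l => eexp (l * T π) * ((i.factorial : ℝ≥0∞) * eexp (bp l)))
      (fun l => eexp (-l * T π) * ((i.factorial : ℝ≥0∞) * eexp (bm l))))
    (hp : ∀ l ∈ Set.Icc (0 : ℝ) 4, ∑ π ∈ permsOfFinset s, Real.exp (l * T π) ≤
      s.card.factorial * Real.exp (cp l))
    (hm : ∀ l ∈ Set.Icc (0 : ℝ) 4, ∑ π ∈ permsOfFinset s, Real.exp (-l * T π) ≤
      s.card.factorial * Real.exp (cm l)) :
    Cpl (fun g => ∑ π ∈ permsOfFinset s, F π g)
      (fun g => (s.card.factorial * i : ℝ≥0∞) * ∫⁻ x, g x ∂μ) i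
      (fun l => (s.card.factorial * i : ℝ≥0∞) * eexp (cp l + bp l))
      (fun l => (s.card.factorial * i : ℝ≥0∞) * eexp (cm l + bm l)) := by
  have hc : ((t.card.factorial : ℕ) : ℝ≥0∞)⁻¹ * (i.factorial : ℝ≥0∞) = i := by
    rw [← hi, Nat.factorial_succ, Nat.cast_mul, mul_comm, mul_assoc, ENNReal.mul_inv_cancel,
      mul_one]
    · exact_mod_cast (Nat.factorial_pos _).ne'
    · exact ENNReal.natCast_ne_top _
  have key : ∀ (k : ℝ) (b c : ℝ), ∑ π ∈ permsOfFinset s, Real.exp (k * T π) ≤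
      s.card.factorial * Real.exp c → ∑ π ∈ permsOfFinset s, ((t.card.factorial : ℕ) : ℝ≥0∞)⁻¹ *
        (eexp (k * T π) * ((i.factorial : ℝ≥0∞) * eexp b)) ≤
      (s.card.factorial * i : ℝ≥0∞) * eexp (c + b) := by
    intro k b c hk
    calc _ = ∑ π ∈ permsOfFinset s, eexp (k * T π) * (i * eexp b) := by
          refine Finset.sum_congr rfl fun π _ => ?_
          rw [← hc]; ring
      _ = ENNReal.ofReal (∑ π ∈ permsOfFinset s, Real.exp (k * T π)) * (i * eexp b) := by
          rw [← Finset.sum_mul, ENNReal.ofReal_sum_of_nonneg fun _ _ => (Real.exp_pos _).le]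
      _ ≤ ENNReal.ofReal (s.card.factorial * Real.exp c) * (i * eexp b) := by gcongr
      _ = _ := by
          rw [ENNReal.ofReal_mul (Nat.cast_nonneg _), ENNReal.ofReal_natCast, eexp_add]; ring
  refine (Cpl.sum _ fun π hπ => (h π hπ).smul ((t.card.factorial : ℕ) : ℝ≥0∞)⁻¹).mono
    (fun g _ => ?_) (fun g _ => ?_) (fun l hl => key l _ _ (hp l hl))
    (fun l hl => key (-l) _ _ (hm l hl))
  · exact (sum_perms_coset hts fun π => F π g).symm
  · rw [Finset.sum_const, card_perms_of_finset, nsmul_eq_mul, ← mul_assoc _ _ (∫⁻ x, g x ∂μ), hc,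
      mul_assoc]

section Core

variable {A : ℕ → ℕ} {lo hi : ℕ}

lemma IsBlock.comp_perms (hA : IsBlock A lo hi) {s : Finset ℕ} (hs : s ⊆ Finset.Icc lo hi)
    {π : Equiv.Perm ℕ} (hπ : π ∈ permsOfFinset s) : IsBlock (π ∘ A) lo hi :=
  hA.comp_perm fun v hv => mem_perms.1 hπ v fun h => hv (by simpa using hs h)

/-- The values of the positions that the left sub-list receives, without the smallest value of the
block. -/
def leftValues (A : ℕ → ℕ) (lo : ℕ) : Finset ℕ := ((Finset.Ioc lo (A lo - 1)).image A).erase lo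

lemma leftValues_subset (hA : IsBlock A lo hi) (hx : lo < A lo) (hxh : A lo ≤ hi) :
    leftValues A lo ⊆ (Finset.Ioc lo hi).erase (A lo) := by
  intro v hv
  simp only [leftValues, Finset.mem_erase, Finset.mem_image, Finset.mem_Ioc] at hv ⊢
  obtain ⟨hv, p, hp, rfl⟩ := hv
  have h1 := hA.mapsTo (show p ∈ Set.Icc lo hi from ⟨by omega, by omega⟩)
  refine ⟨fun h => ?_, lt_of_le_of_ne h1.1 (Ne.symm hv), h1.2⟩
  have := hA.eq_of_eq (by omega) (by omega) le_rfl (by omega) h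
  omega

/-- Whether the smallest value of the block stands to the left of the position of the pivot decides
on the number of values in `leftValues`. -/
lemma card_leftValues (hA : IsBlock A lo hi) (hx : lo < A lo) (hxh : A lo ≤ hi) :
    (leftValues A lo).card + lo + 1 = A lo ∨ (leftValues A lo).card + lo + 2 = A lo := by
  have h1 : ((Finset.Ioc lo (A lo - 1)).image A).card = A lo - 1 - lo := by
    rw [Finset.card_image_of_injOn, Nat.card_Ioc]
    intro p hp q hq h
    simp only [Finset.coe_Ioc, Set.mem_Ioc] at hp hq
    exact hA.eq_of_eq (by omega) (by omega) (by omega) (by omega) h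
  unfold leftValues
  by_cases h : lo ∈ (Finset.Ioc lo (A lo - 1)).image A
  · rw [Finset.card_erase_of_mem h, h1]
    have : 0 < ((Finset.Ioc lo (A lo - 1)).image A).card := Finset.card_pos.2 ⟨_, h⟩
    omega
  · rw [Finset.erase_eq_of_notMem h, h1]
    omega

/-- Under a permutation of the values other than `lo` and the pivot, the number of exchanges counts
the values in `leftValues` that are sent beyond the pivot. -/
lemma bigsLeft_comp (hA : IsBlock A lo hi) (hx : lo < A lo) (hxh : A lo ≤ hi)
    {π : Equiv.Perm ℕ} (hπ : π ∈ permsOfFinset ((Finset.Ioc lo hi).erase (A lo))) :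
    bigsLeft (π ∘ A) lo =
      ((leftValues A lo).filter fun v => π v ∈ Finset.Ioc (A lo) hi).card := by
  have hπx : π (A lo) = A lo := mem_perms.1 hπ _ (by simp)
  have hπl : π lo = lo := mem_perms.1 hπ _ (by simp)
  have hb := hA.comp_perms (s := (Finset.Ioc lo hi).erase (A lo))
    (fun v hv => by simp at hv ⊢; omega) hπ
  unfold bigsLeft
  simp only [Function.comp_apply, hπx]
  refine Finset.card_bij (fun p _ => A p) (fun p hp => ?_) (fun p hp q hq h => ?_) (fun v hv => ?_)
  · simp only [Finset.mem_filter, Finset.mem_Ioc, leftValues, Finset.mem_erase,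
      Finset.mem_image] at hp ⊢
    have := hb.mapsTo (show p ∈ Set.Icc lo hi from ⟨by omega, by omega⟩)
    refine ⟨⟨fun h => ?_, p, hp.1, rfl⟩, hp.2, this.2⟩
    rw [h, hπl] at hp
    omega
  · simp only [Finset.mem_filter, Finset.mem_Ioc] at hp hq
    exact hA.eq_of_eq (by omega) (by omega) (by omega) (by omega) h
  · simp only [Finset.mem_filter, Finset.mem_Ioc, leftValues, Finset.mem_erase,
      Finset.mem_image] at hv ⊢
    obtain ⟨⟨_, p, hp, rfl⟩, hv⟩ := hv
    exact ⟨p, ⟨hp, hv.1⟩, rfl⟩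

end Core

/-- The logarithm of the bound for positive orders after a partition of a block of length `m`, for a
sub-list of length `i`: mean and variance proxy of the number of exchanges, and the bound for the
sub-list. -/
noncomputable def upperExponent (l m i : ℝ) : ℝ :=
  l * (1 + (i - 1) * (m - i - 1) / (m - 2)) + l ^ 2 * (m - i - 1) / 8 + mgfExponent l i

/-- The logarithm of the bound for negative orders after a partition of a block of length `m`, for a
sub-list of length `i`. The maximum covers what the mean number of exchanges may lose when the
smallest key of the block stands to the left of the final place of the pivot. -/
noncomputable def lowerExponent (l m i : ℝ) : ℝ :=
  l * max ((m - i) / (m - 1)) (1 - l / 8) - l * (i * (1 - i / m)) + l ^ 2 * (m - i - 1) / 8 +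
    (mgfExponent l i + (l - l ^ 2 / 8))

section Core

variable {μ : Measure ℝ} {A : ℕ → ℕ} {lo hi f m i : ℕ}

lemma sum_exp_one_add_le {s S T : Finset ℕ} {k E c : ℝ}
    (h : ∑ π ∈ permsOfFinset s, Real.exp (k * ((S.filter fun v => π v ∈ T).card : ℝ)) ≤
      s.card.factorial * Real.exp E) (hc : k + E ≤ c) :
    ∑ π ∈ permsOfFinset s, Real.exp (k * (1 + ((S.filter fun v => π v ∈ T).card : ℝ))) ≤
      s.card.factorial * Real.exp c := by
  calc _ = Real.exp k * ∑ π ∈ permsOfFinset s,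
        Real.exp (k * ((S.filter fun v => π v ∈ T).card : ℝ)) := by
        rw [Finset.mul_sum]
        refine Finset.sum_congr rfl fun π _ => ?_
        rw [← Real.exp_add]; congr 1; ring
    _ ≤ Real.exp k * (s.card.factorial * Real.exp E) := by gcongr
    _ = s.card.factorial * Real.exp (k + E) := by rw [Real.exp_add]; ring
    _ ≤ _ := by gcongr

/-- The contribution of the left sub-list, of length `i`, for a fixed pivot. The number of exchanges
is one plus the number of values at the positions of the left sub-list which are sent beyond the
pivot, a hypergeometric variable. -/
lemma core_left (hm : 3 ≤ m) (hi1 : 1 ≤ i) (him : i + 1 ≤ m) (hc : CouplingBound μ i) (hf : i ≤ f)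
    (hlo : 1 ≤ lo) (hlh : hi + 1 = lo + m) (hA : IsBlock A lo hi) (hAi : A lo = lo + i) :
    Cpl (fun g => ∑ π ∈ permsOfFinset ((Finset.Ioc lo hi).erase (A lo)),
        leftSum (f + 1) (π ∘ A) lo hi g)
      (fun g => ((m - 2).factorial * i : ℝ≥0∞) * ∫⁻ x, g x ∂μ) i
      (fun l => ((m - 2).factorial * i : ℝ≥0∞) * eexp (upperExponent l m i))
      (fun l => ((m - 2).factorial * i : ℝ≥0∞) * eexp (lowerExponent l m i)) := by
  have hx : lo < A lo := by omega
  have hxh : A lo ≤ hi := by omega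
  set s := (Finset.Ioc lo hi).erase (A lo) with hs
  set t := Finset.Ioc lo (A lo - 1) with ht
  have hsc : s.card = m - 2 := by
    rw [hs, Finset.card_erase_of_mem (by simp; omega), Nat.card_Ioc]; omega
  have htc : t.card + 1 = i := by rw [ht, Nat.card_Ioc]; omega
  have hts : t ⊆ s := by
    intro v hv; simp only [ht, hs, Finset.mem_Ioc, Finset.mem_erase] at hv ⊢; omega
  have hS : leftValues A lo ⊆ s := leftValues_subset hA hx hxh
  have hT : Finset.Ioc (A lo) hi ⊆ s := by
    intro v hv; simp only [hs, Finset.mem_Ioc, Finset.mem_erase] at hv ⊢; omega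
  have hTc : (Finset.Ioc (A lo) hi).card = m - i - 1 := by rw [Nat.card_Ioc]; omega
  have hmR : (3 : ℝ) ≤ m := by exact_mod_cast hm
  have hiR : (1 : ℝ) ≤ i := by exact_mod_cast hi1
  have himR : (i : ℝ) + 1 ≤ m := by exact_mod_cast him
  have hTR : ((Finset.Ioc (A lo) hi).card : ℝ) = m - i - 1 := by
    rw [hTc, Nat.sub_sub, Nat.cast_sub him]; push_cast; ring
  have hsR : (s.card : ℝ) = m - 2 := by rw [hsc, Nat.cast_sub (by omega)]; norm_num
  have hSR : ((leftValues A lo).card : ℝ) = i - 1 ∨ ((leftValues A lo).card : ℝ) = i - 1 - 1 := by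
    rcases card_leftValues hA hx hxh with h | h
    · left
      have : (leftValues A lo).card + 1 = i := by omega
      rw [← this]; push_cast; ring
    · right
      have : (leftValues A lo).card + 2 = i := by omega
      rw [← this]; push_cast; ring
  have hmean := mean_exchanges_le hmR hiR (by linarith)
  have hq0 : 0 ≤ ((m : ℝ) - i - 1) / (m - 2) := div_nonneg (by linarith) (by linarith)
  have hq1 : ((m : ℝ) - i - 1) / (m - 2) ≤ (m - i) / (m - 1) := by
    rw [div_le_div_iff₀ (by linarith) (by linarith)]; nlinarith
  have := Cpl.sum_cosets (μ := μ) hts htc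
    (F := fun π g => leftSum (f + 1) (π ∘ A) lo hi g)
    (T := fun π => 1 + (((leftValues A lo).filter fun v => π v ∈ Finset.Ioc (A lo) hi).card : ℝ))
    (bp := fun l => mgfExponent l i) (bm := fun l => mgfExponent l i + (l - l ^ 2 / 8))
    (cp := fun l => l * (1 + (i - 1) * (m - i - 1) / (m - 2)) + l ^ 2 * (m - i - 1) / 8)
    (cm := fun l => l * max (((m : ℝ) - i) / (m - 1)) (1 - l / 8) - l * (i * (1 - i / m)) +
      l ^ 2 * (m - i - 1) / 8) ?_ ?_ ?_
  · rw [hsc] at this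
    exact this
  · intro π hπ
    have hb := hA.comp_perms (s := s) (fun v hv => by simp [hs] at hv ⊢; omega) hπ
    have hπx : π (A lo) = A lo := mem_perms.1 hπ _ (by simp [hs])
    obtain ⟨A', h1, h2, h3⟩ := hoarePartition_spec hlo (by omega) hb (by simp [hπx]; omega)
    simp only [Function.comp_apply, hπx] at h1 h2 h3
    have h4 := (hc f A' lo (A lo - 1) hf hlo (by omega) h2).shift
      ((1 + bigsLeft (π ∘ A) lo : ℕ) : ℝ)
    rw [bigsLeft_comp hA hx hxh hπ] at h1 h4
    push_cast at h4
    refine h4.mono (fun g hg => ?_) (fun g hg => rfl) (fun l hl => le_rfl) (fun l hl => ?_)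
    · refine Finset.sum_congr rfl fun ρ hρ => ?_
      have hρ' : ∀ v, (v ≤ lo ∨ A lo ≤ v) → ρ v = v := fun v hv =>
        mem_perms.1 hρ v (by simp [ht]; omega)
      have hρm : ∀ v, (lo < v ∧ v < A lo) → (lo < ρ v ∧ ρ v < A lo) := fun v hv => by
        have := (perms_apply_mem hρ (v := v)).2 (by simp [ht]; omega)
        simp [ht] at this; omega
      have hρx := hρ' (A lo) (by simp)
      have h5 : hoarePartition ((ρ * π : Equiv.Perm ℕ) ∘ A) lo hi = (ρ ∘ A',
          ((ρ * π : Equiv.Perm ℕ) ∘ A) lo - 1,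
          1 + ((leftValues A lo).filter fun v => π v ∈ Finset.Ioc (A lo) hi).card) := by
        rw [Equiv.Perm.coe_mul, Function.comp_assoc, hoarePartition_comp, h1]
        · simp [hπx, hρx]
        all_goals
          intro v
          simp only [Function.comp_apply, hπx]
          have a1 := hρ' v
          have a2 := hρm v
          by_cases hv : lo < v ∧ v < A lo
          · have := a2 hv; omega
          · rw [a1 (by omega)]
      have h6 := leftSum_succ (A := (ρ * π : Equiv.Perm ℕ) ∘ A) hlo (by simp [hπx, hρx]; omega)
        (by simp [hπx, hρx]; omega) h5 f g
      rw [h6]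
      simp [hπx, hρx]
    · have hcn := correction_nonneg hl
      refine mul_le_mul' le_rfl (mul_le_mul' le_rfl (eexp_mono ?_))
      split_ifs <;> linarith
  · intro l hl
    refine sum_exp_one_add_le (sum_perms_exp_le' hS hT l) ?_
    rw [hTR, hsR, mul_div_assoc, mul_div_assoc ((i : ℝ) - 1)]
    rcases hSR with h | h <;> rw [h]
    · linarith
    · nlinarith [mul_nonneg hl.1 hq0]
  · intro l hl
    refine sum_exp_one_add_le (sum_perms_exp_le' hS hT (-l)) ?_
    rw [hTR, hsR, mul_div_assoc]
    rw [mul_div_assoc] at hmean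
    have h7 := mul_nonneg hl.1 hmean.2.2
    have h8 := mul_le_mul_of_nonneg_left (hq1.trans (le_max_left _ (1 - l / 8))) hl.1
    have h9 := mul_nonneg hl.1 hq0
    rcases hSR with h | h <;> rw [h] <;> nlinarith

/-- The contribution of the right sub-list, of length `i`, for a fixed pivot; the analogue of
`core_left`. -/
lemma core_right (hm : 3 ≤ m) (hi1 : 1 ≤ i) (him : i + 1 ≤ m) (hc : CouplingBound μ i) (hf : i ≤ f)
    (hlo : 1 ≤ lo) (hlh : hi + 1 = lo + m) (hA : IsBlock A lo hi) (hAi : A lo + i = hi + 1) :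
    Cpl (fun g => ∑ π ∈ permsOfFinset ((Finset.Ioc lo hi).erase (A lo)),
        rightSum (f + 1) (π ∘ A) lo hi g)
      (fun g => ((m - 2).factorial * i : ℝ≥0∞) * ∫⁻ x, g x ∂μ) i
      (fun l => ((m - 2).factorial * i : ℝ≥0∞) * eexp (upperExponent l m i))
      (fun l => ((m - 2).factorial * i : ℝ≥0∞) * eexp (lowerExponent l m i)) := by
  have hx : lo < A lo := by omega
  have hxh : A lo ≤ hi := by omega
  set s := (Finset.Ioc lo hi).erase (A lo) with hs
  set t := Finset.Ioc (A lo) hi with ht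
  have hsc : s.card = m - 2 := by
    rw [hs, Finset.card_erase_of_mem (by simp; omega), Nat.card_Ioc]; omega
  have htc : t.card + 1 = i := by rw [ht, Nat.card_Ioc]; omega
  have hts : t ⊆ s := by
    intro v hv; simp only [ht, hs, Finset.mem_Ioc, Finset.mem_erase] at hv ⊢; omega
  have hS : leftValues A lo ⊆ s := leftValues_subset hA hx hxh
  have hmR : (3 : ℝ) ≤ m := by exact_mod_cast hm
  have hiR : (1 : ℝ) ≤ i := by exact_mod_cast hi1
  have himR : (i : ℝ) + 1 ≤ m := by exact_mod_cast him
  have htR : (t.card : ℝ) = i - 1 := by rw [← htc]; push_cast; ring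
  have hsR : (s.card : ℝ) = m - 2 := by rw [hsc, Nat.cast_sub (by omega)]; norm_num
  have hSR : ((leftValues A lo).card : ℝ) = m - i - 1 ∨
      ((leftValues A lo).card : ℝ) = m - i - 1 - 1 := by
    rcases card_leftValues hA hx hxh with h | h
    · left
      have : (leftValues A lo).card + i + 1 = m := by omega
      rw [← this]; push_cast; ring
    · right
      have : (leftValues A lo).card + i + 2 = m := by omega
      rw [← this]; push_cast; ring
  have hmean := mean_exchanges_le hmR hiR (by linarith)
  have hq0 : 0 ≤ ((i : ℝ) - 1) / (m - 2) := div_nonneg (by linarith) (by linarith)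
  have hq1 : ((i : ℝ) - 1) / (m - 2) ≤ 1 := by
    rw [div_le_one (by linarith)]; linarith
  have hcomm : ((i : ℝ) - 1) * (m - i - 1) / (m - 2) = (m - i - 1) * ((i - 1) / (m - 2)) := by ring
  have := Cpl.sum_cosets (μ := μ) hts htc
    (F := fun π g => rightSum (f + 1) (π ∘ A) lo hi g)
    (T := fun π => 1 + (((leftValues A lo).filter fun v => π v ∈ Finset.Ioc (A lo) hi).card : ℝ))
    (bp := fun l => mgfExponent l i) (bm := fun l => mgfExponent l i + (l - l ^ 2 / 8))
    (cp := fun l => l * (1 + (i - 1) * (m - i - 1) / (m - 2)) + l ^ 2 * (m - i - 1) / 8)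
    (cm := fun l => l * max (((m : ℝ) - i) / (m - 1)) (1 - l / 8) - l * (i * (1 - i / m)) +
      l ^ 2 * (m - i - 1) / 8) ?_ ?_ ?_
  · rw [hsc] at this
    exact this
  · intro π hπ
    have hb := hA.comp_perms (s := s) (fun v hv => by simp [hs] at hv ⊢; omega) hπ
    have hπx : π (A lo) = A lo := mem_perms.1 hπ _ (by simp [hs])
    obtain ⟨A', h1, h2, h3⟩ := hoarePartition_spec hlo (by omega) hb (by simp [hπx]; omega)
    simp only [Function.comp_apply, hπx] at h1 h2 h3
    have h4 := (hc f A' (A lo) hi hf (by omega) (by omega) h3).shift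
      ((1 + bigsLeft (π ∘ A) lo : ℕ) : ℝ)
    rw [bigsLeft_comp hA hx hxh hπ] at h1 h4
    push_cast at h4
    refine h4.mono (fun g hg => ?_) (fun g hg => rfl) (fun l hl => le_rfl) (fun l hl => ?_)
    · refine Finset.sum_congr rfl fun ρ hρ => ?_
      have hρ' : ∀ v, (v ≤ A lo ∨ hi < v) → ρ v = v := fun v hv =>
        mem_perms.1 hρ v (by simp [ht]; omega)
      have hρm : ∀ v, (A lo < v ∧ v ≤ hi) → (A lo < ρ v ∧ ρ v ≤ hi) := fun v hv => by
        have := (perms_apply_mem hρ (v := v)).2 (by simp [ht]; omega)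
        simp [ht] at this; omega
      have hρx := hρ' (A lo) (by simp)
      have h5 : hoarePartition ((ρ * π : Equiv.Perm ℕ) ∘ A) lo hi = (ρ ∘ A',
          ((ρ * π : Equiv.Perm ℕ) ∘ A) lo - 1,
          1 + ((leftValues A lo).filter fun v => π v ∈ Finset.Ioc (A lo) hi).card) := by
        rw [Equiv.Perm.coe_mul, Function.comp_assoc, hoarePartition_comp, h1]
        · simp [hπx, hρx]
        all_goals
          intro v
          simp only [Function.comp_apply, hπx]
          have a1 := hρ' v
          have a2 := hρm v
          by_cases hv : A lo < v ∧ v ≤ hi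
          · have := a2 hv; omega
          · rw [a1 (by omega)]
      have h6 := rightSum_succ (A := (ρ * π : Equiv.Perm ℕ) ∘ A) hlo (by simp [hπx, hρx]; omega)
        (by simp [hπx, hρx]; omega) h5 f g
      rw [h6]
      simp [hπx, hρx]
    · have hcn := correction_nonneg hl
      refine mul_le_mul' le_rfl (mul_le_mul' le_rfl (eexp_mono ?_))
      split_ifs <;> linarith
  · intro l hl
    refine sum_exp_one_add_le (sum_perms_exp_le hS hts l) ?_
    rw [htR, hsR, mul_div_assoc, hcomm]
    rcases hSR with h | h <;> rw [h]
    · linarith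
    · nlinarith [mul_nonneg hl.1 hq0, sq_nonneg l]
  · intro l hl
    refine sum_exp_one_add_le (sum_perms_exp_le hS hts (-l)) ?_
    rw [htR, hsR, mul_div_assoc]
    rw [hcomm] at hmean
    have h7 := mul_nonneg hl.1 hmean.2.2
    have h8 := mul_le_mul_of_nonneg_left (le_max_right (((m : ℝ) - i) / (m - 1)) (1 - l / 8)) hl.1
    have h9 := mul_nonneg hl.1 hq0
    have h10 := mul_nonneg hl.1 (sub_nonneg.2 hq1)
    have h11 : 0 ≤ l * max (((m : ℝ) - i) / (m - 1)) (1 - l / 8) :=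
      mul_nonneg hl.1 (le_max_of_le_left (div_nonneg (by linarith) (by linarith)))
    rcases hSR with h | h <;> rw [h] <;> nlinarith

end Core

/-! ### The recursive step -/

/-- The logarithm of a bound for the contribution of the sub-lists of length `i`, in all cases. Here
`477 / 100 = 137 / 20 - 2.08`, the `2.08` being spent in `shifted_lower`. -/
noncomputable def stepExponent (l m i : ℝ) : ℝ :=
  mgfExponent l m + l * (2 - 3 * l / 8 + 2.5 * ((m - i) / (m - 1)) - 477 / 100 * (√m - √i))

/-- The bound obtained by summing over the lengths `i` of the sub-lists, where length `i` has the
weight `2 i / (m (m - 1))` in the total mass `m!`. -/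
noncomputable def stepBound (l : ℝ) (m : ℕ) : ℝ≥0∞ :=
  ∑ i ∈ Finset.Ico 1 m, (2 * ((m - 2).factorial * i) : ℝ≥0∞) * eexp (stepExponent l m i)

section Exponents

variable {l m i : ℝ}

lemma stepExponent_eq (l m i : ℝ) : stepExponent l m i = l ^ 2 * m / 8 + l * (137 / 20) * √i +
    l * (137 / 20 * (√m - √i)) +
    l * (2 - 3 * l / 8 + 2.5 * ((m - i) / (m - 1)) - 477 / 100 * (√m - √i)) := by
  unfold stepExponent mgfExponent; ring

lemma upper_generic_le (hl : l ∈ Set.Icc (0 : ℝ) 4) (him : i ≤ m) :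
    l * (1 + 2.5 * ((m - i) / (m - 1)) - (1 + (i - 1) * (m - i - 1) / (m - 2))) +
      upperExponent l m i ≤ stepExponent l m i := by
  have hd := mul_nonneg hl.1 (sub_nonneg.2 (Real.sqrt_le_sqrt him))
  have hl2 := mul_nonneg hl.1 (sub_nonneg.2 hl.2)
  rw [stepExponent_eq]
  unfold upperExponent mgfExponent
  linarith

lemma lower_generic_le (hl : l ∈ Set.Icc (0 : ℝ) 4) (hm : 1 < m) (hi : 1 ≤ i) (him : i ≤ m) :
    l * (2 * ((m - i) / (m - 1)) + i * (1 - i / m)) + lowerExponent l m i ≤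
      0 + stepExponent l m i := by
  have hd := mul_nonneg hl.1 (sub_nonneg.2 (Real.sqrt_le_sqrt him))
  have hl2 := mul_nonneg hl.1 (sub_nonneg.2 hl.2)
  have ht0 : 0 ≤ (m - i) / (m - 1) := div_nonneg (by linarith) (by linarith)
  have ht1 : (m - i) / (m - 1) ≤ 1 := by rw [div_le_one (by linarith)]; linarith
  have h1 := mul_nonneg hl.1 ht0
  have h2 := mul_nonneg hl.1 (sub_nonneg.2 ht1)
  rw [stepExponent_eq]
  unfold lowerExponent mgfExponent
  rcases max_choice ((m - i) / (m - 1)) (1 - l / 8) with h | h <;> rw [h] <;> linarith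

lemma upper_shifted_le (hl : l ∈ Set.Icc (0 : ℝ) 4) (hm : 1 < m) (him : i ≤ m) :
    l * (3 / 2 + (m - i) / (m - 1) - (1 + (i - 1) * (m - 1 - i - 1) / (m - 1 - 2))) +
      upperExponent l (m - 1) i ≤ stepExponent l m i := by
  have hd := mul_nonneg hl.1 (sub_nonneg.2 (Real.sqrt_le_sqrt him))
  have hl2 := mul_nonneg hl.1 (sub_nonneg.2 hl.2)
  have h1 := mul_nonneg hl.1 (div_nonneg (by linarith) (by linarith) : 0 ≤ (m - i) / (m - 1))
  rw [stepExponent_eq]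
  unfold upperExponent mgfExponent
  linarith

lemma lower_shifted_le (hl : l ∈ Set.Icc (0 : ℝ) 4) (hm : 2 < m) (hi : 1 ≤ i) (him : i ≤ m) :
    l * (1 + (m - i) / (m - 1) + 2.08 * (√m - √i) + i * (1 - i / (m - 1))) +
      lowerExponent l (m - 1) i ≤ (l - l ^ 2 / 8) + stepExponent l m i := by
  have hd := mul_nonneg hl.1 (sub_nonneg.2 (Real.sqrt_le_sqrt him))
  have hl2 := mul_nonneg hl.1 (sub_nonneg.2 hl.2)
  have ht0 : 0 ≤ (m - i) / (m - 1) := div_nonneg (by linarith) (by linarith)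
  have h1 := mul_nonneg hl.1 ht0
  have h2 : (m - 1 - i) / (m - 1 - 1) ≤ (m - i) / (m - 1) := by
    rw [div_le_div_iff₀ (by linarith) (by linarith)]; nlinarith
  have h3 := mul_le_mul_of_nonneg_left h2 hl.1
  have h0 := hl.1
  rw [stepExponent_eq]
  unfold lowerExponent mgfExponent
  rcases max_choice ((m - 1 - i) / (m - 1 - 1)) (1 - l / 8) with h | h <;> rw [h] <;> linarith

end Exponents

lemma factorial_eq_mul {m : ℕ} (hm : 2 ≤ m) :
    (m.factorial : ℝ) = (m - 2).factorial * (m * (m - 1)) := by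
  obtain ⟨k, rfl⟩ := Nat.exists_eq_add_of_le' hm
  rw [Nat.add_sub_cancel, Nat.factorial_succ, Nat.factorial_succ]
  push_cast; ring

lemma stepBound_le {l : ℝ} {m : ℕ} (hm : 47 ≤ m) (hl : l ∈ Set.Icc (0 : ℝ) 4)
    (h : 137 / 20 ≤ √m * (1 - l / 8)) :
    stepBound l m ≤ (m.factorial : ℝ≥0∞) * eexp (mgfExponent l m) := by
  have h1 : ∀ i ∈ Finset.Ico 1 m, (2 * ((m - 2).factorial * i) : ℝ≥0∞) *
      eexp (stepExponent l m i) = ENNReal.ofReal ((m - 2).factorial * Real.exp (mgfExponent l m) *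
        (2 * (i : ℝ) * Real.exp (l * (2 - 3 * l / 8 +
      2.5 * (((m : ℝ) - i) / (m - 1)) - 477 / 100 * (√m - √i))))) := by
    intro i _
    rw [stepExponent, eexp, Real.exp_add, ← ENNReal.ofReal_natCast, ← ENNReal.ofReal_natCast,
      ← ENNReal.ofReal_ofNat, ← ENNReal.ofReal_mul (by positivity),
      ← ENNReal.ofReal_mul (by positivity), ← ENNReal.ofReal_mul (by positivity)]
    congr 1; ring
  rw [stepBound, Finset.sum_congr rfl h1, ← ENNReal.ofReal_sum_of_nonneg fun _ _ => by positivity,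
    ← Finset.mul_sum, eexp, ← ENNReal.ofReal_natCast, ← ENNReal.ofReal_mul (by positivity)]
  refine ENNReal.ofReal_le_ofReal ?_
  rw [factorial_eq_mul (m := m) (by omega)]
  calc _ ≤ (m - 2).factorial * Real.exp (mgfExponent l m) * ((m : ℝ) * (m - 1)) := by
        gcongr
        exact sum_step_le hm hl.1 hl.2 h
    _ = _ := by ring

lemma sum_Ioc_eq_sum_add {M : Type*} [AddCommMonoid M] {lo hi m : ℕ} (h : hi + 1 = lo + m)
    (F : ℕ → M) : ∑ b ∈ Finset.Ioc lo hi, F b = ∑ i ∈ Finset.Ico 1 m, F (lo + i) := by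
  refine Finset.sum_bij' (fun b _ => b - lo) (fun i _ => lo + i) ?_ ?_ ?_ ?_ ?_
  all_goals
    intro b hb
    first | rw [Finset.mem_Ioc] at hb | rw [Finset.mem_Ico] at hb
    first | (rw [Finset.mem_Ico]; omega) | (rw [Finset.mem_Ioc]; omega) | omega | (congr 1; omega)

lemma sum_Ioc_eq_sum_sub {M : Type*} [AddCommMonoid M] {lo hi m : ℕ} (h : hi + 1 = lo + m)
    (F : ℕ → M) : ∑ b ∈ Finset.Ioc lo hi, F b = ∑ i ∈ Finset.Ico 1 m, F (hi + 1 - i) := by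
  refine Finset.sum_bij' (fun b _ => hi + 1 - b) (fun i _ => hi + 1 - i) ?_ ?_ ?_ ?_ ?_
  all_goals
    intro b hb
    first | rw [Finset.mem_Ioc] at hb | rw [Finset.mem_Ico] at hb
    first | (rw [Finset.mem_Ico]; omega) | (rw [Finset.mem_Ioc]; omega) | omega | (congr 1; omega)

/-- Averaging over cosets when the bounds are the same on all of them. -/
lemma Cpl.sum_cosets_const {μ : Measure ℝ} {s t : Finset ℕ} (hts : t ⊆ s) {a : ℝ} {c : ℝ≥0∞}
    {F : Equiv.Perm ℕ → (ℝ → ℝ≥0∞) → ℝ≥0∞} {Bp Bm : ℝ → ℝ≥0∞}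
    (h : ∀ π ∈ permsOfFinset s, Cpl (fun g => ∑ ρ ∈ permsOfFinset t, F (ρ * π) g)
      (fun g => (t.card.factorial * c : ℝ≥0∞) * ∫⁻ x, g x ∂μ) a
      (fun l => (t.card.factorial * c : ℝ≥0∞) * Bp l)
      (fun l => (t.card.factorial * c : ℝ≥0∞) * Bm l)) :
    Cpl (fun g => ∑ π ∈ permsOfFinset s, F π g)
      (fun g => (s.card.factorial * c : ℝ≥0∞) * ∫⁻ x, g x ∂μ) a
      (fun l => (s.card.factorial * c : ℝ≥0∞) * Bp l)
      (fun l => (s.card.factorial * c : ℝ≥0∞) * Bm l) := by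
  have key : ∀ b : ℝ≥0∞, ∑ π ∈ permsOfFinset s, ((t.card.factorial : ℕ) : ℝ≥0∞)⁻¹ *
      ((t.card.factorial * c : ℝ≥0∞) * b) = (s.card.factorial * c : ℝ≥0∞) * b := by
    intro b
    rw [Finset.sum_const, card_perms_of_finset, nsmul_eq_mul, ← mul_assoc _ _ b,
      ENNReal.inv_mul_cancel_left' (fun h0 => by
        exact absurd h0 (by exact_mod_cast (Nat.factorial_pos _).ne'))
        (fun h0 => absurd h0 (ENNReal.natCast_ne_top _)), mul_assoc]
  exact (Cpl.sum _ fun π hπ => (h π hπ).smul ((t.card.factorial : ℕ) : ℝ≥0∞)⁻¹).mono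
    (fun g _ => (sum_perms_coset hts fun π => F π g).symm) (fun g _ => key _)
    (fun l _ => (key _).le) (fun l _ => (key _).le)

section Step

variable {μ : Measure ℝ} {m : ℕ} {N N₁ N₂ : (ℝ → ℝ≥0∞) → ℝ≥0∞}

/-- The contributions of the sub-lists of length `i` on the left and on the right together belong
to one interval `(α, β]` of values of `u` in the fixed point equation, whose length is the weight
`2 i / (m (m - 1))` of the length `i`. -/
lemma Cpl.step_pair [SFinite μ] (hμ : μ (Set.Icc 0 1)ᶜ = 0) (hm : 2 ≤ m) {i : ℕ} (hi : 1 ≤ i)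
    {α β ep em : ℝ} (hαβ : α < β) (hlen : 1 / (β - α) = m * (m - 1) / (2 * i))
    {cp cm κ : ℝ → ℝ}
    (h₁ : Cpl N₁ (fun g => ((m - 2).factorial * i : ℝ≥0∞) * ∫⁻ x, g x ∂μ) i
      (fun l => ((m - 2).factorial * i : ℝ≥0∞) * eexp (cp l))
      (fun l => ((m - 2).factorial * i : ℝ≥0∞) * eexp (cm l)))
    (h₂ : Cpl N₂ (fun g => ((m - 2).factorial * i : ℝ≥0∞) * ∫⁻ x, g x ∂μ) i
      (fun l => ((m - 2).factorial * i : ℝ≥0∞) * eexp (cp l))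
      (fun l => ((m - 2).factorial * i : ℝ≥0∞) * eexp (cm l)))
    (hep : ∀ u ∈ Set.Ioc α β, ∀ x ∈ Set.Icc (0 : ℝ) 1, i * x - m * stepMap u x ≤ ep)
    (hem : ∀ u ∈ Set.Ioc α β, ∀ x ∈ Set.Icc (0 : ℝ) 1, m * stepMap u x - i * x ≤ em)
    (hcp : ∀ l ∈ Set.Icc (0 : ℝ) 4, l * ep + cp l ≤ stepExponent l m i)
    (hcm : ∀ l ∈ Set.Icc (0 : ℝ) 4, l * em + cm l ≤ κ l + stepExponent l m i) :
    Cpl (fun g => N₁ g + N₂ g)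
      (fun g => (m.factorial : ℝ≥0∞) * ∫⁻ u in Set.Ioc α β, ∫⁻ x, g (stepMap u x) ∂μ) m
      (fun l => (2 * ((m - 2).factorial * i) : ℝ≥0∞) * eexp (stepExponent l m i))
      (fun l => eexp (κ l) *
        ((2 * ((m - 2).factorial * i) : ℝ≥0∞) * eexp (stepExponent l m i))) := by
  have h := (h₁.add h₂).mono (N' := fun g => N₁ g + N₂ g)
    (S' := fun g => (2 * ((m - 2).factorial * i) : ℝ≥0∞) * ∫⁻ x, g x ∂μ)
    (Bp' := fun l => (2 * ((m - 2).factorial * i) : ℝ≥0∞) * eexp (cp l))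
    (Bm' := fun l => (2 * ((m - 2).factorial * i) : ℝ≥0∞) * eexp (cm l))
    (fun g _ => rfl) (fun g _ => by ring) (fun l _ => le_of_eq (by ring))
    (fun l _ => le_of_eq (by ring))
  have hi0 : (0 : ℝ) < i := by exact_mod_cast hi
  have hc : (2 * ((m - 2).factorial * i) : ℝ≥0∞) * ENNReal.ofReal (1 / (β - α)) =
      m.factorial := by
    rw [hlen, ← ENNReal.ofReal_natCast, ← ENNReal.ofReal_natCast, ← ENNReal.ofReal_natCast,
      ← ENNReal.ofReal_ofNat, ← ENNReal.ofReal_mul (by positivity),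
      ← ENNReal.ofReal_mul (by positivity), ← ENNReal.ofReal_mul (by positivity),
      factorial_eq_mul hm]
    congr 1; field_simp
  refine (h.step hμ hαβ hep hem).mono (fun g _ => rfl) (fun g _ => by rw [hc]) (fun l hl => ?_)
    (fun l hl => ?_)
  · calc _ = (2 * ((m - 2).factorial * i) : ℝ≥0∞) * eexp (l * ep + cp l) := by
          rw [eexp_add]; ring
      _ ≤ _ := by gcongr; exact eexp_mono (hcp l hl)
  · calc _ = (2 * ((m - 2).factorial * i) : ℝ≥0∞) * eexp (l * em + cm l) := by
          rw [eexp_add]; ring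
      _ ≤ (2 * ((m - 2).factorial * i) : ℝ≥0∞) * eexp (κ l + stepExponent l m i) := by
          gcongr; exact eexp_mono (hcm l hl)
      _ = _ := by rw [eexp_add]; ring

/-- The bound summed over the sub-lists is turned into the bound of the induction hypothesis. If
`√m (1 - l / 8)` is less than `137 / 20`, the trivial bound `exp (l m)` is already good enough,
otherwise the summation `sum_step_le` applies. -/
lemma Cpl.finish [IsProbabilityMeasure μ] (hμ : μ (Set.Icc 0 1)ᶜ = 0) (hm : 47 ≤ m) {κ : ℝ → ℝ}
    (hκ : ∀ l ∈ Set.Icc (0 : ℝ) 4, 0 ≤ κ l)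
    (h : Cpl N (fun g => (m.factorial : ℝ≥0∞) * ∫⁻ x, g x ∂μ) m (fun l => stepBound l m)
      (fun l => eexp (κ l) * stepBound l m))
    (hN : N ((Set.Icc (0 : ℝ) m)ᶜ.indicator 1) = 0) :
    Cpl N (fun g => (m.factorial : ℝ≥0∞) * ∫⁻ x, g x ∂μ) m
      (fun l => (m.factorial : ℝ≥0∞) * eexp (mgfExponent l m))
      (fun l => (m.factorial : ℝ≥0∞) * eexp (mgfExponent l m + κ l)) := by
  have hs : 0 ≤ √(m : ℝ) := Real.sqrt_nonneg _
  have hs2 : √(m : ℝ) ^ 2 = m := Real.sq_sqrt (Nat.cast_nonneg _)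
  have key : ∀ l ∈ Set.Icc (0 : ℝ) 4, min (stepBound l m) ((m.factorial : ℝ≥0∞) *
      ENNReal.ofReal (Real.exp (l * m))) ≤ (m.factorial : ℝ≥0∞) * eexp (mgfExponent l m) := by
    intro l hl
    by_cases hb : 137 / 20 ≤ √m * (1 - l / 8)
    · exact (min_le_left _ _).trans (stepBound_le hm hl hb)
    · refine (min_le_right _ _).trans (mul_le_mul' le_rfl (eexp_mono ?_))
      have := mul_le_mul_of_nonneg_left (not_le.1 hb).le (mul_nonneg hl.1 hs)
      have e : l * √(m : ℝ) * (√m * (1 - l / 8)) = l * √(m : ℝ) ^ 2 * (1 - l / 8) := by ring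
      rw [e, hs2] at this
      unfold mgfExponent
      linarith
  refine (h.trivial_bound hμ (Nat.cast_nonneg m) hN).mono (fun _ _ => rfl) (fun _ _ => rfl) key
    (fun l hl => ?_)
  calc _ ≤ eexp (κ l) * min (stepBound l m) ((m.factorial : ℝ≥0∞) *
        ENNReal.ofReal (Real.exp (l * m))) := by
        rw [mul_min]
        refine min_le_min le_rfl ?_
        exact le_mul_of_one_le_left' (by
          rw [eexp, ENNReal.one_le_ofReal]; exact Real.one_le_exp (hκ l hl))
    _ ≤ eexp (κ l) * ((m.factorial : ℝ≥0∞) * eexp (mgfExponent l m)) := by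
        gcongr; exact key l hl
    _ = _ := by rw [eexp_add]; ring

/-- The number of exchanges on a sub-array of length `m` lies in `[0, m]`. -/
lemma sum_rankSum_support {A : ℕ → ℕ} {lo hi f : ℕ} (hlo : 1 ≤ lo) (hlh : hi + 1 = lo + m)
    (hA : IsBlock A lo hi) : ∑ π ∈ permsOfFinset (Finset.Ioc lo hi),
      rankSum f (π ∘ A) lo hi ((Set.Icc (0 : ℝ) m)ᶜ.indicator 1) = 0 := by
  refine Finset.sum_eq_zero fun π hπ => Finset.sum_eq_zero fun r _ => ?_
  have h := quickselectExchanges_le f r hlo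
    (hA.comp_perms (fun v hv => by simp at hv ⊢; omega) hπ)
  rw [Set.indicator_of_notMem]
  simp only [Set.mem_compl_iff, Set.mem_Icc, not_not]
  exact ⟨Nat.cast_nonneg _, by exact_mod_cast h.trans (by omega)⟩

/-- Short sub-arrays: any coupling will do, since `m ≤ (137 / 20) √m`. -/
lemma couplingBound_of_le [IsProbabilityMeasure μ] (hμ : μ (Set.Icc 0 1)ᶜ = 0) (hm1 : 1 ≤ m)
    (hm : m ≤ 46) : CouplingBound μ m := by
  intro f A lo hi hf hlo hlh hA
  have h := (Cpl.indep (μ := μ) (permsOfFinset (Finset.Ioc lo hi) ×ˢ Finset.Icc 1 (hi + 1 - lo))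
    (fun j => (quickselectExchanges f (j.1 ∘ A) lo hi j.2 : ℝ)) m).mono
    (N' := fun g => ∑ π ∈ permsOfFinset (Finset.Ioc lo hi), rankSum f (π ∘ A) lo hi g)
    (S' := fun g => (m.factorial : ℝ≥0∞) * ∫⁻ x, g x ∂μ) (fun g _ => Finset.sum_product _ _ _)
    (fun g _ => by
      rw [Finset.card_product, card_perms_of_finset, Nat.card_Icc, Nat.card_Ioc]
      obtain ⟨k, rfl⟩ := Nat.exists_eq_add_of_le' hm1
      rw [show hi - lo = k by omega, show hi + 1 - lo + 1 - 1 = k + 1 by omega,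
        Nat.factorial_succ, mul_comm k.factorial]) (fun l _ => le_rfl) (fun l _ => le_rfl)
  have hs : 0 ≤ √(m : ℝ) := Real.sqrt_nonneg _
  have hs2 : √(m : ℝ) ^ 2 = m := Real.sq_sqrt (Nat.cast_nonneg _)
  have hs3 : √(m : ℝ) ≤ 137 / 20 := by
    rw [Real.sqrt_le_left (by norm_num)]
    exact (by exact_mod_cast hm : (m : ℝ) ≤ 46).trans (by norm_num)
  have key : ∀ l ∈ Set.Icc (0 : ℝ) 4, l * m ≤ mgfExponent l m := by
    intro l hl
    have h1 := mul_le_mul_of_nonneg_left hs3 (mul_nonneg hl.1 hs)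
    have h2 : 0 ≤ l ^ 2 * m / 8 := by positivity
    rw [mul_assoc, ← sq, hs2] at h1
    unfold mgfExponent
    linarith
  refine (h.trivial_bound hμ (Nat.cast_nonneg m) (sum_rankSum_support hlo hlh hA)).mono
    (fun _ _ => rfl) (fun _ _ => rfl) (fun l hl => (min_le_right _ _).trans ?_)
    (fun l hl => (min_le_right _ _).trans ?_)
  · exact mul_le_mul' le_rfl (eexp_mono (key l hl))
  · refine mul_le_mul' le_rfl (eexp_mono ((key l hl).trans ?_))
    have := correction_nonneg hl
    split_ifs <;> linarith

variable {A : ℕ → ℕ} {lo hi f : ℕ}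

lemma IsBlock.swap_comp (hA : IsBlock A lo hi) {a b : ℕ} (ha : a ∈ Set.Icc lo hi)
    (hb : b ∈ Set.Icc lo hi) : IsBlock (Equiv.swap a b ∘ A) lo hi :=
  hA.comp_perm fun _ hv => Equiv.swap_apply_of_ne_of_ne (fun h => hv (h ▸ ha)) fun h => hv (h ▸ hb)

lemma sqrt_mem {u : ℝ} (h0 : 0 ≤ u) (h1 : u ≤ 1) : 0 ≤ √u ∧ √u ≤ 1 ∧ √u ^ 2 = u :=
  ⟨Real.sqrt_nonneg _, Real.sqrt_le_one.2 h1, Real.sq_sqrt h0⟩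

/-- The recursive step for a block whose first element is not its smallest. The pivot is uniformly
distributed on the other `m - 1` values and the rank on `m` values, so that a sub-list of length `i`
has the weight `2 i / (m (m - 1))`. It is matched with `u ∈ (i (i - 1), i (i + 1)] / (m (m - 1))`.
-/
lemma step_of_ne [IsProbabilityMeasure μ] (hμ : μ (Set.Icc 0 1)ᶜ = 0) (hfix : SolvesRDE μ)
    (hm : 47 ≤ m) (ih : ∀ i, 1 ≤ i → i < m → CouplingBound μ i) (hf : m ≤ f + 1) (hlo : 1 ≤ lo)
    (hlh : hi + 1 = lo + m) (hA : IsBlock A lo hi) (hne : A lo ≠ lo) :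
    Cpl (fun g => ∑ π ∈ permsOfFinset (Finset.Ioc lo hi), rankSum (f + 1) (π ∘ A) lo hi g)
      (fun g => (m.factorial : ℝ≥0∞) * ∫⁻ x, g x ∂μ) m (fun l => stepBound l m)
      (fun l => eexp 0 * stepBound l m) := by
  have hA1 := hA.mapsTo (show lo ∈ Set.Icc lo hi from ⟨le_rfl, by omega⟩)
  have hmR : (47 : ℝ) ≤ m := by exact_mod_cast hm
  set e : ℕ → ℝ := fun i => (i * (i - 1) : ℝ) / (m * (m - 1)) with he
  have hstep : ∀ i ∈ Finset.Ico 1 m, Cpl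
      (fun g => (∑ π ∈ permsOfFinset ((Finset.Ioc lo hi).erase (lo + i)),
          leftSum (f + 1) (π ∘ Equiv.swap (A lo) (lo + i) ∘ A) lo hi g) +
        ∑ π ∈ permsOfFinset ((Finset.Ioc lo hi).erase (hi + 1 - i)),
          rightSum (f + 1) (π ∘ Equiv.swap (A lo) (hi + 1 - i) ∘ A) lo hi g)
      (fun g => (m.factorial : ℝ≥0∞) *
        ∫⁻ u in Set.Ioc (e i) (e (i + 1)), ∫⁻ x, g (stepMap u x) ∂μ) m
      (fun l => (2 * ((m - 2).factorial * i) : ℝ≥0∞) * eexp (stepExponent l m i))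
      (fun l => eexp 0 *
        ((2 * ((m - 2).factorial * i) : ℝ≥0∞) * eexp (stepExponent l m i))) := by
    intro i hi'
    rw [Finset.mem_Ico] at hi'
    have hiR : (1 : ℝ) ≤ i := by exact_mod_cast hi'.1
    have himR : (i : ℝ) + 1 ≤ m := by exact_mod_cast hi'.2
    have hpos : (0 : ℝ) < m * (m - 1) := by nlinarith
    have h1 := core_left (μ := μ) (A := Equiv.swap (A lo) (lo + i) ∘ A) (f := f) (m := m)
      (by omega) hi'.1 (by omega) (ih i hi'.1 hi'.2) (by omega) hlo hlh
      (hA.swap_comp hA1 ⟨by omega, by omega⟩) (by simp)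
    have h2 := core_right (μ := μ) (A := Equiv.swap (A lo) (hi + 1 - i) ∘ A) (f := f) (m := m)
      (by omega) hi'.1 (by omega) (ih i hi'.1 hi'.2) (by omega) hlo hlh
      (hA.swap_comp hA1 ⟨by omega, by omega⟩) (by simp; omega)
    simp only [Function.comp_apply, Equiv.swap_apply_left] at h1 h2
    have hv : ∀ u ∈ Set.Ioc (e i) (e (i + 1)), 0 ≤ √u ∧ √u ≤ 1 ∧
        (i : ℝ) * (i - 1) ≤ √u ^ 2 * (m * (m - 1)) ∧
        √u ^ 2 * (m * (m - 1)) ≤ (i : ℝ) * (i + 1) := by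
      intro u hu
      simp only [he, Set.mem_Ioc, div_lt_iff₀ hpos, le_div_iff₀ hpos] at hu
      push_cast at hu
      have hu0 : 0 ≤ u := by
        by_contra hc
        nlinarith [mul_nonneg (by linarith : (0 : ℝ) ≤ i) (by linarith : (0 : ℝ) ≤ i - 1)]
      have hu1 : u ≤ 1 := by
        by_contra hc
        nlinarith
      obtain ⟨a1, a2, a3⟩ := sqrt_mem hu0 hu1
      rw [a3]
      exact ⟨a1, a2, by linarith [hu.1], by linarith [hu.2]⟩
    refine Cpl.step_pair hμ (by omega) hi'.1 (α := e i) (β := e (i + 1))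
      (ep := 1 + 2.5 * (((m : ℝ) - i) / (m - 1)) -
        (1 + ((i : ℝ) - 1) * (m - i - 1) / (m - 2)))
      (em := 2 * (((m : ℝ) - i) / (m - 1)) + i * (1 - i / m)) ?_ ?_ h1 h2 ?_ ?_
      (fun l hl => upper_generic_le hl (by linarith))
      (fun l hl => lower_generic_le hl (by linarith) hiR (by linarith))
    · simp only [he]
      push_cast
      rw [div_lt_div_iff_of_pos_right hpos]
      linarith
    · simp only [he]
      push_cast
      rw [← sub_div, one_div_div]
      congr 1; ring
    · intro u hu x hx
      obtain ⟨a1, a2, a3, a4⟩ := hv u hu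
      have := generic_upper (by linarith) hiR (by linarith) a1 a2 hx.1 hx.2 a3 a4
      unfold stepMap
      linarith
    · intro u hu x hx
      obtain ⟨a1, a2, a3, a4⟩ := hv u hu
      exact generic_lower (by linarith) hiR (by linarith) a1 a2 hx.1 hx.2 a3 a4
  refine (Cpl.sum _ hstep).mono (fun g _ => ?_) (fun g hg => ?_) (fun l _ => le_rfl)
    (fun l _ => by rw [stepBound, Finset.mul_sum])
  · rw [sum_perms_erase (a := A lo) (by simp; have := hA1.1; have := hA1.2; omega),
      Finset.sum_add_distrib, ← sum_Ioc_eq_sum_add hlh (fun b => ∑ π ∈ permsOfFinset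
        ((Finset.Ioc lo hi).erase b), leftSum (f + 1) (π ∘ Equiv.swap (A lo) b ∘ A) lo hi g),
      ← sum_Ioc_eq_sum_sub hlh (fun b => ∑ π ∈ permsOfFinset
        ((Finset.Ioc lo hi).erase b), rightSum (f + 1) (π ∘ Equiv.swap (A lo) b ∘ A) lo hi g),
      ← Finset.sum_add_distrib]
    refine Finset.sum_congr rfl fun b hb => ?_
    rw [← Finset.sum_add_distrib]
    refine Finset.sum_congr rfl fun π hπ => ?_
    have hπb : π b = b := mem_perms.1 hπ b (by simp)
    rw [Finset.mem_Ioc] at hb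
    exact leftSum_add_rightSum (by simp [hπb]; omega) _ _
  · rw [← Finset.mul_sum, hfix.lintegral_eq hg,
      sum_lintegral_Ioc (e := e) (k := 1) (n := m) (by omega)]
    · have e1 : e 1 = 0 := by simp [he]
      have e2 : e m = 1 := by
        simp only [he]
        rw [div_self]; nlinarith
      rw [e1, e2]
    · intro j hj _
      have hpos : (0 : ℝ) < m * (m - 1) := by nlinarith
      simp only [he]
      push_cast
      rw [div_le_div_iff_of_pos_right hpos]
      nlinarith [(Nat.cast_nonneg j : (0 : ℝ) ≤ j)]

end Step

section Step

variable {μ : Measure ℝ} {m : ℕ} {A : ℕ → ℕ} {lo hi f : ℕ}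

lemma IsBlock.tail (hA : IsBlock A lo hi) (h : A lo = lo) : IsBlock A (lo + 1) hi := by
  refine isBlock_of_mapsTo (fun p hp => ?_)
    (hA.injOn.mono (Set.Icc_subset_Icc_left (Nat.le_succ lo)))
  have h1 := hA.mapsTo (show p ∈ Set.Icc lo hi from ⟨by have := hp.1; omega, hp.2⟩)
  refine ⟨?_, h1.2⟩
  by_contra hc
  have := hp.1
  have h2 := hA.eq_of_eq (p := p) (q := lo) (by omega) hp.2 le_rfl (by have := hp.2; omega)
    (by have := h1.1; omega)
  omega

/-- If the smallest element of a block stands at its first position, the partition performs no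
exchange and splits off this element only. -/
lemma rankSum_of_eq (hlo : 1 ≤ lo) (hlt : lo < hi) (hA : IsBlock A lo hi) (h : A lo = lo)
    (g : ℝ → ℝ≥0∞) : rankSum (f + 1) A lo hi g = g 0 + rankSum f A (lo + 1) hi g := by
  have e := quickselectExchanges_succ hlt f (h := hoarePartition_of_eq hlo hlt hA h)
  unfold rankSum
  rw [show hi + 1 - lo = (hi + 1 - (lo + 1)) + 1 by omega, ← Finset.Ico_succ_right_eq_Icc,
    ← Finset.Ico_succ_right_eq_Icc, Finset.sum_eq_sum_Ico_succ_bot (by simp)]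
  congr 1
  · rw [e, if_pos (by omega), quickselectExchanges_of_le le_rfl]; simp
  · simp only [Nat.succ_eq_succ, Nat.succ_eq_add_one]
    rw [Finset.sum_Ico_add' (fun r => g (quickselectExchanges (f + 1) A lo hi r : ℝ)) 1
      (hi + 1 - (lo + 1) + 1) 1 |>.symm]
    refine Finset.sum_congr rfl fun r hr => ?_
    rw [Finset.mem_Ico] at hr
    rw [e, if_neg (by omega)]
    simp

/-- The constant `0`, coupled with `x`. -/
lemma Cpl.zero [IsProbabilityMeasure μ] (c : ℕ) :
    Cpl (fun g => (c : ℝ≥0∞) * g 0) (fun g => (c : ℝ≥0∞) * ∫⁻ x, g x ∂μ) 0 (fun _ => (c : ℝ≥0∞))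
      (fun _ => (c : ℝ≥0∞)) := by
  refine ⟨(c : ℝ≥0∞) • μ.map fun x => (0, x), inferInstance, fun g hg => ?_, fun g hg => ?_,
    fun l _ => ⟨?_, ?_⟩⟩
  · rw [lintegral_smul_measure, lintegral_map (by fun_prop) (by fun_prop)]; simp
  · rw [lintegral_smul_measure, lintegral_map (by fun_prop) (by fun_prop)]; simp
  · rw [lintegral_smul_measure, lintegral_map (by fun_prop) (by fun_prop)]; simp
  · rw [lintegral_smul_measure, lintegral_map (by fun_prop) (by fun_prop)]; simp

lemma mul_factorial_pred {m : ℕ} (hm : 1 ≤ m) :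
    ((m - 1).factorial : ℝ≥0∞) * ENNReal.ofReal m = m.factorial := by
  obtain ⟨k, rfl⟩ := Nat.exists_eq_add_of_le' hm
  rw [ENNReal.ofReal_natCast, Nat.add_sub_cancel, Nat.factorial_succ, mul_comm, Nat.cast_mul]

/-- The rank which ends the search at once, matched with `u ∈ (0, 1 / m]`. -/
lemma terminal_step [IsProbabilityMeasure μ] (hμ : μ (Set.Icc 0 1)ᶜ = 0) (hm : 1 ≤ m) :
    Cpl (fun g => ((m - 1).factorial : ℝ≥0∞) * g 0)
      (fun g => (m.factorial : ℝ≥0∞) *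
        ∫⁻ u in Set.Ioc (0 : ℝ) (1 / m), ∫⁻ x, g (stepMap u x) ∂μ) m
      (fun _ => ((m - 1).factorial : ℝ≥0∞))
      (fun l => ((m - 1).factorial : ℝ≥0∞) * eexp (l * (2 * √m))) := by
  have hmR : (1 : ℝ) ≤ m := by exact_mod_cast hm
  have hm0 : (0 : ℝ) < m := by linarith
  have h := ((Cpl.zero (μ := μ) (m - 1).factorial).step hμ (m := m) (α := 0) (β := 1 / m)
    (ep := 0) (em := 2 * √m) (by positivity) ?_ ?_).mono (N' := fun g =>
      ((m - 1).factorial : ℝ≥0∞) * g 0) (S' := fun g => (m.factorial : ℝ≥0∞) *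
        ∫⁻ u in Set.Ioc (0 : ℝ) (1 / m), ∫⁻ x, g (stepMap u x) ∂μ)
        (fun _ _ => rfl) (fun g _ => ?_) (fun l _ => le_rfl) (fun l _ => le_rfl)
  · exact h.mono (fun _ _ => rfl) (fun _ _ => rfl) (fun l _ => by simp)
      (fun l _ => le_of_eq (mul_comm _ _))
  · intro u hu x hx
    have hu1 : u ≤ 1 := hu.2.trans (by rw [div_le_one hm0]; exact hmR)
    have := (stepMap_mem ⟨hu.1.le, hu1⟩ hx).1
    nlinarith
  · intro u hu x hx
    have hu1 : u ≤ 1 := hu.2.trans (by rw [div_le_one hm0]; exact hmR)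
    obtain ⟨a1, a2, a3⟩ := sqrt_mem hu.1.le hu1
    have h1 : m * √u ≤ √m := by
      rw [Real.le_sqrt (by positivity) hm0.le, mul_pow, a3]
      have := mul_le_mul_of_nonneg_left hu.2 (by positivity : (0 : ℝ) ≤ m ^ 2)
      calc _ ≤ (m : ℝ) ^ 2 * (1 / m) := this
        _ = m := by field_simp
    have h2 : x + (1 - √u) ≤ 2 := by linarith [hx.2]
    have h3 := mul_le_mul_of_nonneg_left h2 (mul_nonneg hm0.le a1)
    unfold stepMap
    linarith
  · rw [show (1 : ℝ) / (1 / m - 0) = m by rw [sub_zero, one_div_one_div], mul_factorial_pred hm]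

/-- The case that only the smallest element is split off and that the remaining block again starts
with its smallest element, matched with `u ∈ (1 - 1 / m, 1]`. -/
lemma top_step [IsProbabilityMeasure μ] (hμ : μ (Set.Icc 0 1)ᶜ = 0) (hm : 2 ≤ m)
    {N : (ℝ → ℝ≥0∞) → ℝ≥0∞} {bp bm : ℝ → ℝ}
    (h : Cpl N (fun g => ((m - 1).factorial : ℝ≥0∞) * ∫⁻ x, g x ∂μ) ((m : ℝ) - 1)
      (fun l => ((m - 1).factorial : ℝ≥0∞) * eexp (bp l))
      (fun l => ((m - 1).factorial : ℝ≥0∞) * eexp (bm l))) :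
    Cpl N (fun g => (m.factorial : ℝ≥0∞) *
        ∫⁻ u in Set.Ioc (1 - 1 / m : ℝ) 1, ∫⁻ x, g (stepMap u x) ∂μ) m
      (fun l => ((m - 1).factorial : ℝ≥0∞) * eexp (bp l))
      (fun l => ((m - 1).factorial : ℝ≥0∞) * eexp (l + bm l)) := by
  have hmR : (2 : ℝ) ≤ m := by exact_mod_cast hm
  have hm0 : (0 : ℝ) < m := by linarith
  have hi0 : 0 < 1 / (m : ℝ) := by positivity
  have hi1 : 1 / (m : ℝ) ≤ 1 := by rw [div_le_one hm0]; linarith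
  have hmm : (m : ℝ) * (1 / m) = 1 := by field_simp
  have hv : ∀ u ∈ Set.Ioc (1 - 1 / m : ℝ) 1, 0 ≤ √u ∧ √u ≤ 1 ∧ m - 1 ≤ m * √u ^ 2 := by
    intro u hu
    obtain ⟨a1, a2, a3⟩ := sqrt_mem (by linarith [hu.1]) hu.2
    refine ⟨a1, a2, ?_⟩
    rw [a3]
    have := mul_le_mul_of_nonneg_left hu.1.le hm0.le
    linarith
  refine (h.step hμ (m := m) (α := 1 - 1 / m) (β := 1) (ep := 0) (em := 1) (by linarith)
    ?_ ?_).mono (fun _ _ => rfl) (fun g _ => ?_) (fun l _ => by simp) (fun l _ => ?_)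
  · intro u hu x hx
    obtain ⟨a1, a2, a3⟩ := hv u hu
    have h1 : m * √u ^ 2 ≤ m * √u := by
      have := mul_le_mul_of_nonneg_left a2 (mul_nonneg hm0.le a1)
      linarith
    have h2 := mul_nonneg hx.1 (by linarith : 0 ≤ m * √u - (m - 1))
    have h3 := mul_nonneg (mul_nonneg hm0.le a1) (sub_nonneg.2 a2)
    unfold stepMap
    linarith
  · intro u hu x hx
    obtain ⟨a1, a2, a3⟩ := hv u hu
    have h1 : m * √u ^ 2 ≤ m * √u := by
      have := mul_le_mul_of_nonneg_left a2 (mul_nonneg hm0.le a1)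
      linarith
    have h2 := mul_nonneg (sub_nonneg.2 hx.2) (by linarith : 0 ≤ m * √u - (m - 1))
    have h3 := mul_nonneg hm0.le (sq_nonneg (1 - √u))
    unfold stepMap
    linarith
  · rw [show (1 : ℝ) / (1 - (1 - 1 / m)) = m by rw [sub_sub_cancel, one_div_one_div],
      mul_factorial_pred (by omega)]
  · rw [eexp_add, mul_one]
    exact le_of_eq (by ring)

/-- The two extreme intervals together are accounted for by the summand `i = m - 1` of
`stepBound`. -/
lemma extreme_le {l : ℝ} (hm : 47 ≤ m) (hl : l ∈ Set.Icc (0 : ℝ) 4) :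
    0 ≤ stepExponent l m (m - 1) ∧ mgfExponent l (m - 1) ≤ stepExponent l m (m - 1) ∧
    l * (2 * √m) ≤ stepExponent l m (m - 1) ∧
    l + (mgfExponent l (m - 1) + (l - l ^ 2 / 8)) ≤
      (l - l ^ 2 / 8) + stepExponent l m (m - 1) := by
  have hmR : (47 : ℝ) ≤ m := by exact_mod_cast hm
  have hd := mul_nonneg hl.1 (sub_nonneg.2 (Real.sqrt_le_sqrt (show (m : ℝ) - 1 ≤ m by linarith)))
  have hs := mul_nonneg hl.1 (Real.sqrt_nonneg (m : ℝ))
  have hs' := mul_nonneg hl.1 (Real.sqrt_nonneg ((m : ℝ) - 1))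
  have hl2 := mul_nonneg hl.1 (sub_nonneg.2 hl.2)
  have h0 := hl.1
  have h1 : 0 ≤ l * (((m : ℝ) - (m - 1)) / (m - 1)) :=
    mul_nonneg hl.1 (div_nonneg (by linarith) (by linarith))
  have h2 : 0 ≤ l ^ 2 * m / 8 := by positivity
  have h3 : 0 ≤ l ^ 2 * (m - 1) / 8 := by
    have : (0 : ℝ) ≤ m - 1 := by linarith
    positivity
  unfold stepExponent mgfExponent
  refine ⟨?_, ?_, ?_, ?_⟩ <;> linarith

/-- The recursive step for a block whose first element is its smallest. Its partition splits off
this element without an exchange, so the next partition is taken into the same step: the rank `1` is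
matched with `(0, 1 / m]`, a sub-list of length `i ≤ m - 2` in the next partition with the interval
`1 / m + (i (i - 1), i (i + 1)] / (m (m - 1))`, and the case that no further progress is made, since
the remaining block starts with its smallest element too, with `(1 - 1 / m, 1]`. -/
lemma step_of_eq [IsProbabilityMeasure μ] (hμ : μ (Set.Icc 0 1)ᶜ = 0) (hfix : SolvesRDE μ)
    (hm : 47 ≤ m) (ih : ∀ i, 1 ≤ i → i < m → CouplingBound μ i) (hf : m ≤ f + 1) (hlo : 1 ≤ lo)
    (hlh : hi + 1 = lo + m) (hA : IsBlock A lo hi) (heq : A lo = lo) :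
    Cpl (fun g => ∑ π ∈ permsOfFinset (Finset.Ioc lo hi), rankSum (f + 1) (π ∘ A) lo hi g)
      (fun g => (m.factorial : ℝ≥0∞) * ∫⁻ x, g x ∂μ) m (fun l => stepBound l m)
      (fun l => eexp (l - l ^ 2 / 8) * stepBound l m) := by
  obtain ⟨f, rfl⟩ := Nat.exists_eq_add_of_le' (show 1 ≤ f by omega)
  have hmR : (47 : ℝ) ≤ m := by exact_mod_cast hm
  have hm1R : ((m - 1 : ℕ) : ℝ) = m - 1 := by rw [Nat.cast_sub (by omega), Nat.cast_one]
  have hAt := hA.tail heq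
  have hA1 := hAt.mapsTo (show lo + 1 ∈ Set.Icc (lo + 1) hi from ⟨le_rfl, by omega⟩)
  set B : ℕ → ℕ → ℕ := fun b => Equiv.swap (A (lo + 1)) b ∘ A with hB
  have hBt : ∀ b ∈ Set.Icc (lo + 1) hi, IsBlock (B b) (lo + 1) hi := fun b hb =>
    hAt.swap_comp hA1 hb
  have hBb : ∀ b, B b (lo + 1) = b := fun b => by simp [hB]
  set e : ℕ → ℝ := fun i => (m - 1 + i * (i - 1) : ℝ) / (m * (m - 1)) with he
  have hpos : (0 : ℝ) < m * (m - 1) := by nlinarith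
  -- for a fixed pivot of the next partition, only part of the permutations in question act on
  -- its sub-lists
  have hcoset : ∀ b ∈ Finset.Ioc (lo + 1) hi, ∀ i : ℕ, ∀ (F : (ℕ → ℕ) → (ℝ → ℝ≥0∞) → ℝ≥0∞),
      (∀ A' : ℕ → ℕ, IsBlock A' (lo + 1) hi → A' (lo + 1) = b →
        Cpl (fun g => ∑ π ∈ permsOfFinset ((Finset.Ioc (lo + 1) hi).erase b), F (π ∘ A') g)
        (fun g => ((m - 1 - 2).factorial * i : ℝ≥0∞) * ∫⁻ x, g x ∂μ) i
        (fun l => ((m - 1 - 2).factorial * i : ℝ≥0∞) * eexp (upperExponent l (m - 1) i))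
        (fun l => ((m - 1 - 2).factorial * i : ℝ≥0∞) * eexp (lowerExponent l (m - 1) i))) →
      Cpl (fun g => ∑ π ∈ permsOfFinset ((Finset.Ioc lo hi).erase b), F (π ∘ B b) g)
        (fun g => ((m - 2).factorial * i : ℝ≥0∞) * ∫⁻ x, g x ∂μ) i
        (fun l => ((m - 2).factorial * i : ℝ≥0∞) * eexp (upperExponent l (m - 1) i))
        (fun l => ((m - 2).factorial * i : ℝ≥0∞) * eexp (lowerExponent l (m - 1) i)) := by
    intro b hb i F hF
    rw [Finset.mem_Ioc] at hb
    have c1 : ((Finset.Ioc lo hi).erase b).card = m - 2 := by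
      rw [Finset.card_erase_of_mem (by simp; omega), Nat.card_Ioc]; omega
    have c2 : ((Finset.Ioc (lo + 1) hi).erase b).card = m - 1 - 2 := by
      rw [Finset.card_erase_of_mem (by simp; omega), Nat.card_Ioc]; omega
    have := Cpl.sum_cosets_const (μ := μ) (s := (Finset.Ioc lo hi).erase b)
      (t := (Finset.Ioc (lo + 1) hi).erase b) (a := i) (c := i)
      (F := fun π g => F (π ∘ B b) g) (Bp := fun l => eexp (upperExponent l (m - 1) i))
      (Bm := fun l => eexp (lowerExponent l (m - 1) i)) ?_ ?_
    · rwa [c1] at this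
    · exact Finset.erase_subset_erase _ (Finset.Ioc_subset_Ioc_left (by omega))
    · intro π hπ
      rw [c2]
      have hπb : π b = b := mem_perms.1 hπ b (by simp)
      refine hF (π ∘ B b) ((hBt b ⟨by omega, hb.2⟩).comp_perms (fun v hv => ?_) hπ)
        (by simp [hBb, hπb])
      simp at hv ⊢; omega
  have hstep : ∀ i ∈ Finset.Ico 1 (m - 1), Cpl
      (fun g => (∑ π ∈ permsOfFinset ((Finset.Ioc lo hi).erase (lo + 1 + i)),
          leftSum (f + 1) (π ∘ B (lo + 1 + i)) (lo + 1) hi g) +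
        ∑ π ∈ permsOfFinset ((Finset.Ioc lo hi).erase (hi + 1 - i)),
          rightSum (f + 1) (π ∘ B (hi + 1 - i)) (lo + 1) hi g)
      (fun g => (m.factorial : ℝ≥0∞) *
        ∫⁻ u in Set.Ioc (e i) (e (i + 1)), ∫⁻ x, g (stepMap u x) ∂μ) m
      (fun l => (2 * ((m - 2).factorial * i) : ℝ≥0∞) * eexp (stepExponent l m i))
      (fun l => eexp (l - l ^ 2 / 8) *
        ((2 * ((m - 2).factorial * i) : ℝ≥0∞) * eexp (stepExponent l m i))) := by
    intro i hi'
    rw [Finset.mem_Ico] at hi'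
    have hiR : (1 : ℝ) ≤ i := by exact_mod_cast hi'.1
    have himR : (i : ℝ) + 2 ≤ m := by exact_mod_cast (show i + 2 ≤ m by omega)
    have h1 := hcoset (lo + 1 + i) (by simp; omega) i
      (fun A' g => leftSum (f + 1) A' (lo + 1) hi g) fun A' hA' hb => by
        have := core_left (μ := μ) (A := A') (f := f) (m := m - 1) (by omega) hi'.1 (by omega)
          (ih i hi'.1 (by omega)) (by omega) (by omega) (by omega) hA' hb
        rwa [hm1R, hb] at this
    have h2 := hcoset (hi + 1 - i) (by simp; omega) i
      (fun A' g => rightSum (f + 1) A' (lo + 1) hi g) fun A' hA' hb => by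
        have := core_right (μ := μ) (A := A') (f := f) (m := m - 1) (by omega) hi'.1 (by omega)
          (ih i hi'.1 (by omega)) (by omega) (by omega) (by omega) hA' (by omega)
        rwa [hm1R, hb] at this
    have hv : ∀ u ∈ Set.Ioc (e i) (e (i + 1)), 0 ≤ √u ∧ √u ≤ 1 ∧
        (m : ℝ) - 1 + i * (i - 1) ≤ √u ^ 2 * (m * (m - 1)) ∧
        √u ^ 2 * (m * (m - 1)) ≤ (m : ℝ) - 1 + i * (i + 1) := by
      intro u hu
      simp only [he, Set.mem_Ioc, div_lt_iff₀ hpos, le_div_iff₀ hpos] at hu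
      push_cast at hu
      have hu0 : 0 ≤ u := by
        by_contra hc
        nlinarith [mul_nonneg (by linarith : (0 : ℝ) ≤ i) (by linarith : (0 : ℝ) ≤ i - 1)]
      have hu1 : u ≤ 1 := by
        by_contra hc
        nlinarith
      obtain ⟨a1, a2, a3⟩ := sqrt_mem hu0 hu1
      rw [a3]
      exact ⟨a1, a2, by linarith [hu.1], by linarith [hu.2]⟩
    refine Cpl.step_pair hμ (by omega) hi'.1 (α := e i) (β := e (i + 1))
      (ep := 3 / 2 + ((m : ℝ) - i) / (m - 1) -
        (1 + ((i : ℝ) - 1) * (m - 1 - i - 1) / (m - 1 - 2)))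
      (em := 1 + ((m : ℝ) - i) / (m - 1) + 2.08 * (√m - √i) + i * (1 - i / (m - 1)))
      (κ := fun l => l - l ^ 2 / 8) ?_ ?_ h1 h2 ?_ ?_
      (fun l hl => upper_shifted_le hl (by linarith) (by linarith))
      (fun l hl => lower_shifted_le hl (by linarith) hiR (by linarith))
    · simp only [he]
      push_cast
      rw [div_lt_div_iff_of_pos_right hpos]
      linarith
    · simp only [he]
      push_cast
      rw [← sub_div, one_div_div]
      congr 1; ring
    · intro u hu x hx
      obtain ⟨a1, a2, a3, a4⟩ := hv u hu
      have := shifted_upper (by linarith) hiR (by linarith) a1 a2 hx.1 a3 a4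
      unfold stepMap
      linarith
    · intro u hu x hx
      obtain ⟨a1, a2, a3, a4⟩ := hv u hu
      exact shifted_lower hmR hiR (by linarith) a1 hx.2 a3 a4
  have htop : Cpl (fun g => ∑ π ∈ permsOfFinset (Finset.Ioc (lo + 1) hi),
      rankSum (f + 1) (π ∘ B (lo + 1)) (lo + 1) hi g) (fun g => (m.factorial : ℝ≥0∞) *
        ∫⁻ u in Set.Ioc (1 - 1 / m : ℝ) 1, ∫⁻ x, g (stepMap u x) ∂μ) m
      (fun l => ((m - 1).factorial : ℝ≥0∞) * eexp (mgfExponent l (m - 1)))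
      (fun l => ((m - 1).factorial : ℝ≥0∞) *
        eexp (l + (mgfExponent l (m - 1) + (l - l ^ 2 / 8)))) := by
    have := ih (m - 1) (by omega) (by omega) (f + 1) (B (lo + 1)) (lo + 1) hi (by omega) (by omega)
      (by omega) (hBt _ ⟨le_rfl, by omega⟩)
    simp only [hBb, if_true, hm1R] at this
    exact top_step hμ (by omega) this
  have hterm := terminal_step (μ := μ) (m := m) hμ (by omega)
  have hfac : (2 * ((m - 2).factorial * (m - 1 : ℕ)) : ℝ≥0∞) =
      (m - 1).factorial + (m - 1).factorial := by
    rw [show m - 1 = (m - 2) + 1 by omega, Nat.factorial_succ]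
    push_cast; ring
  have hIco : Finset.Ico 1 m = insert (m - 1) (Finset.Ico 1 (m - 1)) := by
    ext; simp; omega
  refine ((Cpl.sum _ hstep).add (htop.add hterm)).mono (fun g _ => ?_) (fun g hg => ?_)
    (fun l hl => ?_) (fun l hl => ?_)
  · have e1 : ∑ π ∈ permsOfFinset (Finset.Ioc lo hi), rankSum (f + 1 + 1) (π ∘ A) lo hi g =
        ((m - 1).factorial : ℝ≥0∞) * g 0 +
        ∑ π ∈ permsOfFinset (Finset.Ioc lo hi), rankSum (f + 1) (π ∘ A) (lo + 1) hi g := by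
      rw [Finset.sum_congr rfl fun π hπ => rankSum_of_eq hlo (by omega)
        (hA.comp_perms (fun _ hv => by simp at hv ⊢; omega) hπ)
        (by simp [heq, mem_perms.1 hπ lo (by simp)]) g, Finset.sum_add_distrib, Finset.sum_const,
        card_perms_of_finset, Nat.card_Ioc, nsmul_eq_mul, show hi - lo = m - 1 by omega]
    have e2 : Finset.Ioc lo hi = insert (lo + 1) (Finset.Ioc (lo + 1) hi) := by
      ext; simp; omega
    have e3 : (Finset.Ioc lo hi).erase (lo + 1) = Finset.Ioc (lo + 1) hi := by
      rw [e2, Finset.erase_insert (by simp)]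
    have e4 : ∑ π ∈ permsOfFinset (Finset.Ioc lo hi), rankSum (f + 1) (π ∘ A) (lo + 1) hi g =
        ∑ b ∈ Finset.Ioc lo hi, ∑ π ∈ permsOfFinset ((Finset.Ioc lo hi).erase b),
          rankSum (f + 1) (π ∘ B b) (lo + 1) hi g :=
      sum_perms_erase (a := A (lo + 1)) (by simp; have := hA1.1; have := hA1.2; omega) _
    have e5 : ∑ i ∈ Finset.Ico 1 (m - 1),
        ((∑ π ∈ permsOfFinset ((Finset.Ioc lo hi).erase (lo + 1 + i)),
          leftSum (f + 1) (π ∘ B (lo + 1 + i)) (lo + 1) hi g) +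
        ∑ π ∈ permsOfFinset ((Finset.Ioc lo hi).erase (hi + 1 - i)),
          rightSum (f + 1) (π ∘ B (hi + 1 - i)) (lo + 1) hi g) =
        ∑ b ∈ Finset.Ioc (lo + 1) hi, ∑ π ∈ permsOfFinset ((Finset.Ioc lo hi).erase b),
          rankSum (f + 1) (π ∘ B b) (lo + 1) hi g := by
      rw [Finset.sum_add_distrib, ← sum_Ioc_eq_sum_add (lo := lo + 1) (hi := hi) (by omega)
        (fun b => ∑ π ∈ permsOfFinset ((Finset.Ioc lo hi).erase b),
          leftSum (f + 1) (π ∘ B b) (lo + 1) hi g),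
        ← sum_Ioc_eq_sum_sub (lo := lo + 1) (hi := hi) (by omega)
        (fun b => ∑ π ∈ permsOfFinset ((Finset.Ioc lo hi).erase b),
          rightSum (f + 1) (π ∘ B b) (lo + 1) hi g), ← Finset.sum_add_distrib]
      refine Finset.sum_congr rfl fun b hb => ?_
      rw [← Finset.sum_add_distrib]
      refine Finset.sum_congr rfl fun π hπ => ?_
      have hπb : π b = b := mem_perms.1 hπ b (by simp)
      rw [Finset.mem_Ioc] at hb
      exact leftSum_add_rightSum (by simp [hBb, hπb]; omega) _ _
    have e6 : ∑ b ∈ Finset.Ioc lo hi, ∑ π ∈ permsOfFinset ((Finset.Ioc lo hi).erase b),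
          rankSum (f + 1) (π ∘ B b) (lo + 1) hi g =
        ∑ π ∈ permsOfFinset (Finset.Ioc (lo + 1) hi),
          rankSum (f + 1) (π ∘ B (lo + 1)) (lo + 1) hi g +
        ∑ b ∈ Finset.Ioc (lo + 1) hi, ∑ π ∈ permsOfFinset ((Finset.Ioc lo hi).erase b),
          rankSum (f + 1) (π ∘ B b) (lo + 1) hi g := by
      conv_lhs => rw [e2, Finset.sum_insert (by simp), ← e2, e3]
    rw [e1, e4, e6, e5]
    ring
  · have hm' : (m : ℝ) ≠ 0 := by linarith
    have hm'' : (m : ℝ) - 1 ≠ 0 := by linarith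
    have hsum := sum_lintegral_Ioc (e := e) (k := 1) (n := m - 1) (by omega) (fun j hj _ => by
      simp only [he]
      push_cast
      rw [div_le_div_iff_of_pos_right hpos]
      nlinarith [(Nat.cast_nonneg j : (0 : ℝ) ≤ j)]) fun u => ∫⁻ x, g (stepMap u x) ∂μ
    have e1 : e 1 = 1 / m := by simp only [he]; push_cast; field_simp; ring
    have e2 : e (m - 1) = 1 - 1 / m := by
      simp only [he, hm1R]; field_simp; ring
    have hi0 : 0 ≤ 1 / (m : ℝ) := by positivity
    have hi1 : 1 / (m : ℝ) ≤ 1 - 1 / m := by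
      have : 1 / (m : ℝ) ≤ 1 / 47 := one_div_le_one_div_of_le (by norm_num) hmR
      linarith
    have hi2 : 1 - 1 / (m : ℝ) ≤ 1 := by linarith
    have e3 : ∫⁻ u in Set.Ioc (0 : ℝ) 1, ∫⁻ x, g (stepMap u x) ∂μ =
        (∫⁻ u in Set.Ioc (0 : ℝ) (1 / m), ∫⁻ x, g (stepMap u x) ∂μ) +
        ((∫⁻ u in Set.Ioc (1 / m : ℝ) (1 - 1 / m), ∫⁻ x, g (stepMap u x) ∂μ) +
        ∫⁻ u in Set.Ioc (1 - 1 / m : ℝ) 1, ∫⁻ x, g (stepMap u x) ∂μ) := by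
      rw [← lintegral_union measurableSet_Ioc (Set.Ioc_disjoint_Ioc_of_le le_rfl),
        Set.Ioc_union_Ioc_eq_Ioc hi1 hi2,
        ← lintegral_union measurableSet_Ioc (Set.Ioc_disjoint_Ioc_of_le le_rfl),
        Set.Ioc_union_Ioc_eq_Ioc hi0 (hi1.trans hi2)]
    rw [← Finset.mul_sum, hsum, e1, e2, hfix.lintegral_eq hg, e3]
    ring
  · obtain ⟨b1, b2, b3, b4⟩ := extreme_le hm hl
    have hrhs : stepBound l m = ∑ i ∈ Finset.Ico 1 (m - 1),
        (2 * ((m - 2).factorial * i) : ℝ≥0∞) * eexp (stepExponent l m i) +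
        (((m - 1).factorial : ℝ≥0∞) * eexp (stepExponent l m (m - 1)) +
          (m - 1).factorial * eexp (stepExponent l m (m - 1))) := by
      rw [stepBound, hIco, Finset.sum_insert (by simp), add_comm, hfac, hm1R, add_mul]
    rw [hrhs]
    refine add_le_add le_rfl (add_le_add (mul_le_mul' le_rfl (eexp_mono b2)) ?_)
    calc ((m - 1).factorial : ℝ≥0∞) = (m - 1).factorial * eexp 0 := by simp [eexp]
      _ ≤ _ := mul_le_mul' le_rfl (eexp_mono b1)
  · obtain ⟨b1, b2, b3, b4⟩ := extreme_le hm hl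
    have hrhs : eexp (l - l ^ 2 / 8) * stepBound l m = ∑ i ∈ Finset.Ico 1 (m - 1),
        eexp (l - l ^ 2 / 8) * ((2 * ((m - 2).factorial * i) : ℝ≥0∞) *
          eexp (stepExponent l m i)) +
        (((m - 1).factorial : ℝ≥0∞) * eexp (l - l ^ 2 / 8 + stepExponent l m (m - 1)) +
          (m - 1).factorial * eexp (l - l ^ 2 / 8 + stepExponent l m (m - 1))) := by
      rw [stepBound, hIco, Finset.sum_insert (by simp), add_comm, hfac, hm1R, eexp_add, mul_add,
        Finset.mul_sum]
      ring
    rw [hrhs]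
    refine add_le_add le_rfl (add_le_add (mul_le_mul' le_rfl (eexp_mono b4)) ?_)
    exact mul_le_mul' le_rfl (eexp_mono (by linarith [correction_nonneg hl]))

/-- The exponential moments of the difference between the number of exchanges and `m X`, by strong
induction on the length `m`. -/
theorem couplingBound [IsProbabilityMeasure μ] (hμ : μ (Set.Icc 0 1)ᶜ = 0) (hfix : SolvesRDE μ)
    (m : ℕ) (hm : 1 ≤ m) : CouplingBound μ m := by
  induction m using Nat.strong_induction_on with
  | _ m ih =>
    rcases le_or_gt m 46 with h | h
    · exact couplingBound_of_le hμ hm h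
    · intro f A lo hi hf hlo hlh hA
      obtain ⟨f, rfl⟩ := Nat.exists_eq_add_of_le' (show 1 ≤ f by omega)
      have ih' : ∀ i, 1 ≤ i → i < m → CouplingBound μ i := fun i h1 h2 => ih i h2 h1
      have hs := sum_rankSum_support (f := f + 1) hlo hlh hA
      by_cases heq : A lo = lo
      · simp only [if_pos heq]
        exact (step_of_eq hμ hfix h ih' hf hlo hlh hA heq).finish hμ h
          (fun l hl => correction_nonneg hl) hs
      · simp only [if_neg heq]
        exact (step_of_ne hμ hfix h ih' hf hlo hlh hA heq).finish hμ h (κ := fun _ => 0)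
          (fun l hl => le_rfl) hs

end Step

/-! ### The fixed point equation -/

instance isProbabilityMeasure_uniform :
    IsProbabilityMeasure (volume.restrict (Set.Icc (0 : ℝ) 1)) :=
  ⟨by simp⟩

/-- The characteristic functions of a fixed point satisfy an integral equation. -/
lemma SolvesRDE.charFun_eq {μ : Measure ℝ} [IsProbabilityMeasure μ] (h : SolvesRDE μ) (t : ℝ) :
    charFun μ t = ∫ u in (0 : ℝ)..1,
      Complex.exp (t * (√u * (1 - √u) : ℝ) * Complex.I) * charFun μ (t * √u) := by
  have hm : Measurable fun z : ℝ × ℝ => √z.2 * z.1 + √z.2 * (1 - √z.2) := by fun_prop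
  rw [intervalIntegral.integral_of_le zero_le_one]
  conv_lhs => rw [charFun_apply_real, h]
  rw [integral_map hm.aemeasurable (by fun_prop), integral_prod_symm, restrict_Ioc_eq_restrict_Icc]
  · refine integral_congr_ae (Filter.Eventually.of_forall fun u => ?_)
    beta_reduce
    rw [charFun_apply_real, ← integral_const_mul]
    refine integral_congr_ae (Filter.Eventually.of_forall fun x => ?_)
    beta_reduce
    rw [← Complex.exp_add]
    congr 1
    push_cast; ring
  · refine Integrable.of_bound (by fun_prop) 1 (Filter.Eventually.of_forall fun z => ?_)
    rw [← Complex.ofReal_mul, Complex.norm_exp_ofReal_mul_I]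

/-- A fixed point is unique: at a point of `[-|t|, |t|]` at which the difference of two
characteristic functions is largest, the integral equation forces this difference to be constant
on the way down to `0`, where it vanishes. -/
lemma SolvesRDE.unique {μ ν : Measure ℝ} [IsProbabilityMeasure μ] [IsProbabilityMeasure ν]
    (hμ : SolvesRDE μ) (hν : SolvesRDE ν) : μ = ν := by
  refine Measure.ext_of_charFun (funext fun t => ?_)
  set δ : ℝ → ℝ := fun s => ‖charFun μ s - charFun ν s‖ with hδ
  have hδc : Continuous δ := by fun_prop
  have hδ0 : δ 0 = 0 := by simp [hδ]
  have hle : ∀ s, δ s ≤ ∫ u in (0 : ℝ)..1, δ (s * √u) := by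
    intro s
    have hc : ∀ (ρ : Measure ℝ) [IsProbabilityMeasure ρ], Continuous fun u : ℝ =>
        Complex.exp (s * (√u * (1 - √u) : ℝ) * Complex.I) * charFun ρ (s * √u) := by
      intro ρ _
      exact (by fun_prop : Continuous fun u : ℝ =>
        Complex.exp (s * (√u * (1 - √u) : ℝ) * Complex.I)).mul
        (continuous_charFun.comp (by fun_prop))
    simp only [hδ]
    rw [hμ.charFun_eq s, hν.charFun_eq s, ← intervalIntegral.integral_sub
      ((hc μ).intervalIntegrable _ _) ((hc ν).intervalIntegrable _ _)]
    refine (intervalIntegral.norm_integral_le_integral_norm zero_le_one).trans (le_of_eq ?_)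
    refine intervalIntegral.integral_congr fun u _ => ?_
    rw [← mul_sub, norm_mul, ← Complex.ofReal_mul, Complex.norm_exp_ofReal_mul_I, one_mul]
  obtain ⟨s, hs, hmax⟩ := (isCompact_Icc (a := -|t|) (b := |t|)).exists_isMaxOn
    ⟨0, by simp⟩ hδc.continuousOn
  have hmax' : ∀ u ∈ Set.Icc (0 : ℝ) 1, δ (s * √u) ≤ δ s := by
    intro u hu
    refine hmax ?_
    have h1 : |s| ≤ |t| := abs_le.2 hs
    have h2 : |s * √u| ≤ |t| := by
      rw [abs_mul, abs_of_nonneg (Real.sqrt_nonneg u)]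
      have := mul_le_mul_of_nonneg_left (Real.sqrt_le_one.2 hu.2) (abs_nonneg s)
      linarith
    exact abs_le.1 h2
  have hs0 : δ s = 0 := by
    by_contra hne
    have hpos : 0 < δ s := lt_of_le_of_ne (norm_nonneg _) (Ne.symm hne)
    have := intervalIntegral.integral_lt_integral_of_continuousOn_of_le_of_exists_lt
      (f := fun u => δ (s * √u)) (g := fun _ => δ s) zero_lt_one
      (hδc.comp (by fun_prop)).continuousOn continuousOn_const
      (fun u hu => hmax' u ⟨hu.1.le, hu.2⟩) ⟨0, by simp, by simpa [hδ0] using hpos⟩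
    simp only [intervalIntegral.integral_const, sub_zero, one_smul] at this
    exact absurd (hle s) (not_le.2 this)
  have ht : δ t ≤ δ s := hmax ⟨neg_abs_le t, le_abs_self t⟩
  have : δ t = 0 := le_antisymm (ht.trans hs0.le) (norm_nonneg _)
  exact sub_eq_zero.1 (norm_eq_zero.1 this)

/-- The law of a sequence of independent uniformly distributed random variables. -/
noncomputable def uniformSeq : Measure (ℕ → ℝ) :=
  Measure.infinitePi fun _ => volume.restrict (Set.Icc (0 : ℝ) 1)

instance : IsProbabilityMeasure uniformSeq := by unfold uniformSeq; infer_instance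

/-- Putting `u` in front of the sequence `ω`. -/
def consSeq (z : ℝ × (ℕ → ℝ)) : ℕ → ℝ
  | 0 => z.1
  | n + 1 => z.2 n

lemma measurable_consSeq : Measurable consSeq := by
  refine measurable_pi_iff.2 fun n => ?_
  cases n with
  | zero => exact measurable_fst
  | succ n => exact (measurable_pi_apply n).comp measurable_snd

lemma map_consSeq :
    ((volume.restrict (Set.Icc (0 : ℝ) 1)).prod uniformSeq).map consSeq = uniformSeq := by
  refine Measure.eq_infinitePi _ fun s t ht => ?_
  obtain ⟨n, hn⟩ := s.exists_nat_subset_range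
  have hn' : s ⊆ Finset.range (n + 1) :=
    hn.trans (Finset.range_subset_range.2 (Nat.le_succ n))
  set t' : ℕ → Set ℝ := fun i => if i ∈ s then t i else Set.univ with ht'
  have ht'm : ∀ i, MeasurableSet (t' i) := fun i => by
    simp only [ht']; split_ifs
    exacts [ht i, MeasurableSet.univ]
  have h1 : Set.pi (s : Set ℕ) t = Set.pi (Finset.range (n + 1) : Set ℕ) t' := by
    ext ω
    simp only [Set.mem_pi, Finset.mem_coe, ht']
    constructor
    · intro h i _
      split_ifs with hi
      exacts [h i hi, trivial]
    · intro h i hi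
      have := h i (hn' hi)
      rwa [if_pos hi] at this
  have h2 : ∏ i ∈ s, volume.restrict (Set.Icc (0 : ℝ) 1) (t i) =
      ∏ i ∈ Finset.range (n + 1), volume.restrict (Set.Icc (0 : ℝ) 1) (t' i) := by
    refine Finset.prod_subset_one_on_sdiff hn' (fun i hi => ?_) (fun i hi => ?_)
    · simp only [ht', if_neg (Finset.mem_sdiff.1 hi).2, measure_univ]
    · simp only [ht', if_pos hi]
  have h3 : consSeq ⁻¹' Set.pi (Finset.range (n + 1) : Set ℕ) t' =
      t' 0 ×ˢ Set.pi (Finset.range n : Set ℕ) fun i => t' (i + 1) := by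
    ext z
    simp only [Set.mem_preimage, Set.mem_pi, Finset.coe_range, Set.mem_Iio, Set.mem_prod]
    constructor
    · exact fun h => ⟨h 0 (Nat.succ_pos n), fun i hi => h (i + 1) (Nat.succ_lt_succ hi)⟩
    · rintro ⟨h0, h⟩ i hi
      cases i with
      | zero => exact h0
      | succ i => exact h i (Nat.lt_of_succ_lt_succ hi)
  rw [h1, h2, Measure.map_apply measurable_consSeq
    (MeasurableSet.pi (Finset.countable_toSet _) fun i _ => ht'm i), h3, Measure.prod_prod,
    uniformSeq, Measure.infinitePi_pi _ fun i _ => ht'm _, Finset.prod_range_succ', mul_comm]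

/-- The perpetuity `∑ₙ √U₀ ⋯ √Uₙ₋₁ √Uₙ (1 - √Uₙ)`. The square roots are cut off at `1`, which does
not change the law. -/
noncomputable def perpetuity (ω : ℕ → ℝ) : ℝ≥0∞ :=
  ∑' n, ENNReal.ofReal ((∏ k ∈ Finset.range n, min 1 √(ω k)) *
    (min 1 √(ω n) * (1 - min 1 √(ω n))))

@[fun_prop]
lemma measurable_perpetuity : Measurable perpetuity := by
  unfold perpetuity; fun_prop

lemma perpetuity_consSeq (u : ℝ) (ω : ℕ → ℝ) : perpetuity (consSeq (u, ω)) =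
    ENNReal.ofReal (min 1 √u * (1 - min 1 √u)) + ENNReal.ofReal (min 1 √u) * perpetuity ω := by
  have h0 : 0 ≤ min 1 √u := le_min zero_le_one (Real.sqrt_nonneg u)
  unfold perpetuity
  rw [tsum_eq_zero_add' ENNReal.summable, ← ENNReal.tsum_mul_left]
  congr 1
  · simp [consSeq]
  · refine tsum_congr fun n => ?_
    rw [← ENNReal.ofReal_mul h0, Finset.prod_range_succ']
    simp only [consSeq]
    congr 1; ring

/-- The partial sums obey the recursion `x ↦ s x + s (1 - s)` with `s ∈ [0, 1]`, which preserves
`x ≤ 1`. -/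
lemma perpetuity_le_one (ω : ℕ → ℝ) : perpetuity ω ≤ 1 := by
  refine ENNReal.tsum_le_of_sum_range_le fun n => ?_
  induction n generalizing ω with
  | zero => simp
  | succ n ih =>
    have h0 : 0 ≤ min 1 √(ω 0) := le_min zero_le_one (Real.sqrt_nonneg _)
    have h1 : min 1 √(ω 0) ≤ 1 := min_le_left _ _
    rw [Finset.sum_range_succ']
    calc _ = ENNReal.ofReal (min 1 √(ω 0)) * ∑ i ∈ Finset.range n,
          ENNReal.ofReal ((∏ k ∈ Finset.range i, min 1 √(ω (k + 1))) *
            (min 1 √(ω (i + 1)) * (1 - min 1 √(ω (i + 1))))) +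
          ENNReal.ofReal (min 1 √(ω 0) * (1 - min 1 √(ω 0))) := by
          rw [Finset.mul_sum]
          congr 1
          · refine Finset.sum_congr rfl fun i _ => ?_
            rw [← ENNReal.ofReal_mul h0, Finset.prod_range_succ']
            congr 1; ring
          · simp
      _ ≤ ENNReal.ofReal (min 1 √(ω 0)) * 1 +
          ENNReal.ofReal (min 1 √(ω 0) * (1 - min 1 √(ω 0))) := by
          gcongr
          exact ih fun k => ω (k + 1)
      _ = ENNReal.ofReal (min 1 √(ω 0) + min 1 √(ω 0) * (1 - min 1 √(ω 0))) := by
          rw [mul_one, ENNReal.ofReal_add h0 (mul_nonneg h0 (sub_nonneg.2 h1))]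
      _ ≤ 1 := by
          rw [ENNReal.ofReal_le_one]
          nlinarith [sq_nonneg (1 - min 1 √(ω 0))]

/-- The law of the perpetuity, the fixed point. -/
noncomputable def fixedLaw : Measure ℝ := uniformSeq.map fun ω => (perpetuity ω).toReal

instance : IsProbabilityMeasure fixedLaw := by
  unfold fixedLaw
  exact Measure.isProbabilityMeasure_map (by fun_prop)

lemma fixedLaw_compl : fixedLaw (Set.Icc 0 1)ᶜ = 0 := by
  rw [fixedLaw, Measure.map_apply (by fun_prop) measurableSet_Icc.compl]
  convert measure_empty (μ := uniformSeq)
  ext ω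
  simp only [Set.mem_preimage, Set.mem_compl_iff, Set.mem_Icc, Set.mem_empty_iff_false, iff_false,
    not_not]
  exact ⟨ENNReal.toReal_nonneg, ENNReal.toReal_le_of_le_ofReal zero_le_one
    (by simpa using perpetuity_le_one ω)⟩

lemma solvesRDE_fixedLaw : SolvesRDE fixedLaw := by
  have hX : Measurable fun ω => (perpetuity ω).toReal := by fun_prop
  have hF : Measurable fun z : ℝ × ℝ => √z.2 * z.1 + √z.2 * (1 - √z.2) := by fun_prop
  unfold SolvesRDE
  have h1 : fixedLaw.prod (volume.restrict (Set.Icc (0 : ℝ) 1)) =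
      (((volume.restrict (Set.Icc (0 : ℝ) 1)).prod uniformSeq).map Prod.swap).map
        (Prod.map (fun ω => (perpetuity ω).toReal) id) := by
    rw [Measure.prod_swap, ← Measure.map_prod_map _ _ hX measurable_id, Measure.map_id, fixedLaw]
  rw [h1, Measure.map_map hF (by fun_prop), Measure.map_map (by fun_prop) (by fun_prop)]
  conv_lhs => rw [fixedLaw, ← map_consSeq, Measure.map_map hX measurable_consSeq]
  refine Measure.map_congr ?_
  have hae : ∀ᵐ z ∂((volume.restrict (Set.Icc (0 : ℝ) 1)).prod uniformSeq),
      z.1 ∈ Set.Icc (0 : ℝ) 1 :=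
    Measure.quasiMeasurePreserving_fst.ae (ae_restrict_mem measurableSet_Icc)
  filter_upwards [hae] with z hz
  have h2 : min 1 √z.1 = √z.1 := min_eq_right (Real.sqrt_le_one.2 hz.2)
  have h3 : 0 ≤ √z.1 * (1 - √z.1) :=
    mul_nonneg (Real.sqrt_nonneg _) (sub_nonneg.2 (Real.sqrt_le_one.2 hz.2))
  have h4 : perpetuity z.2 ≠ ∞ := ((perpetuity_le_one z.2).trans_lt ENNReal.one_lt_top).ne
  simp only [Function.comp_apply, Prod.map, Prod.swap, id]
  rw [show z = (z.1, z.2) from rfl, perpetuity_consSeq, h2, ENNReal.toReal_add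
    ENNReal.ofReal_ne_top (ENNReal.mul_ne_top ENNReal.ofReal_ne_top h4), ENNReal.toReal_mul,
    ENNReal.toReal_ofReal h3, ENNReal.toReal_ofReal (Real.sqrt_nonneg _), add_comm]

/-- Every fixed point is concentrated on `[0, 1]`, being the law of the perpetuity. -/
lemma SolvesRDE.compl_Icc {μ : Measure ℝ} [IsProbabilityMeasure μ] (h : SolvesRDE μ) :
    μ (Set.Icc 0 1)ᶜ = 0 := by
  rw [h.unique solvesRDE_fixedLaw]
  exact fixedLaw_compl

/-! ### The coupling for Quickselect on a random permutation -/

section Root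

variable {n : ℕ}

lemma arrayOfPerm_apply (σ : Equiv.Perm (Fin n)) {k : ℕ} (h : k - 1 < n) :
    arrayOfPerm σ k = σ ⟨k - 1, h⟩ + 1 := dif_pos h

lemma isBlock_arrayOfPerm (σ : Equiv.Perm (Fin n)) : IsBlock (arrayOfPerm σ) 1 n := by
  refine isBlock_of_mapsTo (fun p hp => ?_) (fun p hp q hq h => ?_)
  · have hp' : p - 1 < n := by have := hp.1; have := hp.2; omega
    rw [arrayOfPerm_apply σ hp']
    exact ⟨by omega, (σ ⟨p - 1, hp'⟩).2⟩
  · have hp' : p - 1 < n := by have := hp.1; have := hp.2; omega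
    have hq' : q - 1 < n := by have := hq.1; have := hq.2; omega
    rw [arrayOfPerm_apply σ hp', arrayOfPerm_apply σ hq'] at h
    have h1 := σ.injective (Fin.ext (Nat.succ_injective h))
    simp only [Fin.mk.injEq] at h1
    have := hp.1
    have := hq.1
    omega

/-- A permutation of the values `2, …, n` acts on the permutations of size `n`. -/
lemma exists_mul_arrayOfPerm {π : Equiv.Perm ℕ} (hπ : π ∈ permsOfFinset (Finset.Ioc 1 n)) :
    ∃ ρ : Equiv.Perm (Fin n), ∀ σ, arrayOfPerm (ρ * σ) = π ∘ arrayOfPerm σ := by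
  have hv : ∀ i : Fin n, 1 ≤ π (i + 1) ∧ π (i + 1) ≤ n := by
    intro i
    by_cases h : (i : ℕ) + 1 ∈ Finset.Ioc 1 n
    · have := (perms_apply_mem hπ).2 h
      rw [Finset.mem_Ioc] at this
      omega
    · rw [mem_perms.1 hπ _ h]
      have := i.2
      omega
  have hinj : Function.Injective fun i : Fin n =>
      (⟨π (i + 1) - 1, by have := hv i; omega⟩ : Fin n) := by
    intro i j h
    simp only [Fin.mk.injEq] at h
    have := π.injective (show π (i + 1) = π (j + 1) by have := hv i; have := hv j; omega)
    exact Fin.ext (by omega)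
  refine ⟨Equiv.ofBijective _ (Finite.injective_iff_bijective.1 hinj), fun σ => funext fun k => ?_⟩
  simp only [Function.comp_apply]
  by_cases hk : k - 1 < n
  · rw [arrayOfPerm_apply _ hk, arrayOfPerm_apply _ hk]
    have := hv (σ ⟨k - 1, hk⟩)
    simp only [Equiv.Perm.coe_mul, Function.comp_apply, Equiv.ofBijective_apply]
    omega
  · simp only [arrayOfPerm, dif_neg hk]
    -- outside the array both sides are `0`
    exact (mem_perms.1 hπ 0 (by simp)).symm

/-- The law of `Yₙ / n` as a normalised sum over all permutations and ranks. -/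
lemma scaledExchangesLaw_apply [NeZero n] {s : Set ℝ} (hs : MeasurableSet s) :
    scaledExchangesLaw n s = ((n.factorial * n : ℕ) : ℝ≥0∞)⁻¹ *
      ∑ σ : Equiv.Perm (Fin n), rankSum n (arrayOfPerm σ) 1 n
        fun y => s.indicator 1 (y / n) := by
  let _ : MeasurableSpace (Equiv.Perm (Fin n) × Fin n) := ⊤
  rw [scaledExchangesLaw, PMF.toMeasure_map_apply _ _ _ (measurable_from_top) hs,
    PMF.toMeasure_apply_fintype, Finset.mul_sum, Fintype.sum_prod_type]
  refine Finset.sum_congr rfl fun σ _ => ?_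
  have h1 : ∀ F : ℕ → ℝ≥0∞, ∑ r ∈ Finset.Icc 1 (n + 1 - 1), F r = ∑ R : Fin n, F (R + 1) := by
    intro F
    rw [Fin.sum_univ_eq_sum_range (fun i => F (i + 1)) n, Finset.range_eq_Ico,
      Finset.sum_Ico_add' F 0 n 1]
    rfl
  rw [rankSum, h1, Finset.mul_sum]
  refine Finset.sum_congr rfl fun R _ => ?_
  by_cases h : (keyExchanges σ R : ℝ) / n ∈ s
  · have h' : (quickselectExchanges n (arrayOfPerm σ) 1 n (R + 1) : ℝ) / n ∈ s := h
    rw [Set.indicator_of_mem h', Set.indicator_of_mem (by exact h)]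
    simp [Fintype.card_perm]
  · have h' : (quickselectExchanges n (arrayOfPerm σ) 1 n (R + 1) : ℝ) / n ∉ s := h
    rw [Set.indicator_of_notMem h', Set.indicator_of_notMem (by exact h), mul_zero]

/-- The number of exchanges on a random permutation of size `n` can be coupled with `n X` in such a
way that the exponential moments of the difference are bounded. The sum over all permutations is
averaged over the group of permutations that fix the smallest value, for which `couplingBound` is
stated. -/
lemma exists_coupling [NeZero n] {μ : Measure ℝ} [IsProbabilityMeasure μ] (hfix : SolvesRDE μ) :
    ∃ γ : Measure (ℝ × ℝ), γ.map (fun z => z.1 / (n : ℝ)) = scaledExchangesLaw n ∧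
      γ.map Prod.snd = μ ∧ (∀ᵐ z ∂γ, |z.1 - (n : ℝ) * z.2| ≤ n) ∧ ∀ l ∈ Set.Icc (0 : ℝ) 4,
        ∫⁻ z, eexp (l * (z.1 - (n : ℝ) * z.2)) ∂γ ≤ eexp (mgfExponent l n + l) ∧
        ∫⁻ z, eexp (-l * (z.1 - (n : ℝ) * z.2)) ∂γ ≤ eexp (mgfExponent l n + l) := by
  have hn : 1 ≤ n := Nat.one_le_iff_ne_zero.2 (NeZero.ne n)
  have hμ := hfix.compl_Icc
  set c : ℝ≥0∞ := ((n.factorial * n.factorial : ℕ) : ℝ≥0∞)⁻¹ with hc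
  have hc0 : c * (n.factorial * n.factorial : ℕ) = 1 := by
    refine ENNReal.inv_mul_cancel ?_ (ENNReal.natCast_ne_top _)
    exact_mod_cast (Nat.mul_pos (Nat.factorial_pos n) (Nat.factorial_pos n)).ne'
  have hc1 : c * ((n - 1).factorial : ℕ) = ((n.factorial * n : ℕ) : ℝ≥0∞)⁻¹ := by
    refine ENNReal.eq_inv_of_mul_eq_one_left ?_
    have : (n - 1).factorial * (n.factorial * n) = n.factorial * n.factorial := by
      rw [mul_left_comm, mul_comm _ n, Nat.mul_factorial_pred (by omega)]
    rw [mul_assoc, ← Nat.cast_mul, this, hc0]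
  have hsum : ∀ b : ℝ≥0∞, c * ∑ _σ : Equiv.Perm (Fin n), (n.factorial : ℝ≥0∞) * b = b := by
    intro b
    rw [Finset.sum_const, Finset.card_univ, Fintype.card_perm, Fintype.card_fin, nsmul_eq_mul,
      ← mul_assoc, ← mul_assoc, mul_assoc c, ← Nat.cast_mul, hc0, one_mul]
  have hcpl : Cpl (fun g => ((n.factorial * n : ℕ) : ℝ≥0∞)⁻¹ *
      ∑ σ : Equiv.Perm (Fin n), rankSum n (arrayOfPerm σ) 1 n g) (fun g => ∫⁻ x, g x ∂μ) n
      (fun l => eexp (mgfExponent l n + l)) (fun l => eexp (mgfExponent l n + l)) := by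
    refine ((Cpl.sum Finset.univ fun (σ : Equiv.Perm (Fin n)) _ =>
      couplingBound hμ hfix n hn n (arrayOfPerm σ) 1 n le_rfl le_rfl (add_comm _ _)
        (isBlock_arrayOfPerm σ)).smul c).mono
      (fun g _ => ?_) (fun g _ => hsum _) (fun l hl => ?_) (fun l hl => ?_)
    · rw [Finset.sum_comm, ← hc1, mul_assoc]
      congr 1
      have h4 : ∀ π ∈ permsOfFinset (Finset.Ioc 1 n), ∑ σ : Equiv.Perm (Fin n),
          rankSum n (π ∘ arrayOfPerm σ) 1 n g =
          ∑ σ : Equiv.Perm (Fin n), rankSum n (arrayOfPerm σ) 1 n g := by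
        intro π hπ
        obtain ⟨ρ, hρ⟩ := exists_mul_arrayOfPerm hπ
        simp only [← hρ]
        exact Equiv.sum_comp (Equiv.mulLeft ρ) fun σ => rankSum n (arrayOfPerm σ) 1 n g
      rw [Finset.sum_congr rfl h4, Finset.sum_const, card_perms_of_finset, Nat.card_Ioc,
        nsmul_eq_mul]
    · rw [hsum]
      exact eexp_mono (by linarith [hl.1])
    · calc _ ≤ c * ∑ _σ : Equiv.Perm (Fin n),
            (n.factorial : ℝ≥0∞) * eexp (mgfExponent l n + l) := by
            gcongr with σ
            have := correction_nonneg hl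
            have := sq_nonneg l
            refine eexp_mono ?_
            split_ifs <;> linarith [hl.1]
        _ = _ := hsum _
  obtain ⟨γ, h0, h1, h2, h3⟩ := hcpl
  refine ⟨γ, ?_, ?_, ?_, h3⟩
  · ext s hs
    rw [scaledExchangesLaw_apply hs, Measure.map_apply (by fun_prop) hs,
      ← lintegral_indicator_one ((show Measurable fun z : ℝ × ℝ => z.1 / n by fun_prop) hs)]
    exact h1 (fun y => s.indicator 1 (y / n))
      ((measurable_one.indicator hs).comp (measurable_id.div_const _))
  · ext s hs
    rw [Measure.map_apply measurable_snd hs, ← lintegral_indicator_one (measurable_snd hs),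
      ← lintegral_indicator_one hs]
    exact h2 _ (measurable_one.indicator hs)
  · have hx : ∀ᵐ z ∂γ, z.2 ∈ Set.Icc (0 : ℝ) 1 := by
      refine ae_mem_of_lintegral_indicator measurable_snd measurableSet_Icc ?_
      rw [h2 _ (measurable_one.indicator measurableSet_Icc.compl)]
      simp [lintegral_indicator_one measurableSet_Icc.compl, hμ]
    have hy : ∀ᵐ z ∂γ, z.1 ∈ Set.Icc (0 : ℝ) n := by
      refine ae_mem_of_lintegral_indicator measurable_fst measurableSet_Icc ?_
      rw [h1 _ (measurable_one.indicator measurableSet_Icc.compl)]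
      simp only [rankSum]
      rw [Finset.sum_eq_zero fun σ _ => Finset.sum_eq_zero fun r _ => ?_, mul_zero]
      have h := quickselectExchanges_le n r le_rfl (isBlock_arrayOfPerm σ)
      rw [Set.indicator_of_notMem]
      simp only [Set.mem_compl_iff, Set.mem_Icc, not_not]
      exact ⟨Nat.cast_nonneg _, by exact_mod_cast h.trans (by omega)⟩
    filter_upwards [hx, hy] with z hx hy
    have h4 := mul_le_mul_of_nonneg_left hx.2 (Nat.cast_nonneg n : (0 : ℝ) ≤ n)
    have h5 := mul_nonneg (Nat.cast_nonneg n : (0 : ℝ) ≤ n) hx.1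
    rw [abs_le]
    constructor <;> linarith [hy.1, hy.2]

end Root

/-! ### From exponential moments to `ℓ_p` -/

/-- The tail bound `2 exp (-2 t²)` gives the `p`-th moment `4 Γ(p/2 + 1) / 2^(p/2 + 1)`, at most
`4 τ_p^p`. The factor `4^(1/p)` is absorbed by the first factor of `κ_p`, by Bernoulli's inequality.
-/
lemma four_rpow_le {p : ℝ} (hp : 1 ≤ p) : (4 : ℝ) ^ (1 / p) ≤ (2 * p + 3) / (2 * p - 1) := by
  have hp0 : 0 < p := by linarith
  have h4 : (4 : ℝ) ^ (1 / p) = (1 + 1) ^ (2 / p) := by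
    rw [show (4 : ℝ) = 2 ^ (2 : ℝ) by norm_num, ← Real.rpow_mul (by norm_num)]
    norm_num
    congr 1
  rw [h4, le_div_iff₀ (by linarith)]
  rcases le_total 2 p with h | h
  · have h1 := rpow_one_add_le_one_add_mul_self (s := 1) (by norm_num) (p := 2 / p)
      (by positivity) ((div_le_one hp0).2 h)
    calc _ ≤ (1 + 2 / p * 1) * (2 * p - 1) := by gcongr; linarith
      _ = 2 * p + 3 - 2 / p := by field_simp; ring
      _ ≤ _ := by have : 0 ≤ 2 / p := by positivity
                  linarith
  · have h1 := rpow_one_add_le_one_add_mul_self (s := 1) (by norm_num) (p := 2 / p - 1)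
      (by rw [sub_nonneg, le_div_iff₀ hp0]; linarith)
      (by rw [sub_le_iff_le_add, div_le_iff₀ hp0]; linarith)
    have h2 : ((1 : ℝ) + 1) ^ (2 / p) = (1 + 1) ^ (2 / p - 1) * 2 := by
      rw [Real.rpow_sub_one (by norm_num)]; norm_num
    rw [h2]
    calc _ ≤ (1 + (2 / p - 1) * 1) * 2 * (2 * p - 1) := by gcongr; linarith
      _ = 8 - 4 / p := by field_simp; ring
      _ ≤ 2 * p + 3 := by
          rw [sub_le_iff_le_add, ← sub_le_iff_le_add', le_div_iff₀ hp0]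
          nlinarith [sq_nonneg (4 * p - 5)]

lemma tauConst_nonneg (p : ℝ) (hp : 1 ≤ p) : 0 ≤ tauConst p := by
  unfold tauConst
  have := Real.Gamma_pos_of_pos (show 0 < p / 2 + 1 by linarith)
  positivity

/-- Sub-Gaussian tails bound the moments, by integration over the tails. -/
lemma eLpNorm_le_of_tail {Ω : Type*} [MeasurableSpace Ω] {P : Measure Ω} {X : Ω → ℝ}
    (hX : Measurable X) (hX0 : ∀ ω, 0 ≤ X ω)
    (htail : ∀ t, 0 < t → P {ω | t ≤ X ω} ≤ ENNReal.ofReal (2 * Real.exp (-2 * t ^ (2 : ℝ))))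
    {p : ℝ} (hp : 1 ≤ p) :
    eLpNorm X (ENNReal.ofReal p) P ≤ ENNReal.ofReal ((4 : ℝ) ^ (1 / p) * tauConst p) := by
  have hp0 : 0 < p := by linarith
  have hG := Real.Gamma_pos_of_pos (show 0 < p / 2 + 1 by linarith)
  have hint : ∫⁻ ω, ENNReal.ofReal (X ω ^ p) ∂P ≤
      ENNReal.ofReal (4 * (1 / 2 + Real.Gamma (p / 2 + 1) / 2 ^ (p / 2 + 1))) := by
    rw [lintegral_rpow_eq_lintegral_meas_le_mul P (Filter.Eventually.of_forall hX0)
      hX.aemeasurable hp0]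
    calc _ ≤ ENNReal.ofReal p * ∫⁻ t in Set.Ioi (0 : ℝ),
          ENNReal.ofReal (2 * (t ^ (p - 1) * Real.exp (-2 * t ^ (2 : ℝ)))) := by
          refine mul_le_mul' le_rfl (setLIntegral_mono (by fun_prop) fun t ht => ?_)
          calc _ ≤ ENNReal.ofReal (2 * Real.exp (-2 * t ^ (2 : ℝ))) *
                ENNReal.ofReal (t ^ (p - 1)) := mul_le_mul' (htail t ht) le_rfl
            _ = _ := by rw [← ENNReal.ofReal_mul (by positivity)]; congr 1; ring
      _ = ENNReal.ofReal (p * (2 * (2 ^ (-(p - 1 + 1) / 2) * (1 / 2) *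
            Real.Gamma ((p - 1 + 1) / 2)))) := by
          rw [← integral_rpow_mul_exp_neg_mul_rpow two_pos (by linarith) two_pos,
            ← integral_const_mul, ENNReal.ofReal_mul hp0.le, ofReal_integral_eq_lintegral_ofReal]
          · exact (integrableOn_rpow_mul_exp_neg_mul_rpow (by linarith) two_pos two_pos).const_mul 2
          · refine (ae_restrict_iff' measurableSet_Ioi).2 (Filter.Eventually.of_forall ?_)
            intro t ht
            have := Real.rpow_nonneg (le_of_lt ht) (p - 1)
            positivity
      _ ≤ _ := by
          refine ENNReal.ofReal_le_ofReal ?_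
          have h1 : Real.Gamma (p / 2 + 1) = p / 2 * Real.Gamma (p / 2) :=
            Real.Gamma_add_one (by linarith)
          have h2 : (2 : ℝ) ^ (-(p - 1 + 1) / 2) = ((2 : ℝ) ^ (p / 2))⁻¹ := by
            rw [← Real.rpow_neg (by norm_num)]; congr 1; ring
          have h3 : (2 : ℝ) ^ (p / 2 + 1) = 2 ^ (p / 2) * 2 := by
            rw [Real.rpow_add_one (by norm_num)]
          have h4 : (0 : ℝ) < 2 ^ (p / 2) := by positivity
          rw [h2, h3, h1, sub_add_cancel]
          have h5 : 4 * (1 / 2 + p / 2 * Real.Gamma (p / 2) / (2 ^ (p / 2) * 2)) =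
              2 + p * (2 * (((2 : ℝ) ^ (p / 2))⁻¹ * (1 / 2) * Real.Gamma (p / 2))) := by
            field_simp; ring
          linarith
  rw [eLpNorm_eq_lintegral_rpow_enorm_toReal (by simpa using hp0) ENNReal.ofReal_ne_top,
    ENNReal.toReal_ofReal hp0.le]
  have h6 : ∀ ω, ‖X ω‖ₑ ^ p = ENNReal.ofReal (X ω ^ p) := fun ω => by
    rw [Real.enorm_eq_ofReal (hX0 ω), ENNReal.ofReal_rpow_of_nonneg (hX0 ω) hp0.le]
  simp only [h6]
  calc _ ≤ ENNReal.ofReal (4 * (1 / 2 + Real.Gamma (p / 2 + 1) / 2 ^ (p / 2 + 1))) ^ (1 / p) := by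
        gcongr
    _ = _ := by
        rw [ENNReal.ofReal_rpow_of_nonneg (by positivity) (by positivity),
          Real.mul_rpow (by norm_num) (by positivity), tauConst]

section Tail

variable {γ : Measure (ℝ × ℝ)} {n : ℕ}

lemma chernoff {f : ℝ × ℝ → ℝ} (hf : Measurable f) {l E c t : ℝ} (hl : 0 ≤ l)
    (h : ∫⁻ z, eexp (l * f z) ∂γ ≤ eexp E) (hE : E - l * c ≤ -2 * t ^ 2) :
    γ {z | c ≤ f z} ≤ eexp (-2 * t ^ 2) := by
  calc γ {z | c ≤ f z} ≤ γ {z | eexp (l * c) ≤ eexp (l * f z)} :=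
        measure_mono fun z hz => eexp_mono (mul_le_mul_of_nonneg_left hz hl)
    _ = eexp (-(l * c)) * (eexp (l * c) * γ {z | eexp (l * c) ≤ eexp (l * f z)}) := by
        rw [← mul_assoc, ← eexp_add, neg_add_cancel]; simp [eexp]
    _ ≤ eexp (-(l * c)) * eexp E := by
        gcongr
        exact (mul_meas_ge_le_lintegral (by unfold eexp; fun_prop) _).trans h
    _ = eexp (E - l * c) := by rw [← eexp_add]; congr 1; ring
    _ ≤ _ := eexp_mono hE

/-- The tail bound for the normalised difference, by Chernoff's bound with the order
`l = 4 t / √n`. -/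
lemma tail_le (hn : 50 ≤ n) (hb : ∀ᵐ z ∂γ, |z.1 - (n : ℝ) * z.2| ≤ n)
    (h : ∀ l ∈ Set.Icc (0 : ℝ) 4,
        ∫⁻ z, eexp (l * (z.1 - (n : ℝ) * z.2)) ∂γ ≤ eexp (mgfExponent l n + l) ∧
        ∫⁻ z, eexp (-l * (z.1 - (n : ℝ) * z.2)) ∂γ ≤ eexp (mgfExponent l n + l))
    {t : ℝ} (ht : 0 < t) :
    γ {z | t ≤ max 0 (|z.1 - (n : ℝ) * z.2| / √n - 7)} ≤
      ENNReal.ofReal (2 * Real.exp (-2 * t ^ (2 : ℝ))) := by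
  have hnR : (50 : ℝ) ≤ n := by exact_mod_cast hn
  have hs7 : 7 ≤ √(n : ℝ) := by
    rw [Real.le_sqrt (by norm_num) (by linarith)]; linarith
  have hs0 : 0 < √(n : ℝ) := by linarith
  have hs2 : √(n : ℝ) * √n = n := Real.mul_self_sqrt (by linarith)
  have hsub : {z : ℝ × ℝ | t ≤ max 0 (|z.1 - (n : ℝ) * z.2| / √n - 7)} ⊆
      {z | (7 + t) * √n ≤ |z.1 - (n : ℝ) * z.2|} := by
    intro z hz
    rcases le_max_iff.1 (show t ≤ max 0 (|z.1 - (n : ℝ) * z.2| / √n - 7) from hz) with h | h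
    · exact absurd h (not_le.2 ht)
    · exact (le_div_iff₀ hs0).1 (by linarith)
  refine (measure_mono hsub).trans ?_
  by_cases hts : √n < 7 + t
  · refine le_of_eq_of_le (measure_eq_zero_iff_ae_notMem.2 ?_) zero_le
    filter_upwards [hb] with z hz hc
    have := mul_lt_mul_of_pos_right hts hs0
    have h1 : (7 + t) * √n ≤ |z.1 - (n : ℝ) * z.2| := hc
    rw [hs2] at this
    linarith
  · have ht4 : t ≤ √n := by linarith [not_lt.1 hts]
    set l := 4 * t / √n with hl
    have hls : l * √n = 4 * t := by rw [hl]; field_simp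
    have hl0 : 0 ≤ l := by positivity
    have hl4 : l ≤ 4 := by rw [hl, div_le_iff₀ hs0]; linarith
    have hl5 : l * 7 ≤ 4 * t := by rw [← hls]; gcongr
    have hE : mgfExponent l n + l - l * ((7 + t) * √n) ≤ -2 * t ^ 2 := by
      have e1 : l ^ 2 * n / 8 = 2 * t ^ 2 := by
        rw [← hs2]; linear_combination (l * √n + 4 * t) / 8 * hls
      have e2 : l * (137 / 20) * √n = 137 / 5 * t := by linear_combination 137 / 20 * hls
      have e3 : l * ((7 + t) * √n) = (7 + t) * (4 * t) := by linear_combination (7 + t) * hls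
      unfold mgfExponent
      rw [e1, e2, e3]
      nlinarith
    have h1 := chernoff (f := fun z : ℝ × ℝ => z.1 - (n : ℝ) * z.2) (by fun_prop) hl0
      (h l ⟨hl0, hl4⟩).1 hE
    have h2 := chernoff (f := fun z : ℝ × ℝ => -(z.1 - (n : ℝ) * z.2)) (by fun_prop) hl0
      (by simpa only [mul_neg, neg_mul] using (h l ⟨hl0, hl4⟩).2) hE
    calc γ {z | (7 + t) * √n ≤ |z.1 - (n : ℝ) * z.2|} ≤
          γ ({z | (7 + t) * √n ≤ z.1 - (n : ℝ) * z.2} ∪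
          {z | (7 + t) * √n ≤ -(z.1 - (n : ℝ) * z.2)}) := measure_mono fun z hz => by
            exact le_abs.1 (show (7 + t) * √n ≤ |z.1 - (n : ℝ) * z.2| from hz)
      _ ≤ eexp (-2 * t ^ 2) + eexp (-2 * t ^ 2) := (measure_union_le _ _).trans (add_le_add h1 h2)
      _ = _ := by
          rw [← ENNReal.ofReal_add (Real.exp_pos _).le (Real.exp_pos _).le, ← two_mul,
            Real.rpow_two]

/-- The `L_p` bound for the normalised difference. For `n < 50` the trivial bound `n` for the
difference suffices. -/
lemma eLpNorm_coupling_le [IsProbabilityMeasure γ] (hn : 1 ≤ n)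
    (hb : ∀ᵐ z ∂γ, |z.1 - (n : ℝ) * z.2| ≤ n)
    (h : ∀ l ∈ Set.Icc (0 : ℝ) 4,
        ∫⁻ z, eexp (l * (z.1 - (n : ℝ) * z.2)) ∂γ ≤ eexp (mgfExponent l n + l) ∧
        ∫⁻ z, eexp (-l * (z.1 - (n : ℝ) * z.2)) ∂γ ≤ eexp (mgfExponent l n + l))
    {p : ℝ} (hp : 1 ≤ p) :
    eLpNorm (fun z => |z.1 - (n : ℝ) * z.2| / √n) (ENNReal.ofReal p) γ ≤
      ENNReal.ofReal (kappaConst p) := by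
  have hp1 : 1 ≤ ENNReal.ofReal p := by rwa [ENNReal.one_le_ofReal]
  have hτ := tauConst_nonneg p hp
  have hs0 : 0 < √(n : ℝ) := Real.sqrt_pos.2 (by exact_mod_cast hn)
  have hq : 1 ≤ (2 * p + 3) / (2 * p - 1) := by
    rw [le_div_iff₀ (by linarith)]; linarith
  rcases lt_or_ge n 50 with h50 | h50
  · have hs7 : √(n : ℝ) ≤ 7 := by
      rw [Real.sqrt_le_left (by norm_num)]
      exact (by exact_mod_cast Nat.le_of_lt_succ h50 : (n : ℝ) ≤ 49).trans (by norm_num)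
    have hbound : ∀ᵐ z ∂γ, ‖|z.1 - (n : ℝ) * z.2| / √n‖ ≤ 7 := by
      filter_upwards [hb] with z hz
      rw [Real.norm_of_nonneg (by positivity), div_le_iff₀ hs0]
      refine hz.trans ?_
      nlinarith [Real.mul_self_sqrt (Nat.cast_nonneg n : (0 : ℝ) ≤ n)]
    refine (eLpNorm_le_of_ae_bound hbound).trans ?_
    rw [measure_univ, ENNReal.one_rpow, one_mul]
    refine ENNReal.ofReal_le_ofReal ?_
    unfold kappaConst
    nlinarith
  · set X : ℝ × ℝ → ℝ := fun z => max 0 (|z.1 - (n : ℝ) * z.2| / √n - 7) with hX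
    have hXm : Measurable X := by fun_prop
    calc _ ≤ eLpNorm (fun z => (7 : ℝ) + X z) (ENNReal.ofReal p) γ := by
          refine eLpNorm_mono fun z => ?_
          have h1 := le_max_right (0 : ℝ) (|z.1 - (n : ℝ) * z.2| / √n - 7)
          have h2 := le_max_left (0 : ℝ) (|z.1 - (n : ℝ) * z.2| / √n - 7)
          rw [Real.norm_of_nonneg (by positivity),
            Real.norm_of_nonneg (by simp only [hX]; linarith)]
          simp only [hX]; linarith
      _ ≤ eLpNorm (fun _ => (7 : ℝ)) (ENNReal.ofReal p) γ + eLpNorm X (ENNReal.ofReal p) γ :=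
          eLpNorm_add_le aestronglyMeasurable_const hXm.aestronglyMeasurable hp1
      _ ≤ ENNReal.ofReal 7 + ENNReal.ofReal ((4 : ℝ) ^ (1 / p) * tauConst p) := by
          refine add_le_add ?_ (eLpNorm_le_of_tail hXm (fun z => le_max_left _ _)
            (fun t ht => tail_le h50 hb h ht) hp)
          refine (eLpNorm_le_of_ae_bound (C := 7)
            (Filter.Eventually.of_forall fun _ => by norm_num)).trans ?_
          rw [measure_univ, ENNReal.one_rpow, one_mul]
      _ = ENNReal.ofReal (7 + (4 : ℝ) ^ (1 / p) * tauConst p) := by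
          rw [ENNReal.ofReal_add (by norm_num) (by positivity)]
      _ ≤ _ := by
          refine ENNReal.ofReal_le_ofReal ?_
          have h1 := mul_le_mul_of_nonneg_right (four_rpow_le hp) hτ
          unfold kappaConst
          linarith

end Tail

/-- The coupling of `exists_coupling`, scaled by `1 / n`, bounds the minimal distance. -/
lemma minimalLp_le {μ : Measure ℝ} [IsProbabilityMeasure μ] (hfix : SolvesRDE μ) {p : ℝ}
    (hp : 1 ≤ p) (n : ℕ) [NeZero n] : minimalLp p (scaledExchangesLaw n) μ ≤
      ENNReal.ofReal (kappaConst p * (n : ℝ) ^ (-(1 / 2) : ℝ)) := by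
  have hn : 1 ≤ n := Nat.one_le_iff_ne_zero.2 (NeZero.ne n)
  have hn0 : (0 : ℝ) < n := by exact_mod_cast hn
  obtain ⟨γ, h1, h2, h3, h4⟩ := exists_coupling (n := n) hfix
  have hγ : IsProbabilityMeasure γ := by
    refine ⟨?_⟩
    have := congrArg (fun ρ : Measure ℝ => ρ Set.univ) h2
    simpa [Measure.map_apply measurable_snd MeasurableSet.univ] using this
  have hm : Measurable fun z : ℝ × ℝ => (z.1 / n, z.2) := by fun_prop
  refine (iInf₂_le (γ.map fun z : ℝ × ℝ => (z.1 / n, z.2))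
    ⟨by rw [Measure.map_map measurable_fst hm]; exact h1,
      by rw [Measure.map_map measurable_snd hm]; exact h2⟩).trans ?_
  · rw [eLpNorm_map_measure (by fun_prop) hm.aemeasurable]
    have hr : (n : ℝ) ^ (-(1 / 2) : ℝ) = (√n)⁻¹ := by
      rw [Real.rpow_neg hn0.le, Real.sqrt_eq_rpow]
    have hs0 : 0 < √(n : ℝ) := Real.sqrt_pos.2 hn0
    calc _ = eLpNorm ((√(n : ℝ))⁻¹ • fun z : ℝ × ℝ => |z.1 - (n : ℝ) * z.2| / √n)
          (ENNReal.ofReal p) γ := by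
          refine eLpNorm_congr_norm_ae (Filter.Eventually.of_forall fun z => ?_)
          simp only [Function.comp_apply, Pi.smul_apply, smul_eq_mul, Real.norm_eq_abs, abs_mul,
            abs_inv, abs_div, abs_abs, abs_of_pos hs0]
          rw [show z.1 / n - z.2 = (z.1 - (n : ℝ) * z.2) / n by field_simp, abs_div, abs_of_pos hn0]
          nth_rewrite 2 [← Real.mul_self_sqrt hn0.le]
          field_simp
      _ ≤ ENNReal.ofReal (√n)⁻¹ * ENNReal.ofReal (kappaConst p) := by
          rw [eLpNorm_const_smul, Real.enorm_eq_ofReal (by positivity)]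
          gcongr
          exact eLpNorm_coupling_le hn h3 h4 hp
      _ = _ := by rw [← ENNReal.ofReal_mul (by positivity), hr, mul_comm]

theorem mainTheorem2 :
    (∃! μ : Measure ℝ, IsProbabilityMeasure μ ∧ SolvesRDE μ) ∧
    ∀ μ : Measure ℝ, IsProbabilityMeasure μ → SolvesRDE μ →
      ∀ p : ℝ, 1 ≤ p →
        MemLp (fun x : ℝ => x) (ENNReal.ofReal p) μ ∧
        ∀ (n : ℕ) [NeZero n],
          minimalLp p (scaledExchangesLaw n) μ ≤
            ENNReal.ofReal (kappaConst p * (n : ℝ) ^ (-(1 / 2) : ℝ)) := by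
  refine ⟨⟨fixedLaw, ⟨inferInstance, solvesRDE_fixedLaw⟩, fun μ ⟨_, hμ⟩ =>
    hμ.unique solvesRDE_fixedLaw⟩, fun μ _ hfix p hp => ⟨?_, fun n _ => minimalLp_le hfix hp n⟩⟩
  refine MemLp.of_bound (by fun_prop) 1 ?_
  have h : ∀ᵐ x ∂μ, x ∈ Set.Icc (0 : ℝ) 1 := hfix.compl_Icc
  filter_upwards [h] with x hx
  rw [Real.norm_of_nonneg hx.1]
  exact hx.2
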